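/- Let $k$ be a field, let $M$ be a scheme of finite type over $k$ which is nonsingular (i.e. smooth over $k$; for instance a nonsingular variety), and let $Y\subset X\subset M$ be closed embeddings of schemes. Write $\mathcal J_{Y,X}$ for the ideal sheaf of $Y$ in $X$, and $\mathcal J_{Y,M},\mathcal J_{X,M}$ for the ideal sheaves of $Y$ and $X$ in $M$. Definitions. For closed embeddings $X\subset N$ over $k$ into schemes $N$ of finite type over $k$, the relative quasi-symmetric algebra is the graded $\mathcal O_X$-algebra $$\mathrm{qSym}_{X\subset N}(\mathcal J_{Y,X}):=\mathrm{Sym}_{\mathcal O_X}(\mathcal J_{Y,X})\otimes_{\mathrm{Sym}_{\mathcal O_N}(\mathcal J_{Y,N})}\mathrm{Rees}_{\mathcal O_N}(\mathcal J_{Y,N}),\qquad \mathrm{Rees}_{\mathcal O_N}(\mathcal J_{Y,N})=\bigoplus_{d\ge 0}\mathcal J_{Y,N}^d .$$ Closed embeddings $X\subset N\subset N'$ induce epimorphisms $\mathrm{qSym}_{X\subset N'}(\mathcal J_{Y,X})\to\mathrm{qSym}_{X\subset N}(\mathcal J_{Y,X})$. The quasi-symmetric algebra of $\mathcal J_{Y,X}$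 is the inverse limit of graded $\mathcal O_X$-algebras $$\mathrm{qSym}_{\mathcal O_X}(\mathcal J_{Y,X}):=\varprojlim_{N\supset X}\mathrm{qSym}_{X\subset N}(\mathcal J_{Y,X}),$$ and the quasi-symmetric blow-up of $X$ along $Y$ is $qB\ell_YX:=\mathrm{Proj}(\mathrm{qSym}_{\mathcal O_X}(\mathcal J_{Y,X}))$. Let $\rho: B\ell_YM=\mathrm{Proj}(\mathrm{Rees}_{\mathcal O_M}(\mathcal J_{Y,M}))\to M$ be the blow-up of $M$ along $Y$, with exceptional divisor $E=\rho^{-1}(Y)$. The principal transform of $X$ in $B\ell_YM$ is the residual scheme to $E$ in $\rho^{-1}(X)$, that is, the closed subscheme $R$ of $B\ell_Y M$ whose ideal sheaf satisfies $\mathcal I_{\rho^{-1}(X)}=\mathcal I_E\cdot\mathcal I_R$; here $E$ is an effective Cartier divisor contained in $\rho^{-1}(X)$. Theorem. (i) The limit $\mathrm{qSym}_{\mathcal O_X}(\mathcal J_{Y,X})$ exists and is a quasi-coherent graded $\mathcal O_X$-algebra, and the projection $\mathrm{qSym}_{\mathcal O_X}(\mathcal J_{Y,X})\to\mathrm{qSym}_{X\subset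 M}(\mathcal J_{Y,X})$ is an isomorphism. The resulting graded map $\varphi:\mathrm{Rees}_{\mathcal O_M}(\mathcal J_{Y,M})\to\mathrm{qSym}_{\mathcal O_X}(\mathcal J_{Y,X})$ is surjective, and its kernel in degree $d$ is $\mathcal J_{X,M}\mathcal J_{Y,M}^{d-1}$; hence $$\mathrm{qSym}_{\mathcal O_X}(\mathcal J_{Y,X})=\bigoplus_{d\ge 0}\frac{\mathcal J_{Y,M}^d}{\mathcal J_{X,M}\,\mathcal J_{Y,M}^{d-1}},\qquad\text{where } \mathcal J_{Y,M}^{-1}:=\mathcal O_M .$$ (ii) The map $\varphi$ induces a closed embedding $qB\ell_YX\subset B\ell_YM$, compatible with the projections to $X\subset M$, and its image is the principal transform of $X$ in $B\ell_YM$. -/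

import Mathlib

open CategoryTheory AlgebraicGeometry TopologicalSpace

universe u

set_option linter.style.haveILetI false
set_option linter.unusedSectionVars false

noncomputable section

namespace QSymBlowUp

/-! ### Algebra: symmetric, Rees and quasi-symmetric algebras -/

section Algebra

variable {R A : Type u} [CommRing R] [CommRing A]

/-- The symmetric algebra `Sym_A(𝔞)` of an ideal `𝔞` of `A`. -/
def Sym (𝔞 : Ideal A) : Type u := SymmetricAlgebra A 𝔞

namespace Sym

variable (𝔞 : Ideal A)

instance : CommRing (Sym 𝔞) := inferInstanceAs (CommRing (SymmetricAlgebra A 𝔞))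

instance : Algebra A (Sym 𝔞) := inferInstanceAs (Algebra A (SymmetricAlgebra A 𝔞))

/-- The inclusion of `𝔞` as the degree one part of `Sym_A(𝔞)`. -/
def ι : 𝔞 →ₗ[A] Sym 𝔞 := SymmetricAlgebra.ι A 𝔞

variable {𝔞}

/-- The universal property of the symmetric algebra. -/
def lift {B : Type*} [CommRing B] [Algebra A B] (f : 𝔞 →ₗ[A] B) : Sym 𝔞 →ₐ[A] B :=
  SymmetricAlgebra.lift f

lemma lift_ι {B : Type*} [CommRing B] [Algebra A B] (f : 𝔞 →ₗ[A] B) (x : 𝔞) :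
    lift f (ι 𝔞 x) = f x := SymmetricAlgebra.lift_ι_apply f x

/-- Two ring maps out of a symmetric algebra agree if they agree on scalars and in degree one. -/
lemma ringHom_ext {B : Type*} [CommRing B] {f g : Sym 𝔞 →+* B}
    (h0 : ∀ r, f (algebraMap A _ r) = g (algebraMap A _ r))
    (h1 : ∀ x, f (ι 𝔞 x) = g (ι 𝔞 x)) : f = g := by
  letI : Algebra A B := (f.comp (algebraMap A (Sym 𝔞))).toAlgebra
  let f' : Sym 𝔞 →ₐ[A] B := { f with commutes' := fun r => rfl }
  let g' : Sym 𝔞 →ₐ[A] B := { g with commutes' := fun r => (h0 r).symm }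
  have : f' = g' := SymmetricAlgebra.algHom_ext (LinearMap.ext h1)
  ext x
  exact congr($this x)

/-- The degree `d` part `Sym^d_A(𝔞)` of the symmetric algebra. -/
def deg (𝔞 : Ideal A) (d : ℕ) : Submodule A (Sym 𝔞) := LinearMap.range (ι 𝔞) ^ d

end Sym

/-- The ring map `Sym_R(I) → Sym_A(𝔞)` induced by `φ : R → A` with `φ(I) ⊆ 𝔞`. -/
def symMap (φ : R →+* A) (I : Ideal R) (𝔞 : Ideal A) (h : I ≤ 𝔞.comap φ) :
    Sym I →+* Sym 𝔞 :=
  letI : Algebra R (Sym 𝔞) :=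
    ((algebraMap A (Sym 𝔞)).comp φ).toAlgebra
  (Sym.lift
    ({ toFun := fun x => Sym.ι 𝔞 ⟨φ x, h x.2⟩
       map_add' := fun x y => by rw [← map_add]; congr 1; ext; simp
       map_smul' := fun r x => by
        rw [Algebra.smul_def, RingHom.algebraMap_toAlgebra]
        simp only [RingHom.id_apply, RingHom.comp_apply]
        rw [← Algebra.smul_def, ← map_smul]
        congr 1; ext; simp } : I →ₗ[R] Sym 𝔞)).toRingHom

/-- The canonical map `Sym_R(I) → Rees_R(I) = ⨁ I^d t^d`, sending `x ∈ I` to `x t`. -/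
def symToRees (I : Ideal R) : Sym I →+* reesAlgebra I :=
  (Sym.lift
    ({ toFun := fun x => ⟨Polynomial.monomial 1 (x : R),
          reesAlgebra.monomial_mem.mpr (by simp)⟩
       map_add' := fun x y => by ext1; simp
       map_smul' := fun r x => by ext1; simp [Polynomial.smul_monomial] } :
      I →ₗ[R] reesAlgebra I)).toRingHom

/-- The map `Rees_R(I) → Rees_A(𝔞)` induced by `φ : R → A` with `φ(I) ⊆ 𝔞`. -/
def reesMap (φ : R →+* A) (I : Ideal R) (𝔞 : Ideal A) (h : I ≤ 𝔞.comap φ) :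
    reesAlgebra I →+* reesAlgebra 𝔞 :=
  ((Polynomial.mapRingHom φ).comp (reesAlgebra I).val.toRingHom).codRestrict
    (reesAlgebra 𝔞) (fun p i => by
      have h1 : (p : Polynomial R).coeff i ∈ I ^ i := p.2 i
      have h2 : I ^ i ≤ (𝔞 ^ i).comap φ :=
        (Ideal.pow_right_mono h i).trans (Ideal.le_comap_pow φ i)
      simpa using h2 h1)

@[simp]
lemma coe_reesMap (φ : R →+* A) (I : Ideal R) (𝔞 : Ideal A) (h : I ≤ 𝔞.comap φ)
    (p : reesAlgebra I) :
    (reesMap φ I 𝔞 h p : Polynomial A) = (p : Polynomial R).map φ := rfl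

/-- The degree `d` part `I^d t^d` of the Rees algebra. -/
def reesDeg (I : Ideal R) (d : ℕ) : AddSubgroup (reesAlgebra I) where
  carrier := { p | ∀ i, i ≠ d → (p : Polynomial R).coeff i = 0 }
  add_mem' := fun {p q} hp hq i hi => by
    have := hp i hi
    have := hq i hi
    simp_all
  zero_mem' := fun i _ => by simp
  neg_mem' := fun {p} hp i hi => by
    have := hp i hi
    simp_all

/-- The element `x t^d` of the Rees algebra, for `x ∈ I^d`. -/
def reesMonomial (I : Ideal R) (d : ℕ) (x : R) (hx : x ∈ I ^ d) : reesAlgebra I :=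
  ⟨Polynomial.monomial d x, reesAlgebra.monomial_mem.mpr hx⟩

lemma reesMonomial_mem (I : Ideal R) (d : ℕ) (x : R) (hx : x ∈ I ^ d) :
    reesMonomial I d x hx ∈ reesDeg I d := fun i hi => by
  simp [reesMonomial, Polynomial.coeff_monomial, hi.symm]

lemma rees_eq_sum (I : Ideal R) (p : reesAlgebra I) :
    p = ∑ i ∈ (p : Polynomial R).support,
      reesMonomial I i ((p : Polynomial R).coeff i) (p.2 i) := by
  ext1
  rw [AddSubmonoidClass.coe_finsetSum]
  exact (p : Polynomial R).as_sum_support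

instance (I : Ideal R) : SetLike.GradedMonoid (reesDeg I) where
  one_mem := fun i hi => by simp [Polynomial.coeff_one, hi]
  mul_mem := fun {m n} p q hp hq i hi => by
    simp only [MulMemClass.coe_mul, Polynomial.coeff_mul]
    refine Finset.sum_eq_zero fun x hx => ?_
    rw [Finset.HasAntidiagonal.mem_antidiagonal] at hx
    by_cases h1 : x.1 = m
    · rw [hq x.2 (by omega), mul_zero]
    · rw [hp x.1 h1, zero_mul]

lemma rees_isInternal (I : Ideal R) : DirectSum.IsInternal (reesDeg I) := by
  classical
  have key : ∀ (x : DirectSum ℕ fun d => reesDeg I d) (d : ℕ),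
      ((DirectSum.coeAddMonoidHom (reesDeg I) x : reesAlgebra I) : Polynomial R).coeff d =
        ((x d : reesAlgebra I) : Polynomial R).coeff d := by
    intro x d
    induction x using DirectSum.induction_on with
    | zero => simp
    | of i y =>
      rw [DirectSum.coeAddMonoidHom_of]
      by_cases h : i = d
      · subst h; simp
      · rw [DirectSum.of_eq_of_ne _ _ _ (Ne.symm h)]
        simpa using y.2 d (Ne.symm h)
    | add x y hx hy => simp [hx, hy]
  constructor
  · intro x y hxy
    ext d : 3
    ext i
    by_cases h : i = d
    · subst h
      rw [← key, ← key, hxy]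
    · rw [(x d).2 i h, (y d).2 i h]
  · intro p
    refine ⟨∑ i ∈ (p : Polynomial R).support, DirectSum.of (fun d => reesDeg I d) i
      ⟨_, reesMonomial_mem I i ((p : Polynomial R).coeff i) (p.2 i)⟩, ?_⟩
    rw [map_sum]
    simp only [DirectSum.coeAddMonoidHom_of]
    exact (rees_eq_sum I p).symm

instance (I : Ideal R) : GradedRing (reesDeg I) where
  __ := (rees_isInternal I).chooseDecomposition

/-- The graded map between Rees algebras. -/
def reesGradedMap (φ : R →+* A) (I : Ideal R) (𝔞 : Ideal A) (h : I ≤ 𝔞.comap φ) :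
    reesDeg I →+*ᵍ reesDeg 𝔞 where
  __ := reesMap φ I 𝔞 h
  map_mem := fun {d p} hp i hi => by
    have := hp i hi
    change ((p : Polynomial R).map φ).coeff i = 0
    simp [this]

/-- If `A = R_f` and `𝔞 = I R_f`, then `Rees_A(𝔞) = Rees_R(I)_f`. -/
lemma rees_isLocalization (φ : R →+* A) (I : Ideal R) (𝔞 : Ideal A) (h : I ≤ 𝔞.comap φ)
    (f : R) (hφ : letI := φ.toAlgebra; IsLocalization.Away f A) (h𝔞 : 𝔞 = I.map φ) :
    letI := (reesMap φ I 𝔞 h).toAlgebra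
    IsLocalization.Away (algebraMap R (reesAlgebra I) f) (reesAlgebra 𝔞) := by
  letI := φ.toAlgebra
  letI := (reesMap φ I 𝔞 h).toAlgebra
  have hmap : ∀ p : reesAlgebra I,
    ((algebraMap (reesAlgebra I) (reesAlgebra 𝔞) p : reesAlgebra 𝔞) : Polynomial A) =
      (p : Polynomial R).map φ := fun p => rfl
  have hunit : IsUnit (φ f) := IsLocalization.Away.algebraMap_isUnit (S := A) f
  have hf : algebraMap (reesAlgebra I) (reesAlgebra 𝔞) (algebraMap R (reesAlgebra I) f) =
      algebraMap A (reesAlgebra 𝔞) (φ f) := by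
    ext1
    rw [hmap]
    exact Polynomial.map_C φ
  refine ⟨?_, ?_, ?_⟩
  · rintro ⟨_, n, rfl⟩
    simp only [map_pow, hf]
    exact (hunit.map _).pow n
  · intro p
    suffices H : ∃ (n : ℕ) (q : reesAlgebra I),
        p * (algebraMap A (reesAlgebra 𝔞) (φ f)) ^ n =
          algebraMap (reesAlgebra I) (reesAlgebra 𝔞) q by
      obtain ⟨n, q, hq⟩ := H
      exact ⟨(q, ⟨_, n, rfl⟩), by simpa [hf] using hq⟩
    rw [rees_eq_sum 𝔞 p]
    generalize (p : Polynomial A).support = s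
    classical
    induction s using Finset.induction_on with
    | empty => exact ⟨0, 0, by simp⟩
    | insert i s his ih =>
      obtain ⟨n, q, hq⟩ := ih
      have h1 : (p : Polynomial A).coeff i ∈ (I ^ i).map (algebraMap R A) := by
        have h0 : 𝔞 ^ i = (I ^ i).map (algebraMap R A) := by rw [h𝔞, Ideal.map_pow]; rfl
        exact h0 ▸ p.2 i
      obtain ⟨⟨⟨x, hx⟩, ⟨_, m, rfl⟩⟩, hxm⟩ :=
        (IsLocalization.mem_map_algebraMap_iff (Submonoid.powers f) A).mp h1
      refine ⟨n + m, algebraMap R _ f ^ m * q + algebraMap R _ f ^ n * reesMonomial I i x hx, ?_⟩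
      rw [Finset.sum_insert his, add_mul, map_add, map_mul, map_mul, ← hq, map_pow, map_pow, hf,
        add_comm]
      have h2 : algebraMap (reesAlgebra I) (reesAlgebra 𝔞) (reesMonomial I i x hx) =
          reesMonomial 𝔞 i _ (p.2 i) * algebraMap A (reesAlgebra 𝔞) (φ f) ^ m := by
        ext1
        rw [hmap]
        simp only [reesMonomial, Polynomial.map_monomial]
        rw [← map_pow]
        change _ = Polynomial.monomial i _ * Polynomial.C _
        rw [Polynomial.monomial_mul_C]
        congr 1
        rw [← map_pow]
        exact hxm.symm
      rw [h2]
      ring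
  · intro p q hpq
    have h1 : ∀ i, ∃ n : ℕ, f ^ n * (p : Polynomial R).coeff i =
        f ^ n * (q : Polynomial R).coeff i := by
      intro i
      have h2 : φ ((p : Polynomial R).coeff i) = φ ((q : Polynomial R).coeff i) := by
        have := congr((($hpq : reesAlgebra 𝔞) : Polynomial A).coeff i)
        simpa [hmap] using this
      obtain ⟨⟨_, n, rfl⟩, hn⟩ :=
        IsLocalization.exists_of_eq (M := Submonoid.powers f) (S := A) h2
      exact ⟨n, hn⟩
    choose n hn using h1
    let s := (p : Polynomial R).support ∪ (q : Polynomial R).support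
    refine ⟨⟨_, s.sup n, rfl⟩, ?_⟩
    ext i
    have h3 : ∀ r : reesAlgebra I, ((algebraMap R (reesAlgebra I) f ^ s.sup n * r : reesAlgebra I) :
        Polynomial R).coeff i = f ^ s.sup n * (r : Polynomial R).coeff i := by
      intro r
      rw [← map_pow]
      exact Polynomial.coeff_C_mul _
    simp only [h3]
    by_cases his : i ∈ s
    · obtain ⟨c, hc⟩ := Nat.exists_eq_add_of_le (Finset.le_sup (f := n) his)
      rw [hc, add_comm, pow_add, mul_assoc, mul_assoc, hn]
    · simp only [s, Finset.mem_union, Polynomial.mem_support_iff, not_or, not_not] at his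
      rw [his.1, his.2]

/-- The quasi-symmetric algebra `qSym_{R → A}(𝔞) = Sym_A(𝔞) ⊗_{Sym_R(I)} Rees_R(I)`;
in the applications `R → A` is surjective and `I` is the inverse image of `𝔞`. -/
def QSym (φ : R →+* A) (I : Ideal R) (𝔞 : Ideal A) (h : I ≤ 𝔞.comap φ) : Type u :=
  letI := (symMap φ I 𝔞 h).toAlgebra
  letI := (symToRees I).toAlgebra
  TensorProduct (Sym I) (Sym 𝔞) (reesAlgebra I)

namespace QSym

variable (φ : R →+* A) (I : Ideal R) (𝔞 : Ideal A) (h : I ≤ 𝔞.comap φ)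

instance : CommRing (QSym φ I 𝔞 h) :=
  @Algebra.TensorProduct.instCommRing (Sym I) (Sym 𝔞) (reesAlgebra I) _ _
    (symMap φ I 𝔞 h).toAlgebra _ (symToRees I).toAlgebra

/-- The canonical map `Sym_A(𝔞) → qSym_{R → A}(𝔞)`. -/
def inl : Sym 𝔞 →+* QSym φ I 𝔞 h :=
  letI := (symMap φ I 𝔞 h).toAlgebra
  letI := (symToRees I).toAlgebra
  (Algebra.TensorProduct.includeLeft (R := Sym I) (S := Sym I)
    (A := Sym 𝔞) (B := reesAlgebra I)).toRingHom

/-- The canonical map `Rees_R(I) → qSym_{R → A}(𝔞)`. -/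
def inr : reesAlgebra I →+* QSym φ I 𝔞 h :=
  letI := (symMap φ I 𝔞 h).toAlgebra
  letI := (symToRees I).toAlgebra
  (Algebra.TensorProduct.includeRight (R := Sym I)
    (A := Sym 𝔞) (B := reesAlgebra I)).toRingHom

lemma inl_symMap (x : Sym I) :
    inl φ I 𝔞 h (symMap φ I 𝔞 h x) = inr φ I 𝔞 h (symToRees I x) := by
  letI := (symMap φ I 𝔞 h).toAlgebra
  letI := (symToRees I).toAlgebra
  exact (Algebra.TensorProduct.includeLeft.commutes x).trans
    (Algebra.TensorProduct.includeRight (R := Sym I)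
      (A := Sym 𝔞) (B := reesAlgebra I).commutes x).symm

/-- The degree `d` part of `qSym_{R → A}(𝔞)`. As `Rees_R(I)` is generated by the image of `I` in
degree one, `Sym_A(𝔞) → qSym_{R → A}(𝔞)` is onto and the degree `d` part is the
image of `Sym^d_A(𝔞)`. -/
def deg (d : ℕ) : AddSubgroup (QSym φ I 𝔞 h) :=
  (Sym.deg 𝔞 d).toAddSubgroup.map (inl φ I 𝔞 h).toAddMonoidHom

variable {φ I 𝔞 h}

/-- The universal property of the tensor product. -/
def lift {B : Type u} [CommRing B] (f : Sym 𝔞 →+* B) (g : reesAlgebra I →+* B)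
    (hfg : ∀ x, f (symMap φ I 𝔞 h x) = g (symToRees I x)) : QSym φ I 𝔞 h →+* B :=
  letI := (symMap φ I 𝔞 h).toAlgebra
  letI := (symToRees I).toAlgebra
  letI := (f.comp (symMap φ I 𝔞 h)).toAlgebra
  (Algebra.TensorProduct.lift (R := Sym I) (S := Sym I)
    (A := Sym 𝔞) (B := reesAlgebra I) (C := B)
    { f with commutes' := fun _ => rfl }
    { g with commutes' := fun x => (hfg x).symm } (fun _ _ => Commute.all _ _)).toRingHom

lemma lift_inl {B : Type u} [CommRing B] (f : Sym 𝔞 →+* B)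
    (g : reesAlgebra I →+* B) (hfg : ∀ x, f (symMap φ I 𝔞 h x) = g (symToRees I x)) (x) :
    lift f g hfg (inl φ I 𝔞 h x) = f x := by
  letI := (symMap φ I 𝔞 h).toAlgebra
  letI := (symToRees I).toAlgebra
  letI := (f.comp (symMap φ I 𝔞 h)).toAlgebra
  exact (Algebra.TensorProduct.lift_tmul _ _ _ x 1).trans (by simp)

lemma lift_inr {B : Type u} [CommRing B] (f : Sym 𝔞 →+* B)
    (g : reesAlgebra I →+* B) (hfg : ∀ x, f (symMap φ I 𝔞 h x) = g (symToRees I x)) (x) :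
    lift f g hfg (inr φ I 𝔞 h x) = g x := by
  letI := (symMap φ I 𝔞 h).toAlgebra
  letI := (symToRees I).toAlgebra
  letI := (f.comp (symMap φ I 𝔞 h)).toAlgebra
  exact (Algebra.TensorProduct.lift_tmul _ _ _ 1 x).trans (by simp)

end QSym

lemma symMap_algebraMap (φ : R →+* A) (I : Ideal R) (𝔞 : Ideal A) (h : I ≤ 𝔞.comap φ) (r : R) :
    symMap φ I 𝔞 h (algebraMap _ _ r) = algebraMap _ _ (φ r) := by
  letI : Algebra R (Sym 𝔞) :=
    ((algebraMap A (Sym 𝔞)).comp φ).toAlgebra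
  exact AlgHom.commutes _ r

lemma symMap_ι (φ : R →+* A) (I : Ideal R) (𝔞 : Ideal A) (h : I ≤ 𝔞.comap φ) (x : I) :
    symMap φ I 𝔞 h (Sym.ι _ x) = Sym.ι _ ⟨φ x, h x.2⟩ := by
  letI : Algebra R (Sym 𝔞) :=
    ((algebraMap A (Sym 𝔞)).comp φ).toAlgebra
  exact Sym.lift_ι _ _

lemma symToRees_algebraMap (I : Ideal R) (r : R) :
    symToRees I (algebraMap _ _ r) = algebraMap _ _ r :=
  AlgHom.commutes _ r

lemma symToRees_ι (I : Ideal R) (x : I) :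
    symToRees I (Sym.ι _ x) = reesMonomial I 1 x (by simp) :=
  Sym.lift_ι _ _

/-- The map `qSym_{R → A}(𝔞) → qSym_{R' → A'}(𝔞')` induced by a commutative square of rings. -/
def QSym.map {R' A' : Type u} [CommRing R'] [CommRing A']
    {φ : R →+* A} {I : Ideal R} {𝔞 : Ideal A} {h : I ≤ 𝔞.comap φ}
    {φ' : R' →+* A'} {I' : Ideal R'} {𝔞' : Ideal A'} {h' : I' ≤ 𝔞'.comap φ'}
    (r : R →+* R') (a : A →+* A') (comm : a.comp φ = φ'.comp r)
    (hI : I ≤ I'.comap r) (ha : 𝔞 ≤ 𝔞'.comap a) : QSym φ I 𝔞 h →+* QSym φ' I' 𝔞' h' :=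
  QSym.lift ((QSym.inl φ' I' 𝔞' h').comp (symMap a 𝔞 𝔞' ha))
    ((QSym.inr φ' I' 𝔞' h').comp (reesMap r I I' hI)) (fun x => by
      have h1 : (symMap a 𝔞 𝔞' ha).comp (symMap φ I 𝔞 h) =
          (symMap φ' I' 𝔞' h').comp (symMap r I I' hI) := by
        refine Sym.ringHom_ext (fun s => ?_) (fun s => ?_)
        · simp only [RingHom.comp_apply, symMap_algebraMap]
          congr 1; exact congr($comm s)
        · simp only [RingHom.comp_apply, symMap_ι]
          congr 1; ext; exact congr($comm s)
      have h2 : (reesMap r I I' hI).comp (symToRees I) =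
          (symToRees I').comp (symMap r I I' hI) := by
        refine Sym.ringHom_ext (fun s => ?_) (fun s => ?_)
        · simp only [RingHom.comp_apply, symMap_algebraMap, symToRees_algebraMap]
          ext1
          exact Polynomial.map_C r
        · simp only [RingHom.comp_apply, symMap_ι, symToRees_ι]
          ext1
          exact Polynomial.map_monomial r
      simp only [RingHom.comp_apply]
      rw [show symMap a 𝔞 𝔞' ha (symMap φ I 𝔞 h x) = _ from congr($h1 x),
        show reesMap r I I' hI (symToRees I x) = _ from congr($h2 x)]
      exact QSym.inl_symMap φ' I' 𝔞' h' _)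

end Algebra

/-! ### Localizing a graded ring at an element of degree zero, and `Proj` -/

section Proj

open HomogeneousLocalization HomogeneousIdeal

variable {A B : Type u} [CommRing A] [CommRing B] {𝒜 : ℕ → AddSubgroup A} {ℬ : ℕ → AddSubgroup B}
  [GradedRing 𝒜] [GradedRing ℬ]

/-- A surjective graded ring map is surjective on irrelevant ideals. -/
lemma irrelevant_le_of_surjective (ψ : 𝒜 →+*ᵍ ℬ) (hψ : Function.Surjective ψ) :
    irrelevant ℬ ≤ (irrelevant 𝒜).map ψ := by
  rw [← toIdeal_le_toIdeal_iff, toIdeal_irrelevant_le]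
  intro n hn b hb
  obtain ⟨a, ha⟩ := hψ b
  have h1 : ψ (DirectSum.decompose 𝒜 a n) = b := by
    rw [ψ.map_directSumDecompose, ha, DirectSum.decompose_of_mem_same ℬ hb]
  rw [← h1]
  exact Ideal.mem_map_of_mem _ (HomogeneousIdeal.mem_irrelevant_of_mem 𝒜 hn (SetLike.coe_mem _))

variable (ψ : 𝒜 →+*ᵍ ℬ) (f : A)

lemma exists_of_mem_deg (hf : f ∈ 𝒜 0)
    (hloc : letI := (ψ : A →+* B).toAlgebra; IsLocalization.Away f B) {n : ℕ} {b : B} (hb : b ∈ ℬ n) :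
    ∃ (m : ℕ) (a : A), a ∈ 𝒜 n ∧ ψ a = ψ f ^ m * b := by
  letI := (ψ : A →+* B).toAlgebra
  obtain ⟨⟨a, ⟨_, m, rfl⟩⟩, h⟩ := IsLocalization.surj (Submonoid.powers f) b
  refine ⟨m, DirectSum.decompose 𝒜 a n, SetLike.coe_mem _, ?_⟩
  have h2 : ψ a = ψ f ^ m * b := by
    rw [mul_comm, ← map_pow]; exact h.symm
  have h3 : ψ f ^ m * b ∈ ℬ n := by
    have : ψ f ^ m ∈ ℬ (m • 0) := SetLike.pow_mem_graded m (ψ.2 hf)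
    simpa using SetLike.mul_mem_graded this hb
  rw [ψ.map_directSumDecompose, h2, DirectSum.decompose_of_mem_same ℬ h3]

lemma exists_inverse (hf : f ∈ 𝒜 0)
    (hloc : letI := (ψ : A →+* B).toAlgebra; IsLocalization.Away f B) : ∃ v ∈ ℬ 0, ψ f * v = 1 := by
  letI := (ψ : A →+* B).toAlgebra
  obtain ⟨v, hv⟩ := (IsLocalization.Away.algebraMap_isUnit (S := B) f).exists_right_inv
  have hv' : ψ f * v = 1 := hv
  refine ⟨DirectSum.decompose ℬ v 0, SetLike.coe_mem _, ?_⟩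
  have h0 : ψ f ∈ ℬ 0 := ψ.2 hf
  have h1 := DirectSum.coe_decompose_mul_of_left_mem_zero ℬ (b := v) (j := 0) h0
  rw [← h1, hv', DirectSum.decompose_of_mem_same ℬ (SetLike.GradedOne.one_mem)]

lemma irrelevant_le_of_isLocalization (hf : f ∈ 𝒜 0)
    (hloc : letI := (ψ : A →+* B).toAlgebra; IsLocalization.Away f B) :
    irrelevant ℬ ≤ (irrelevant 𝒜).map ψ := by
  rw [← toIdeal_le_toIdeal_iff, toIdeal_irrelevant_le]
  intro n hn b hb
  obtain ⟨m, a, ha, h⟩ := exists_of_mem_deg ψ f hf hloc hb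
  obtain ⟨v, -, hv⟩ := exists_inverse ψ f hf hloc
  have h1 : b = v ^ m * ψ a := by
    rw [h, ← mul_assoc, ← mul_pow, mul_comm v, hv, one_pow, one_mul]
  rw [h1]
  exact Ideal.mul_mem_left _ _
    (Ideal.mem_map_of_mem _ (HomogeneousIdeal.mem_irrelevant_of_mem 𝒜 hn ha))

lemma isLocalization_awayMap (hf : f ∈ 𝒜 0)
    (hloc : letI := (ψ : A →+* B).toAlgebra; IsLocalization.Away f B)
    {d : ℕ} {s : A} (hs : s ∈ 𝒜 d) :
    letI := (Away.map ψ s).toAlgebra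
    IsLocalization.Away (Away.mk 𝒜 hs 0 f (by simpa using hf)) (Away ℬ (ψ s)) := by
  letI := (ψ : A →+* B).toAlgebra
  letI := (Away.map ψ s).toAlgebra
  have hf0 : f ∈ 𝒜 (0 • d) := by simpa using hf
  have hmul : ∀ (n : ℕ) (a : A) (ha : a ∈ 𝒜 (n • d)) (m : ℕ) (ha'),
      Away.mk 𝒜 hs 0 f hf0 ^ m * Away.mk 𝒜 hs n a ha = Away.mk 𝒜 hs n (f ^ m * a) ha' := by
    intro n a ha m ha'
    apply HomogeneousLocalization.val_injective
    simp [HomogeneousLocalization.val_mul, HomogeneousLocalization.val_pow, Away.val_mk,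
      Localization.mk_pow, Localization.mk_mul]
  refine ⟨?_, ?_, ?_⟩
  · rintro ⟨_, n, rfl⟩
    rw [map_pow]
    refine IsUnit.pow _ ?_
    obtain ⟨v, hv0, hv⟩ := exists_inverse ψ f hf hloc
    refine IsUnit.of_mul_eq_one (Away.mk ℬ (ψ.2 hs) 0 v (by simpa using hv0)) ?_
    rw [RingHom.algebraMap_toAlgebra, Away.map_mk]
    apply HomogeneousLocalization.val_injective
    simp [HomogeneousLocalization.val_mul, Away.val_mk, Localization.mk_mul, hv]
  · intro z
    obtain ⟨n, b, hb, rfl⟩ := Away.mk_surjective ℬ (ψ.2 hs) z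
    obtain ⟨m, a, ha, h⟩ := exists_of_mem_deg ψ f hf hloc hb
    refine ⟨(Away.mk 𝒜 hs n a ha, ⟨_, m, rfl⟩), ?_⟩
    rw [map_pow, RingHom.algebraMap_toAlgebra, Away.map_mk, Away.map_mk]
    apply HomogeneousLocalization.val_injective
    simp [HomogeneousLocalization.val_mul, HomogeneousLocalization.val_pow, Away.val_mk,
      Localization.mk_pow, Localization.mk_mul, h, mul_comm]
  · intro x y hxy
    rw [RingHom.algebraMap_toAlgebra, ← sub_eq_zero, ← map_sub] at hxy
    obtain ⟨n, a, ha, h⟩ := Away.mk_surjective 𝒜 hs (x - y)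
    rw [← h, Away.map_mk] at hxy
    have h1 := congr(HomogeneousLocalization.val $hxy)
    rw [Away.val_mk, HomogeneousLocalization.val_zero, Localization.mk_eq_mk',
      IsLocalization.mk'_eq_zero_iff] at h1
    obtain ⟨⟨_, p, rfl⟩, hp⟩ := h1
    have h2 : algebraMap A B (s ^ p * a) = 0 := by
      change ψ _ = 0
      simpa using hp
    obtain ⟨⟨_, m, rfl⟩, hm⟩ := (IsLocalization.map_eq_zero_iff (Submonoid.powers f) B _).mp h2
    refine ⟨⟨_, m, rfl⟩, ?_⟩
    rw [← sub_eq_zero, ← mul_sub, ← h]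
    have hfa : f ^ m * a ∈ 𝒜 (n • d) := by
      have : f ^ m ∈ 𝒜 (m • 0) := SetLike.pow_mem_graded m hf
      simpa using SetLike.mul_mem_graded this ha
    rw [hmul n a ha m hfa]
    apply HomogeneousLocalization.val_injective
    rw [Away.val_mk, HomogeneousLocalization.val_zero, Localization.mk_eq_mk',
      IsLocalization.mk'_eq_zero_iff]
    exact ⟨⟨_, p, rfl⟩, by simp only; rw [← hm]; ring⟩

end Proj

section ProjBaseChange

open HomogeneousLocalization HomogeneousIdeal Limits

variable {A B : Type u} [CommRing A] [CommRing B] {𝒜 : ℕ → AddSubgroup A} {ℬ : ℕ → AddSubgroup B}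
  [GradedRing 𝒜] [GradedRing ℬ]

lemma projMap_eq_id (ψ : 𝒜 →+*ᵍ 𝒜) (hψ : irrelevant 𝒜 ≤ (irrelevant 𝒜).map ψ)
    (h : ∀ x, ψ x = x) : Proj.map ψ hψ = 𝟙 _ := by
  obtain rfl : ψ = .id 𝒜 := by ext x; exact h x
  exact Proj.map_id

lemma projMap_eq_comp {C : Type u} [CommRing C] {𝒞 : ℕ → AddSubgroup C} [GradedRing 𝒞]
    (f : 𝒜 →+*ᵍ ℬ) (hf : irrelevant ℬ ≤ (irrelevant 𝒜).map f)
    (g : ℬ →+*ᵍ 𝒞) (hg : irrelevant 𝒞 ≤ (irrelevant ℬ).map g)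
    (ψ : 𝒜 →+*ᵍ 𝒞) (hψ : irrelevant 𝒞 ≤ (irrelevant 𝒜).map ψ)
    (h : ∀ x, ψ x = g (f x)) : Proj.map ψ hψ = Proj.map g hg ≫ Proj.map f hf := by
  obtain rfl : ψ = g.comp f := by ext x; exact h x
  exact Proj.map_comp _ _ _ _

/-- A ring map with values in degree zero, as a map to the degree zero subring. -/
def toDegZero {R : Type u} [CommRing R] (q : R →+* A) (hq : ∀ r, q r ∈ 𝒜 0) : R →+* 𝒜 0 where
  toFun r := ⟨q r, hq r⟩
  map_one' := Subtype.ext (map_one q)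
  map_mul' x y := Subtype.ext (map_mul q x y)
  map_zero' := Subtype.ext (map_zero q)
  map_add' x y := Subtype.ext (map_add q x y)

/-- The structure map `Proj A → Spec R` of a graded `R`-algebra. -/
def projToSpec {R : Type u} [CommRing R] (𝒜 : ℕ → AddSubgroup A) [GradedRing 𝒜]
    (q : R →+* A) (hq : ∀ r, q r ∈ 𝒜 0) :
    Proj 𝒜 ⟶ Spec (.of R) :=
  Proj.toSpecZero 𝒜 ≫ Spec.map (CommRingCat.ofHom (toDegZero q hq))

lemma awayι_projToSpec {R : Type u} [CommRing R] (q : R →+* A) (hq : ∀ r, q r ∈ 𝒜 0)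
    {m : ℕ} (s : A) (hs : s ∈ 𝒜 m) (hm : 0 < m) :
    Proj.awayι 𝒜 s hs hm ≫ projToSpec 𝒜 q hq =
      Spec.map (CommRingCat.ofHom ((fromZeroRingHom 𝒜 _).comp (toDegZero q hq))) := by
  rw [projToSpec, Proj.awayι_toSpecZero_assoc, ← Spec.map_comp, ← CommRingCat.ofHom_comp]

lemma fromZeroRingHom_eq_mk {m : ℕ} {s : A} (hs : s ∈ 𝒜 m) (a : 𝒜 0) :
    fromZeroRingHom 𝒜 (Submonoid.powers s) a =
      Away.mk 𝒜 hs 0 (a : A) (by rw [zero_smul]; exact a.2) := by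
  apply HomogeneousLocalization.val_injective
  rw [Away.val_mk, fromZeroRingHom]
  change Localization.mk _ _ = _
  congr 1
  ext
  simp

variable (ψ : 𝒜 →+*ᵍ ℬ) (hψ : irrelevant ℬ ≤ (irrelevant 𝒜).map ψ)
  {R R' : Type u} [CommRing R] [CommRing R'] (q : R →+* A) (hq : ∀ r, q r ∈ 𝒜 0)
  (q' : R' →+* B) (hq' : ∀ r, q' r ∈ ℬ 0) (ρ : R →+* R')

lemma isPullback_awayι {i : ℕ} (hi : 0 < i) {s : A} (hs : s ∈ 𝒜 i) :
    IsPullback (Spec.map (CommRingCat.ofHom (Away.map ψ s)))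
      (Proj.awayι ℬ (ψ s) (ψ.2 hs) hi) (Proj.awayι 𝒜 s hs hi) (Proj.map ψ hψ) := by
  refine IsOpenImmersion.isPullback _ _ _ _ (Proj.awayι_comp_map ψ hψ hi s hs) ?_
  rw [Proj.opensRange_awayι, Proj.opensRange_awayι, Proj.map_preimage_basicOpen]

lemma range_comap_awayMap (f : A) (hf : f ∈ 𝒜 0)
    (hloc : letI := (ψ : A →+* B).toAlgebra; IsLocalization.Away f B)
    {i : ℕ} {s : A} (hs : s ∈ 𝒜 i) :
    Set.range (PrimeSpectrum.comap (Away.map ψ s)) = PrimeSpectrum.basicOpen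
      (Away.mk 𝒜 hs 0 f (by simpa using hf)) := by
  letI := (Away.map ψ s).toAlgebra
  haveI := isLocalization_awayMap ψ f hf hloc hs
  exact PrimeSpectrum.localization_away_comap_range (Away ℬ (ψ s)) _

lemma isOpenImmersion_awayMap (f : A) (hf : f ∈ 𝒜 0)
    (hloc : letI := (ψ : A →+* B).toAlgebra; IsLocalization.Away f B)
    {i : ℕ} {s : A} (hs : s ∈ 𝒜 i) :
    IsOpenImmersion (Spec.map (CommRingCat.ofHom (Away.map ψ s))) := by
  letI := (Away.map ψ s).toAlgebra
  haveI := isLocalization_awayMap ψ f hf hloc hs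
  exact IsOpenImmersion.of_isLocalization (S := Away ℬ (ψ s))
      (Away.mk 𝒜 hs 0 f _)

lemma isOpenImmersion_projMap (f : A) (hf : f ∈ 𝒜 0)
    (hloc : letI := (ψ : A →+* B).toAlgebra; IsLocalization.Away f B) :
    IsOpenImmersion (Proj.map ψ hψ) := by
  refine (IsZariskiLocalAtTarget.iff_of_openCover (P := @IsOpenImmersion)
    (Proj.affineOpenCover 𝒜).openCover).mpr fun s => ?_
  have h := isPullback_awayι ψ hψ s.1.2 s.2.2
  refine (MorphismProperty.cancel_left_of_respectsIso @IsOpenImmersion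
    h.flip.isoPullback.hom _).mp ?_
  have h2 : h.flip.isoPullback.hom ≫
    Scheme.Cover.pullbackHom (Proj.affineOpenCover 𝒜).openCover (Proj.map ψ hψ) s = _ :=
      h.flip.isoPullback_hom_snd
  exact h2.symm ▸ isOpenImmersion_awayMap ψ f hf hloc s.2.2

lemma away_map_fromZero (hcomm : ∀ r, ψ (q r) = q' (ρ r))
    {i : ℕ} {s : A} (hs : s ∈ 𝒜 i) (r : R) :
    Away.map ψ s (fromZeroRingHom 𝒜 _ (toDegZero q hq r)) =
      fromZeroRingHom ℬ _ (toDegZero q' hq' (ρ r)) := by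
  rw [fromZeroRingHom_eq_mk (𝒜 := 𝒜) hs, Away.map_mk]
  refine Eq.trans ?_ (fromZeroRingHom_eq_mk (𝒜 := ℬ) (s := ψ s) (ψ.2 hs) _).symm
  congr 1
  exact hcomm r

lemma awayι_map_projToSpec (hcomm : ∀ r, ψ (q r) = q' (ρ r))
    {i : ℕ} (hi : 0 < i) {s : A} (hs : s ∈ 𝒜 i) :
    Proj.awayι ℬ (ψ s) (ψ.2 hs) hi ≫ Proj.map ψ hψ ≫ projToSpec 𝒜 q hq =
      Proj.awayι ℬ (ψ s) (ψ.2 hs) hi ≫ projToSpec ℬ q' hq' ≫ Spec.map (CommRingCat.ofHom ρ) := by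
  have h := awayι_projToSpec (𝒜 := ℬ) q' hq' (ψ s) (ψ.2 hs) hi
  rw [Proj.awayι_comp_map_assoc ψ hψ hi s hs, awayι_projToSpec, reassoc_of% h,
    ← Spec.map_comp, ← Spec.map_comp, ← CommRingCat.ofHom_comp, ← CommRingCat.ofHom_comp]
  congr 2
  exact RingHom.ext fun r => away_map_fromZero ψ q hq q' hq' ρ hcomm hs r

lemma map_projToSpec (hcomm : ∀ r, ψ (q r) = q' (ρ r)) :
    Proj.map ψ hψ ≫ projToSpec 𝒜 q hq = projToSpec ℬ q' hq' ≫ Spec.map (CommRingCat.ofHom ρ) :=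
  (Proj.mapAffineOpenCover ψ hψ).openCover.hom_ext _ _ fun s ↦
    awayι_map_projToSpec ψ hψ q hq q' hq' ρ hcomm s.1.2 s.2.2

/-- `Proj` commutes with localization of the base. -/
lemma isPullback_projMap (hcomm : ∀ r, ψ (q r) = q' (ρ r)) (a : R)
    (hρ : letI := ρ.toAlgebra; IsLocalization.Away a R')
    (hloc : letI := (ψ : A →+* B).toAlgebra; IsLocalization.Away (q a) B) :
    IsPullback (projToSpec ℬ q' hq') (Proj.map ψ hψ)
      (Spec.map (CommRingCat.ofHom ρ)) (projToSpec 𝒜 q hq) := by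
  letI := ρ.toAlgebra
  haveI hopenρ : IsOpenImmersion (Spec.map (CommRingCat.ofHom ρ)) :=
    IsOpenImmersion.of_isLocalization (S := R') a
  have hrangeρ : (Spec.map (CommRingCat.ofHom ρ)).opensRange = PrimeSpectrum.basicOpen a := by
    ext1
    exact PrimeSpectrum.localization_away_comap_range R' a
  haveI := isOpenImmersion_projMap ψ hψ (q a) (hq a) hloc
  refine IsOpenImmersion.isPullback _ _ _ _ (map_projToSpec ψ hψ q hq q' hq' ρ hcomm) ?_
  rw [hrangeρ]
  refine le_antisymm (fun x hx => ?_) ?_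
  · obtain ⟨s, y, rfl⟩ : ∃ (s : (i : ℕ+) × 𝒜 i) (y : _),
      Proj.awayι 𝒜 (s.2 : A) s.2.2 s.1.2 y = x := (Proj.affineOpenCover 𝒜).openCover.exists_eq x
    have h2 : y ∈ Set.range (PrimeSpectrum.comap (Away.map ψ (s.2 : A))) := by
      rw [range_comap_awayMap ψ (q a) (hq a) hloc s.2.2]
      have h3 : (Proj.awayι 𝒜 (s.2 : A) s.2.2 s.1.2 ≫ projToSpec 𝒜 q hq) y ∈
        PrimeSpectrum.basicOpen a := hx
      have h4 : (Spec.map (CommRingCat.ofHom ((fromZeroRingHom 𝒜 _).comp (toDegZero q hq)))) y ∈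
        PrimeSpectrum.basicOpen a := (awayι_projToSpec q hq (s.2 : A) s.2.2 s.1.2) ▸ h3
      change Away.mk 𝒜 s.2.2 0 (q a) _ ∉ y.asIdeal
      have h5 : fromZeroRingHom 𝒜 _ (toDegZero q hq a) ∉ y.asIdeal := h4
      rwa [fromZeroRingHom_eq_mk (𝒜 := 𝒜) s.2.2] at h5
    obtain ⟨z, rfl⟩ := h2
    have h6 := congr($(Proj.awayι_comp_map ψ hψ s.1.2 s.2 s.2.2) z)
    exact ⟨_, h6⟩
  · rintro _ ⟨y, rfl⟩
    have h3 : (Spec.map (CommRingCat.ofHom ρ)) (projToSpec ℬ q' hq' y) ∈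
      (Spec.map (CommRingCat.ofHom ρ)).opensRange := ⟨_, rfl⟩
    rw [hrangeρ] at h3
    have h4 := congr($(map_projToSpec ψ hψ q hq q' hq' ρ hcomm) y)
    change (Proj.map ψ hψ ≫ projToSpec 𝒜 q hq) y ∈ PrimeSpectrum.basicOpen a
    exact h4 ▸ h3

end ProjBaseChange

/-! ### Graded quasi-coherent algebras on a scheme and relative `Proj` -/

section RelativeProj

open Limits HomogeneousIdeal Scheme

/-- A presheaf of graded `𝒪_X`-algebras on the affine open subsets of `X`. -/
structure GradedAlg (X : Scheme.{u}) where
  /-- The sections over an affine open. -/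
  obj : X.affineOpens → Type u
  [ring : ∀ U, CommRing (obj U)]
  /-- The homogeneous sections of degree `d`. -/
  deg : ∀ U, ℕ → AddSubgroup (obj U)
  [graded : ∀ U, GradedRing (deg U)]
  /-- The restriction maps. -/
  map : ∀ {U V : X.affineOpens}, V ≤ U → (deg U →+*ᵍ deg V)
  map_id : ∀ (U : X.affineOpens) (x : obj U), map (le_refl U) x = x
  map_comp : ∀ {U V W : X.affineOpens} (h : V ≤ U) (h' : W ≤ V) (x : obj U),
    map h' (map h x) = map (h'.trans h) x
  /-- The `𝒪_X`-algebra structure. -/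
  str : ∀ U : X.affineOpens, Γ(X, U) →+* obj U
  str_mem : ∀ (U : X.affineOpens) (r : Γ(X, U)), str U r ∈ deg U 0
  map_str : ∀ {U V : X.affineOpens} (h : V ≤ U) (r : Γ(X, U)),
    map h (str U r) = str V (X.presheaf.map (homOfLE h).op r)

attribute [instance] GradedAlg.ring GradedAlg.graded

namespace GradedAlg

variable {X : Scheme.{u}} (𝒜 : GradedAlg X)

/-- Quasi-coherence: the sections over `D(f) ⊆ U` are the localization at `f` of those over `U`. -/
def IsQuasiCoherent : Prop :=
  ∀ (U : X.affineOpens) (f : Γ(X, U)),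
    letI := (𝒜.map (X.affineBasicOpen_le f) : 𝒜.obj U →+* 𝒜.obj (X.affineBasicOpen f)).toAlgebra
    IsLocalization.Away (𝒜.str U f) (𝒜.obj (X.affineBasicOpen f))

variable {𝒜}

lemma le_of_le {U V : AffineZariskiSite X} (h : U ≤ V) :
    (⟨U.1, U.2⟩ : X.affineOpens) ≤ ⟨V.1, V.2⟩ := AffineZariskiSite.toOpens_mono h

lemma exists_isLocalization (hQ : 𝒜.IsQuasiCoherent) {U V : AffineZariskiSite X} (h : U ≤ V) :
    ∃ f : Γ(X, V.1),
      (letI := (X.presheaf.map (homOfLE (AffineZariskiSite.toOpens_mono h)).op).hom.toAlgebra;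
        IsLocalization.Away f Γ(X, U.1)) ∧
      (letI := (𝒜.map (le_of_le h) : 𝒜.obj ⟨V.1, V.2⟩ →+* 𝒜.obj ⟨U.1, U.2⟩).toAlgebra;
        IsLocalization.Away (𝒜.str ⟨V.1, V.2⟩ f) (𝒜.obj ⟨U.1, U.2⟩)) := by
  obtain ⟨U, hU⟩ := U
  obtain ⟨V, hV⟩ := V
  obtain ⟨f, hf⟩ := id h
  obtain rfl : X.basicOpen f = U := hf
  exact ⟨f, hV.isLocalization_basicOpen f, hQ ⟨V, hV⟩ f⟩

lemma irrelevant_le (hQ : 𝒜.IsQuasiCoherent) {U V : AffineZariskiSite X} (h : U ≤ V) :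
    irrelevant (𝒜.deg ⟨U.1, U.2⟩) ≤ (irrelevant (𝒜.deg ⟨V.1, V.2⟩)).map (𝒜.map (le_of_le h)) := by
  obtain ⟨f, -, hf⟩ := exists_isLocalization hQ h
  exact irrelevant_le_of_isLocalization _ _ (𝒜.str_mem _ f) hf

variable (hQ : 𝒜.IsQuasiCoherent)

/-- The functor `U ↦ Proj 𝒜(U)` on affine opens. -/
def projFunctor : AffineZariskiSite X ⥤ Scheme.{u} where
  obj U := Proj (𝒜.deg ⟨U.1, U.2⟩)
  map h := Proj.map (𝒜.map (le_of_le h.le)) (irrelevant_le hQ h.le)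
  map_id _ := projMap_eq_id _ _ (𝒜.map_id _)
  map_comp _ _ := projMap_eq_comp _ _ _ _ _ _ fun x => (𝒜.map_comp _ _ x).symm

/-- The structure maps `Proj 𝒜(U) → U`. -/
def projNatTrans : projFunctor hQ ⟶
    AffineZariskiSite.toOpensFunctor X ⋙ X.restrictFunctor ⋙ Over.forget _ :=
  ({ app := fun U => projToSpec (𝒜.deg ⟨U.1, U.2⟩) (𝒜.str ⟨U.1, U.2⟩) (𝒜.str_mem ⟨U.1, U.2⟩)
     naturality := fun _ _ _ => map_projToSpec _ _ _ _ _ _ _ (fun r => 𝒜.map_str _ r) } :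
    projFunctor hQ ⟶ AffineZariskiSite.toOpensFunctor X ⋙ X.presheaf.rightOp ⋙ Scheme.Spec) ≫
    (AffineZariskiSite.restrictIsoSpec X).inv

lemma projNatTrans_equifibered : (projNatTrans hQ).Equifibered := by
  refine NatTrans.Equifibered.comp ?_ (.of_isIso _)
  intro U V h
  obtain ⟨f, hf1, hf2⟩ := exists_isLocalization hQ h.le
  have H := isPullback_projMap (𝒜.map (le_of_le h.le)) (irrelevant_le hQ h.le)
    (𝒜.str ⟨V.1, V.2⟩) (𝒜.str_mem _) (𝒜.str ⟨U.1, U.2⟩) (𝒜.str_mem _) _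
    (fun r => 𝒜.map_str _ r) f hf1 hf2
  exact H.flip

/-- The gluing datum for the relative `Proj`. -/
def projGluingData : (AffineZariskiSite.directedCover X).RelativeGluingData where
  functor := projFunctor hQ
  natTrans := projNatTrans hQ
  equifibered := projNatTrans_equifibered hQ

/-- The relative `Proj` of a quasi-coherent graded `𝒪_X`-algebra, glued from the `Proj 𝒜(U)`,
for `U` running over the affine open subsets of `X`. -/
def relProj : Scheme.{u} := (projGluingData hQ).glued

/-- The structure map `Proj 𝒜 → X`. -/
def relProj.toBase : relProj hQ ⟶ X := (projGluingData hQ).toBase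

/-- The open immersion `Proj 𝒜(U) → Proj 𝒜`. -/
def relProj.ι (U : X.affineOpens) : Proj (𝒜.deg U) ⟶ relProj hQ :=
  (projGluingData hQ).cover.f (⟨U.1, U.2⟩ : AffineZariskiSite X)

instance (U : X.affineOpens) : IsOpenImmersion (relProj.ι hQ U) :=
  (projGluingData hQ).cover.map_prop (⟨U.1, U.2⟩ : AffineZariskiSite X)

lemma relProj.ι_toBase (U : X.affineOpens) :
    relProj.ι hQ U ≫ relProj.toBase hQ =
      projToSpec (𝒜.deg U) (𝒜.str U) (𝒜.str_mem U) ≫ U.2.fromSpec :=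
  ((projGluingData hQ).ι_toBase (⟨U.1, U.2⟩ : AffineZariskiSite X)).trans
    (Category.assoc _ _ _)

end GradedAlg

end RelativeProj

/-! ### Blow-ups, residual subschemes and principal transforms -/

section BlowUp

open Scheme

/-- The Rees algebra `⨁ J^d` of an ideal sheaf. -/
def reesAlg {M : Scheme.{u}} (J : M.IdealSheafData) : GradedAlg M where
  obj V := reesAlgebra (J.ideal V)
  deg V := reesDeg (J.ideal V)
  map h := reesGradedMap (M.presheaf.map (homOfLE h).op).hom _ _ (J.ideal_le_comap_ideal h)
  map_id V x := Subtype.ext <| by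
    change Polynomial.map _ _ = _
    ext n
    rw [Polynomial.coeff_map]
    change (M.presheaf.map (𝟙 _)) _ = _
    rw [M.presheaf.map_id]
    rfl
  map_comp h h' x := Subtype.ext <| by
    change Polynomial.map _ (Polynomial.map _ _) = Polynomial.map _ _
    rw [Polynomial.map_map, ← CommRingCat.hom_comp, ← Functor.map_comp]
    rfl
  str V := algebraMap _ _
  str_mem V r i hi := by
    change (Polynomial.C r).coeff i = 0
    rw [Polynomial.coeff_C, if_neg hi]
  map_str h r := Subtype.ext <| by
    change Polynomial.map _ (Polynomial.C _) = Polynomial.C _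
    exact Polynomial.map_C _

lemma reesAlg_isQuasiCoherent {M : Scheme.{u}} (J : M.IdealSheafData) :
    (reesAlg J).IsQuasiCoherent := fun V f =>
  rees_isLocalization (M.presheaf.map (homOfLE (M.basicOpen_le f)).op).hom _ _
    (J.ideal_le_comap_ideal (M.affineBasicOpen_le f)) f
    (V.2.isLocalization_basicOpen f) (J.map_ideal_basicOpen V f).symm

/-- The blow-up of `M` along (the closed subscheme with ideal sheaf) `J`. -/
def blowUp {M : Scheme.{u}} (J : M.IdealSheafData) : Scheme.{u} :=
  GradedAlg.relProj (reesAlg_isQuasiCoherent J)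

/-- The blow-down map. -/
def blowUp.toBase {M : Scheme.{u}} (J : M.IdealSheafData) : blowUp J ⟶ M :=
  GradedAlg.relProj.toBase (reesAlg_isQuasiCoherent J)

/-- The open immersion `Proj (⨁ J(V)^d) → Bℓ_J M`. -/
def blowUp.ι {M : Scheme.{u}} (J : M.IdealSheafData) (V : M.affineOpens) :
    Proj (reesDeg (J.ideal V)) ⟶ blowUp J :=
  GradedAlg.relProj.ι (reesAlg_isQuasiCoherent J) V

/-- An ideal sheaf defines an effective Cartier divisor if it is, locally, generated by a
nonzerodivisor. -/
def IsEffectiveCartier {P : Scheme.{u}} (D : P.IdealSheafData) : Prop :=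
  ∀ x : P, ∃ U : P.affineOpens, x ∈ U.1 ∧
    ∃ t ∈ nonZeroDivisors Γ(P, U), D.ideal U = Ideal.span {t}

/-- `R` is the ideal sheaf of the residual scheme to the effective Cartier divisor `D` in the
closed subscheme `W ⊇ D`: the ideal sheaf of `W` is the product of those of `D` and `R`. -/
def IsResidual {P : Scheme.{u}} (D W R : P.IdealSheafData) : Prop :=
  IsEffectiveCartier D ∧ W ≤ D ∧ W = D * R

/-- For closed embeddings `Y ⊆ X ⊆ M`, the ideal sheaf `R` on `Bℓ_Y M` defines the principal
transform of `X`: the residual scheme to the exceptional divisor `ρ⁻¹(Y)` in `ρ⁻¹(X)`. -/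
def IsPrincipalTransform {Y X M : Scheme.{u}} (i : X ⟶ M) (j : Y ⟶ X)
    (R : (blowUp (j ≫ i).ker).IdealSheafData) : Prop :=
  IsResidual ((j ≫ i).ker.comap (blowUp.toBase _)) (i.ker.comap (blowUp.toBase _)) R

end BlowUp

/-! ### The quasi-symmetric algebra of a closed subscheme -/

section QSymSheaf

open Scheme

variable {k : Type u} [Field k] {X Y : Scheme.{u}} {sX : X ⟶ Spec (.of k)}

/-- A closed embedding over `k` of the `k`-scheme `X` in a scheme of finite type over `k`. -/
structure Ambient (sX : X ⟶ Spec (.of k)) where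
  /-- The ambient scheme. -/
  scheme : Scheme.{u}
  /-- Its structure map. -/
  str : scheme ⟶ Spec (.of k)
  /-- The embedding. -/
  ι : X ⟶ scheme
  [locallyOfFiniteType : LocallyOfFiniteType str]
  [quasiCompact : QuasiCompact str]
  [isClosedImmersion : IsClosedImmersion ι]
  ι_str : ι ≫ str = sX

attribute [instance] Ambient.isClosedImmersion

namespace Ambient

/-- The closed embedding over `k` given by a closed immersion `i : X ⟶ M`. -/
abbrev of {M : Scheme.{u}} (sM : M ⟶ Spec (.of k)) [LocallyOfFiniteType sM] [QuasiCompact sM]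
    (i : X ⟶ M) [IsClosedImmersion i] : Ambient (i ≫ sM) where
  scheme := M
  str := sM
  ι := i
  ι_str := rfl

/-- A closed embedding `M ⊆ N` of schemes in which `X` is embedded,
compatible with the embeddings of `X`. -/
structure Hom (M N : Ambient sX) where
  /-- The embedding. -/
  hom : M.scheme ⟶ N.scheme
  [isClosedImmersion : IsClosedImmersion hom]
  ι_hom : M.ι ≫ hom = N.ι
  hom_str : hom ≫ N.str = M.str

/-- The intersection `V ∩ X` of an affine open of the ambient scheme with `X`. -/
def res (M : Ambient sX) (V : M.scheme.affineOpens) : X.affineOpens :=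
  ⟨M.ι ⁻¹ᵁ V.1, V.2.preimage M.ι⟩

/-- The restriction of functions from `V` to `V ∩ X`. -/
def resHom (M : Ambient sX) (V : M.scheme.affineOpens) :
    Γ(M.scheme, V.1) →+* Γ(X, (M.res V).1) := (M.ι.app V.1).hom

lemma res_le {M N : Ambient sX} (g : Hom M N) {V : N.scheme.affineOpens}
    {V' : M.scheme.affineOpens} (e : V'.1 ≤ g.hom ⁻¹ᵁ V.1) : M.res V' ≤ N.res V := by
  change M.ι ⁻¹ᵁ V'.1 ≤ N.ι ⁻¹ᵁ V.1
  rw [← g.ι_hom]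
  exact fun x hx => e hx

lemma resHom_comp {M N : Ambient sX} (g : Hom M N) {V : N.scheme.affineOpens}
    {V' : M.scheme.affineOpens} (e : V'.1 ≤ g.hom ⁻¹ᵁ V.1) :
    (X.presheaf.map (homOfLE (res_le g e)).op).hom.comp (N.resHom V) =
      (M.resHom V').comp (g.hom.appLE V.1 V'.1 e).hom := by
  have h : N.ι.app V.1 ≫ X.presheaf.map (homOfLE (res_le g e)).op =
      g.hom.appLE V.1 V'.1 e ≫ M.ι.app V'.1 := by
    have h1 := N.ι.appLE_map (U := V.1) le_rfl (homOfLE (res_le g e)).op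
    rw [Hom.appLE_eq_app] at h1
    rw [M.ι.app_eq_appLE, Hom.appLE_comp_appLE]
    refine h1.trans ?_
    congr 1
    exact g.ι_hom.symm
  exact congr(($h).hom)

variable (j : Y ⟶ X) [IsClosedImmersion j]

/-- Over an affine open `V` of `M`, the ideal of `Y` in `M` is the inverse image of the ideal
of `Y` in `X`. -/
lemma ideal_eq_comap (M : Ambient sX) (V : M.scheme.affineOpens) :
    (j ≫ M.ι).ker.ideal V = (j.ker.ideal (M.res V)).comap (M.resHom V) := by
  rw [Hom.ker_apply, Hom.ker_apply, RingHom.comap_ker]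
  rfl

/-- The sections over `V ∩ X` of the quasi-symmetric algebra `qSym_{X ⊆ M}(J_{Y,X})`,
for `V` an affine open of `M`. -/
def qSym (M : Ambient sX) (V : M.scheme.affineOpens) : Type u :=
  QSym (M.resHom V) ((j ≫ M.ι).ker.ideal V) (j.ker.ideal (M.res V)) (M.ideal_eq_comap j V).le

instance (M : Ambient sX) (V : M.scheme.affineOpens) : CommRing (M.qSym j V) :=
  inferInstanceAs (CommRing (QSym _ _ _ _))

/-- The degree `d` part. -/
def qSymDeg (M : Ambient sX) (V : M.scheme.affineOpens) (d : ℕ) : AddSubgroup (M.qSym j V) :=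
  QSym.deg (M.resHom V) ((j ≫ M.ι).ker.ideal V) (j.ker.ideal (M.res V))
    (M.ideal_eq_comap j V).le d

/-- The algebra structure over the functions on `V ∩ X`. -/
def qSymStr (M : Ambient sX) (V : M.scheme.affineOpens) : Γ(X, (M.res V).1) →+* M.qSym j V :=
  (QSym.inl _ _ _ _).comp (algebraMap Γ(X, (M.res V).1) (Sym (j.ker.ideal (M.res V))))

/-- The map `Rees_{Γ(V)}(J_{Y,M}(V)) → qSym_{X ⊆ M}(J_{Y,X})(V ∩ X)`. -/
def reesToQSym (M : Ambient sX) (V : M.scheme.affineOpens) :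
    reesAlgebra ((j ≫ M.ι).ker.ideal V) →+* M.qSym j V :=
  QSym.inr _ _ _ _

/-- For closed embeddings `X ⊆ M ⊆ N`, the map `qSym_{X ⊆ N}(J_{Y,X}) → qSym_{X ⊆ M}(J_{Y,X})`,
from the sections given by the affine open `V ⊆ N` to those given by the affine open
`V' ⊆ V ∩ M`. For `M = N` these are the restriction maps. -/
def qSymMap {M N : Ambient sX} (g : Hom M N) {V : N.scheme.affineOpens}
    {V' : M.scheme.affineOpens} (e : V'.1 ≤ g.hom ⁻¹ᵁ V.1) : N.qSym j V →+* M.qSym j V' :=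
  QSym.map (g.hom.appLE V.1 V'.1 e).hom
    (X.presheaf.map (homOfLE (res_le g e)).op).hom
    (resHom_comp g e)
    (by
      rw [ideal_eq_comap, ideal_eq_comap, Ideal.comap_comap, ← resHom_comp g e]
      exact Ideal.comap_mono (f := N.resHom V) (IdealSheafData.ideal_le_comap_ideal _ (res_le g e)))
    (IdealSheafData.ideal_le_comap_ideal _ (res_le g e))

end Ambient

/-- A graded `𝒪_X`-algebra with compatible maps to the algebras `qSym_{X ⊆ M}(J_{Y,X})`,
for all closed embeddings `X ⊆ M` over `k`. -/
structure QSymCone (sX : X ⟶ Spec (.of k)) (j : Y ⟶ X) [IsClosedImmersion j] where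
  /-- The graded algebra. -/
  alg : GradedAlg X
  /-- The maps, over the affine opens `V ∩ X`, with `V` an affine open of `M`. -/
  proj : ∀ (M : Ambient sX) (V : M.scheme.affineOpens), alg.obj (M.res V) →+* M.qSym j V
  proj_mem : ∀ (M : Ambient sX) (V : M.scheme.affineOpens) (d : ℕ),
    ∀ x ∈ alg.deg (M.res V) d, proj M V x ∈ M.qSymDeg j V d
  proj_str : ∀ (M : Ambient sX) (V : M.scheme.affineOpens) (r : Γ(X, (M.res V).1)),
    proj M V (alg.str _ r) = M.qSymStr j V r
  qSymMap_proj : ∀ {M N : Ambient sX} (g : Ambient.Hom M N) {V : N.scheme.affineOpens}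
    {V' : M.scheme.affineOpens} (e : V'.1 ≤ g.hom ⁻¹ᵁ V.1) (x : alg.obj (N.res V)),
    Ambient.qSymMap j g e (proj N V x) = proj M V' (alg.map (Ambient.res_le g e) x)

/-- `Q` is the inverse limit of the graded algebras `qSym_{X ⊆ M}(J_{Y,X})`, over all closed
embeddings `X ⊆ M`: for every affine open `U ⊆ X`, the sections of degree `d` over `U` are the
compatible families of sections of degree `d` of `qSym_{X ⊆ M}(J_{Y,X})` over `U`. As the
affine opens of `U` of the form `V ∩ X`, with `V ⊆ M` affine open, are a base of `U`, a section
of `qSym_{X ⊆ M}(J_{Y,X})` over `U` is a compatible family of sections over these. -/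
def QSymCone.IsLimit {j : Y ⟶ X} [IsClosedImmersion j] (Q : QSymCone sX j) : Prop :=
  ∀ (U : X.affineOpens) (d : ℕ)
    (s : ∀ (M : Ambient sX) (V : M.scheme.affineOpens), M.res V ≤ U → M.qSym j V),
    (∀ (M : Ambient sX) (V : M.scheme.affineOpens) (h : M.res V ≤ U),
      s M V h ∈ M.qSymDeg j V d) →
    (∀ (M N : Ambient sX) (g : Ambient.Hom M N) (V : N.scheme.affineOpens)
      (V' : M.scheme.affineOpens) (e : V'.1 ≤ g.hom ⁻¹ᵁ V.1) (h : N.res V ≤ U),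
      Ambient.qSymMap j g e (s N V h) = s M V' ((Ambient.res_le g e).trans h)) →
    ∃! x : Q.alg.obj U, x ∈ Q.alg.deg U d ∧
      ∀ (M : Ambient sX) (V : M.scheme.affineOpens) (h : M.res V ≤ U),
        Q.proj M V (Q.alg.map h x) = s M V h

end QSymSheaf

end QSymBlowUp

end

open QSymBlowUp

/-! Locally on `M` there is a surjection `φ : R → A` with kernel `K`, an ideal `𝔞` of `A`, and `I =
φ⁻¹(𝔞) ⊇ K`. Every element of `𝔞` lifts to `I`, so `Sym_R(I) → Sym_A(𝔞)` is onto and the tensor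
product defining `qSym` is a quotient of the Rees algebra of `I`. The relations it imposes are `K`
in degree zero and `K t` in degree one; the ideal they generate has degree `d` part `K I^(d-1)`
(`QSym.ker_inr`). This is the formula of (i), once the limit is known to be its term at `M`.

That identification rests on formal smoothness. Let `C → R` be onto with kernel `L`, and let `J ⊇ L`
be the preimage of `I`. If `R` is formally smooth, `C/L^(d+1) → R` has a section, and comparing an
element with its image under the section gives `L ∩ J^(d+1) = L J^d`
(`mem_mul_pow_of_formallySmooth`). So replacing `R` by `C` does not change `qSym`
(`map_bijective_of_formallySmooth`). For a second embedding `S → A'`, take for `C` the fibre product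
of `S` and `R` over `A'`, the ring of the pushout of the two ambient schemes. Inverting the
isomorphism gives a comparison map from `qSym` for `R` to `qSym` for `S`. Globally, sections over
the smooth `M` thus induce sections over every embedding `N`, and the compatible families over `M`
form a cone (`familyCone`).

This cone is the limit if every compatible family is obtained on `N` by comparison from `M`
(`family_eq_cmp`). Compatibility speaks only of closed embeddings of finite type schemes, so one
such scheme must receive both. Here `N` may be replaced by an infinitesimal neighbourhood of `X`: a
section of degree `d` is determined on the one of order `d`, because `K^(d+1) ⊆ K I^(d-1)`. That
neighbourhood has the same points as `X`, so its pushout with `M` has the same points as `M` and is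
glued from spectra of fibre products of rings; these are of finite type by the Artin–Tate lemma.
Inside the pushout, naturality of the comparison forces the equality. Hence the limit projects
isomorphically onto its term at `M`, and its quasi-coherence follows by clearing denominators over a
finite cover.

For (ii), the surjection from the Rees algebra gives a closed embedding into the blow-up. On the
chart where `x t` is inverted, `I` is generated by the nonzerodivisor `x`. A fraction in the kernel
can be written `w / x^d` with `w ∈ K I^(d-1)`, and multiplying it by `x` lands in the ideal
generated by `K`; conversely `y ∈ K` is `x` times `y t / x t`. So the ideal of the preimage of `X`
is `(x)` times the ideal of the embedded subscheme (`map_reesAwayStr_eq_mul_ker`). -/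

noncomputable section

namespace QSymBlowUp

/-! ### Structure of quasi-symmetric algebras -/

section

variable {A B : Type u} [CommRing A] [CommRing B] (𝒜 : ℕ → AddSubgroup A) [GradedRing 𝒜]
  (ℬ : ℕ → AddSubgroup B)

/-- The grading induced on a quotient of a graded ring by a homogeneous ideal. -/
@[reducible]
def gradedRingOfSurjective (π : A →+* B) (hπ : Function.Surjective π)
    (hℬ : ∀ d, ℬ d = (𝒜 d).map π.toAddMonoidHom)
    (hker : ∀ a, π a = 0 → ∀ d, π (DirectSum.decompose 𝒜 a d) = 0) : GradedRing ℬ := by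
  classical
  have hmem : ∀ d (a : 𝒜 d), π a ∈ ℬ d := fun d a => by rw [hℬ]; exact ⟨a, a.2, rfl⟩
  let g : ∀ d, 𝒜 d →+ ℬ d := fun d =>
    (π.toAddMonoidHom.comp (𝒜 d).subtype).codRestrict (ℬ d) (hmem d)
  let D : A →+ DirectSum ℕ fun d => ℬ d :=
    (DirectSum.map g).comp (DirectSum.decomposeAddEquiv 𝒜).toAddMonoidHom
  have hD : ∀ a d, ((D a d : ℬ d) : B) = π (DirectSum.decompose 𝒜 a d) := fun a d => rfl
  have hDker : π.toAddMonoidHom.ker ≤ D.ker := by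
    intro a ha
    refine DFinsupp.ext fun d => Subtype.ext ?_
    exact hker a ha d
  -- Homogeneity of the kernel, in the form `hker`, lets the decomposition of a lift descend to `B`.
  let L : B →+ DirectSum ℕ fun d => ℬ d :=
    AddMonoidHom.liftOfSurjective π.toAddMonoidHom hπ ⟨D, hDker⟩
  have hL : ∀ a, L (π a) = D a := fun a =>
    AddMonoidHom.liftOfRightInverse_comp_apply _ _ _ ⟨D, hDker⟩ a
  have hsum : ∀ a, DirectSum.coeAddMonoidHom ℬ (D a) = π a := by
    intro a
    have h1 : (DirectSum.coeAddMonoidHom ℬ).comp (DirectSum.map g) =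
        π.toAddMonoidHom.comp (DirectSum.coeAddMonoidHom 𝒜) := by
      ext d x
      simp [g]
    refine (congr($h1 (DirectSum.decompose 𝒜 a))).trans ?_
    simp only [AddMonoidHom.comp_apply]
    exact congr(π $(DirectSum.Decomposition.left_inv (ℳ := 𝒜) a))
  exact
  { one_mem := by
      rw [hℬ]
      exact ⟨1, SetLike.GradedOne.one_mem, map_one π⟩
    mul_mem := fun {m n} x y hx hy => by
      rw [hℬ] at hx hy ⊢
      obtain ⟨x, hx, rfl⟩ := hx
      obtain ⟨y, hy, rfl⟩ := hy
      exact ⟨x * y, SetLike.mul_mem_graded hx hy, map_mul π x y⟩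
    __ := DirectSum.Decomposition.ofAddHom ℬ L
      (by
        ext b
        obtain ⟨a, rfl⟩ := hπ b
        simp only [AddMonoidHom.comp_apply, hL, hsum]
        rfl)
      (by
        refine DirectSum.addHom_ext fun d ⟨b, hb⟩ => ?_
        rw [hℬ] at hb
        obtain ⟨a, ha, rfl⟩ := hb
        simp only [AddMonoidHom.comp_apply, DirectSum.coeAddMonoidHom_of]
        refine (hL a).trans ?_
        simp only [D, AddMonoidHom.comp_apply]
        have h2 : (DirectSum.decomposeAddEquiv 𝒜).toAddMonoidHom a =
          DirectSum.of (fun d => 𝒜 d) d ⟨a, ha⟩ := DirectSum.decompose_of_mem 𝒜 ha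
        rw [h2, DirectSum.map_of]
        rfl) }

end

/-! ### Homogeneous elements of the Rees algebra and the ideal `⨁ K I^(d-1)`. -/

section Rees

variable {R : Type u} [CommRing R] (I : Ideal R)

lemma mem_reesDeg_iff {d : ℕ} {p : reesAlgebra I} :
    p ∈ reesDeg I d ↔
      p = reesMonomial I d ((p : Polynomial R).coeff d) (p.2 d) := by
  refine ⟨fun hp => ?_, fun hp => hp ▸ reesMonomial_mem _ _ _ _⟩
  ext i
  by_cases h : i = d
  · subst h
    simp [reesMonomial]
  · rw [hp i h]
    simp [reesMonomial, Polynomial.coeff_monomial, Ne.symm h]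

lemma decompose_rees (p : reesAlgebra I) (d : ℕ) :
    (DirectSum.decompose (reesDeg I) p d : reesAlgebra I) =
      reesMonomial I d ((p : Polynomial R).coeff d) (p.2 d) := by
  classical
  conv_lhs => rw [rees_eq_sum I p]
  rw [DirectSum.decompose_sum, DFinsupp.finsetSum_apply, AddSubmonoidClass.coe_finsetSum]
  rw [Finset.sum_eq_single d]
  · rw [DirectSum.decompose_of_mem_same _ (reesMonomial_mem _ _ _ _)]
  · intro i _ hi
    rw [DirectSum.decompose_of_mem_ne _ (reesMonomial_mem _ _ _ _) hi]
  · intro hd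
    rw [DirectSum.decompose_of_mem_same _ (reesMonomial_mem _ _ _ _)]
    ext1
    simp only [Polynomial.mem_support_iff, not_not] at hd
    simp [reesMonomial, hd]

lemma reesMonomial_mul {m n : ℕ} {x y : R} (hx : x ∈ I ^ m) (hy : y ∈ I ^ n) :
    reesMonomial I m x hx * reesMonomial I n y hy =
      reesMonomial I (m + n) (x * y) (pow_add I m n ▸ Ideal.mul_mem_mul hx hy) := by
  ext1
  simp [reesMonomial, Polynomial.monomial_mul_monomial]

lemma reesMonomial_add {n : ℕ} {x y : R} (hx : x ∈ I ^ n) (hy : y ∈ I ^ n) :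
    reesMonomial I n (x + y) (add_mem hx hy) =
      reesMonomial I n x hx + reesMonomial I n y hy := by
  ext1
  simp [reesMonomial]

lemma algebraMap_eq_reesMonomial (r : R) :
    algebraMap R (reesAlgebra I) r = reesMonomial I 0 r (by simp) := rfl

/-- The ideal of the Rees algebra of `I` with degree `d` part `K * I ^ (d - 1)`. -/
def reesKer (K : Ideal R) : Ideal (reesAlgebra I) where
  carrier := { p | ∀ i, (p : Polynomial R).coeff i ∈ K * I ^ (i - 1) }
  add_mem' := fun {p q} hp hq i => by
    simpa using add_mem (hp i) (hq i)
  zero_mem' := fun i => by simp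
  smul_mem' := fun c p hp i => by
    rw [smul_eq_mul]
    simp only [MulMemClass.coe_mul, Polynomial.coeff_mul]
    refine sum_mem fun x hx => ?_
    rw [Finset.HasAntidiagonal.mem_antidiagonal] at hx
    have h1 := Ideal.mul_mem_mul (c.2 x.1) (hp x.2)
    -- Since `x.1 + x.2 = i`, truncated subtraction gives `i - 1 ≤ x.1 + (x.2 - 1)`, also when `x.2
    -- = 0`.
    have h2 : I ^ x.1 * (K * I ^ (x.2 - 1)) ≤ K * I ^ (i - 1) := by
      rw [mul_left_comm, ← pow_add]
      exact Ideal.mul_mono_right (Ideal.pow_le_pow_right (by omega))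
    exact h2 h1

variable {I} in
lemma mem_reesKer {K : Ideal R} {p : reesAlgebra I} :
    p ∈ reesKer I K ↔ ∀ i, (p : Polynomial R).coeff i ∈ K * I ^ (i - 1) := Iff.rfl

variable {I} in
lemma reesMonomial_mem_reesKer {K : Ideal R} {d : ℕ} {x : R} (hx : x ∈ I ^ d) :
    reesMonomial I d x hx ∈ reesKer I K ↔ x ∈ K * I ^ (d - 1) := by
  rw [mem_reesKer]
  refine ⟨fun h => by simpa [reesMonomial] using h d, fun h i => ?_⟩
  by_cases hi : i = d
  · subst hi
    simpa [reesMonomial] using h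
  · simp [reesMonomial, Polynomial.coeff_monomial, Ne.symm hi]

end Rees

/-! ### The quasi-symmetric algebra as a graded quotient of the Rees algebra. -/

section Structure

variable {R A : Type u} [CommRing R] [CommRing A]

/-- As `I` is the whole preimage of `𝔞`, the generators of `Sym 𝔞` in degrees zero and one all lift.
-/
lemma symMap_surjective (φ : R →+* A) (I : Ideal R) (𝔞 : Ideal A) (h : I ≤ 𝔞.comap φ)
    (hφ : Function.Surjective φ) (hI : I = 𝔞.comap φ) :
    Function.Surjective (symMap φ I 𝔞 h) := by
  intro x
  have key : x ∈ (symMap φ I 𝔞 h).range := by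
    refine SymmetricAlgebra.induction (R := A) (M := 𝔞)
      (motive := fun x => (x : Sym 𝔞) ∈ (symMap φ I 𝔞 h).range) ?_ ?_ ?_ ?_ x
    · intro a
      obtain ⟨r, rfl⟩ := hφ a
      exact ⟨_, symMap_algebraMap φ I 𝔞 h r⟩
    · rintro ⟨a, ha⟩
      obtain ⟨r, rfl⟩ := hφ a
      exact ⟨_, symMap_ι φ I 𝔞 h ⟨r, hI ▸ ha⟩⟩
    · intro a b ha hb
      exact mul_mem ha hb
    · intro a b ha hb
      exact add_mem ha hb
  exact key

namespace QSym

variable {φ : R →+* A} {I : Ideal R} {𝔞 : Ideal A} {h : I ≤ 𝔞.comap φ}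

lemma inr_algebraMap (r : R) :
    inr φ I 𝔞 h (algebraMap R _ r) = inl φ I 𝔞 h (algebraMap A _ (φ r)) := by
  rw [← symToRees_algebraMap, ← inl_symMap, symMap_algebraMap]

lemma inr_reesMonomial_one (x : R) (hx : x ∈ I ^ 1) :
    inr φ I 𝔞 h (reesMonomial I 1 x hx) =
      inl φ I 𝔞 h (Sym.ι 𝔞 ⟨φ x, h (by simpa using hx)⟩) := by
  rw [← symMap_ι φ I 𝔞 h ⟨x, by simpa using hx⟩, inl_symMap, symToRees_ι]

lemma induction_on {motive : QSym φ I 𝔞 h → Prop} (x : QSym φ I 𝔞 h)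
    (mul : ∀ a b, motive (inl φ I 𝔞 h a * inr φ I 𝔞 h b))
    (add : ∀ x y, motive x → motive y → motive (x + y)) : motive x := by
  letI := (symMap φ I 𝔞 h).toAlgebra
  letI := (symToRees I).toAlgebra
  refine TensorProduct.induction_on (R := Sym I) (M := Sym 𝔞) (N := reesAlgebra I)
    (motive := motive) x ?_ ?_ ?_
  · have := mul 0 0
    rw [map_zero, zero_mul] at this
    exact this
  · intro a b
    have h1 : inl φ I 𝔞 h a * inr φ I 𝔞 h b = a ⊗ₜ[Sym I] b := by
      refine (Algebra.TensorProduct.tmul_mul_tmul (R := Sym I) a 1 1 b).trans ?_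
      rw [mul_one, one_mul]
    exact h1 ▸ mul a b
  · exact add

/-- A left tensor factor lifts to `Sym I` and can then be moved across the tensor sign into the Rees
algebra. -/
lemma inr_surjective (hφ : Function.Surjective φ) (hI : I = 𝔞.comap φ) :
    Function.Surjective (inr φ I 𝔞 h) := by
  intro x
  have key : x ∈ (inr φ I 𝔞 h).range := by
    refine induction_on x (fun a b => ?_) fun x y hx hy => add_mem hx hy
    obtain ⟨a, rfl⟩ := symMap_surjective φ I 𝔞 h hφ hI a
    rw [inl_symMap]
    exact mul_mem ⟨_, rfl⟩ ⟨_, rfl⟩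
  exact key

/-- For `k ∈ ker φ` the degree one element `k t` equals, across the tensor sign, the symbol of `φ k
= 0`; this kills every product `k a` with `a ∈ I ^ (d - 1)`. In degree zero the kernel itself dies,
in agreement with the convention `0 - 1 = 0`. -/
lemma inr_reesMonomial_eq_zero (hK : RingHom.ker φ ≤ I) {d : ℕ} {x : R}
    (hx : x ∈ RingHom.ker φ * I ^ (d - 1)) (hx' : x ∈ I ^ d) :
    inr φ I 𝔞 h (reesMonomial I d x hx') = 0 := by
  obtain _ | d := d
  · rw [Nat.zero_sub, pow_zero, Ideal.one_eq_top, Ideal.mul_top] at hx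
    rw [← algebraMap_eq_reesMonomial, inr_algebraMap, hx, map_zero, map_zero]
  · rw [Nat.add_one_sub_one] at hx
    induction hx using Submodule.mul_induction_on' with
    | mem_mul_mem k hk a ha =>
      have h1 : reesMonomial I (d + 1) (k * a) hx' =
          reesMonomial I 1 k (by simpa using hK hk) * reesMonomial I d a ha := by
        ext1
        simp [reesMonomial, Polynomial.monomial_mul_monomial, add_comm]
      have h2 : (⟨φ k, h (hK hk)⟩ : 𝔞) = 0 := Subtype.ext hk
      rw [h1, map_mul, inr_reesMonomial_one, h2, map_zero, map_zero, zero_mul]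
    | add x hx y hy ihx ihy =>
      have hle : RingHom.ker φ * I ^ d ≤ I ^ (d + 1) := by
        rw [pow_succ']
        exact Ideal.mul_mono_left hK
      rw [reesMonomial_add I (hle hx) (hle hy), map_add, ihx, ihy, add_zero]

/-- The quotient `B` of the Rees algebra by `reesKer` receives a map from the tensor product: `ker
φ` vanishes in degree zero, so `B` is an `A`-algebra, and in degree one, so `𝔞` maps to `B` by
lifting to `I`. The composite with `inr` is the quotient map, whence the bound on the kernel. -/
lemma ker_le_reesKer (hφ : Function.Surjective φ) (hI : I = 𝔞.comap φ) :
    RingHom.ker (inr φ I 𝔞 h) ≤ reesKer I (RingHom.ker φ) := by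
  let B := reesAlgebra I ⧸ reesKer I (RingHom.ker φ)
  letI : CommRing B := Ideal.Quotient.commRing _
  let mk : reesAlgebra I →+* B := Ideal.Quotient.mk _
  let s : A →+* B := RingHom.liftOfSurjective φ hφ ⟨mk.comp (algebraMap R _), fun r hr => by
    rw [RingHom.mem_ker, RingHom.comp_apply, algebraMap_eq_reesMonomial]
    exact Ideal.Quotient.eq_zero_iff_mem.mpr
      ((reesMonomial_mem_reesKer _).mpr (by simpa using hr))⟩
  have hs : ∀ r, s (φ r) = mk (algebraMap R _ r) := fun r =>
    RingHom.liftOfRightInverse_comp_apply _ _ _ ⟨mk.comp (algebraMap R _), _⟩ r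
  letI : Algebra A B := s.toAlgebra
  have hmk : ∀ x y (hx : x ∈ I ^ 1) (hy : y ∈ I ^ 1), φ x = φ y →
      mk (reesMonomial I 1 x hx) = mk (reesMonomial I 1 y hy) := by
    intro x y hx hy hxy
    refine Ideal.Quotient.eq.mpr ?_
    have h1 : reesMonomial I 1 x hx - reesMonomial I 1 y hy =
        reesMonomial I 1 (x - y) (sub_mem hx hy) := by
      ext1
      simp [reesMonomial]
    rw [h1, reesMonomial_mem_reesKer]
    simp [RingHom.mem_ker, hxy]
  -- A set-theoretic section of `φ`; by `hmk` the class of a lift in degree one does not depend on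
  -- the choice, which yields linearity of `l`.
  choose σ hσ using id hφ
  have hσI : ∀ x : 𝔞, σ x ∈ I ^ 1 := fun x => by
    rw [pow_one, hI, Ideal.mem_comap, hσ]
    exact x.2
  let l : 𝔞 →ₗ[A] B :=
    { toFun := fun x => mk (reesMonomial I 1 (σ x) (hσI x))
      map_add' := fun x y => by
        rw [← map_add, ← reesMonomial_add]
        exact hmk _ _ _ _ (by simp [hσ])
      map_smul' := fun a x => by
        rw [RingHom.id_apply, Algebra.smul_def]
        change _ = s a * _
        rw [← hσ a, hs, ← map_mul, algebraMap_eq_reesMonomial, reesMonomial_mul]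
        have h1 : reesMonomial I (0 + 1) (σ a * σ x)
            (pow_add I 0 1 ▸ Ideal.mul_mem_mul (by simp) (hσI x)) =
            reesMonomial I 1 (σ a * σ x) (Ideal.mul_mem_left _ _ (hσI x)) := by
          ext1
          simp [reesMonomial]
        rw [h1]
        exact hmk _ _ _ _ (by simp [hσ]) }
  have hcomp : ∀ x, (Sym.lift l).toRingHom (symMap φ I 𝔞 h x) = mk (symToRees I x) := by
    intro x
    have h1 : (Sym.lift l).toRingHom.comp (symMap φ I 𝔞 h) = mk.comp (symToRees I) := by
      refine Sym.ringHom_ext (fun r => ?_) fun x => ?_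
      · simp only [RingHom.comp_apply, symMap_algebraMap, symToRees_algebraMap]
        exact ((Sym.lift l).commutes _).trans (hs r)
      · simp only [RingHom.comp_apply, symMap_ι, symToRees_ι]
        refine (Sym.lift_ι l _).trans ?_
        exact hmk _ _ _ _ (by simp [hσ])
    exact congr($h1 x)
  intro p hp
  have h1 := lift_inr (φ := φ) (h := h) (Sym.lift l).toRingHom mk hcomp p
  rw [hp, map_zero] at h1
  exact Ideal.Quotient.eq_zero_iff_mem.mp h1.symm

lemma ker_le_of_eq_comap (hI : I = 𝔞.comap φ) : RingHom.ker φ ≤ I := by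
  intro x hx
  rw [hI, Ideal.mem_comap, hx]
  exact zero_mem _

/-- The kernel of `Rees_R(I) → qSym_{R → A}(𝔞)` has degree `d` part `ker φ * I ^ (d - 1)`. -/
lemma ker_inr (hφ : Function.Surjective φ) (hI : I = 𝔞.comap φ) :
    RingHom.ker (inr φ I 𝔞 h) = reesKer I (RingHom.ker φ) := by
  refine le_antisymm (ker_le_reesKer hφ hI) fun p hp => ?_
  rw [rees_eq_sum I p]
  refine sum_mem fun d _ => ?_
  exact inr_reesMonomial_eq_zero (ker_le_of_eq_comap hI) (hp d) _

lemma inr_reesMonomial_eq_zero_iff (hφ : Function.Surjective φ) (hI : I = 𝔞.comap φ) {d : ℕ}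
    {x : R} (hx : x ∈ I ^ d) :
    inr φ I 𝔞 h (reesMonomial I d x hx) = 0 ↔ x ∈ RingHom.ker φ * I ^ (d - 1) := by
  rw [← RingHom.mem_ker, ker_inr hφ hI, reesMonomial_mem_reesKer]

lemma inr_reesMonomial_mem_deg {d : ℕ} {x : R} (hx : x ∈ I ^ d) :
    inr φ I 𝔞 h (reesMonomial I d x hx) ∈ deg φ I 𝔞 h d := by
  induction d generalizing x with
  | zero =>
    rw [← algebraMap_eq_reesMonomial, inr_algebraMap]
    refine ⟨_, ?_, rfl⟩
    rw [Sym.deg, pow_zero]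
    exact ⟨φ x, Algebra.algebraMap_eq_smul_one _ |>.symm⟩
  | succ d ih =>
    have hx' := hx
    rw [pow_succ] at hx'
    induction hx' using Submodule.mul_induction_on' with
    | mem_mul_mem a ha b hb =>
      have h1 : reesMonomial I (d + 1) (a * b) hx =
          reesMonomial I d a ha * reesMonomial I 1 b (by simpa using hb) := by
        ext1
        simp [reesMonomial, Polynomial.monomial_mul_monomial]
      rw [h1, map_mul, inr_reesMonomial_one]
      obtain ⟨y, hy, hy'⟩ := ih ha
      rw [← hy']
      refine ⟨y * Sym.ι 𝔞 ⟨φ b, h hb⟩, ?_, map_mul (inl φ I 𝔞 h) _ _⟩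
      rw [Sym.deg, pow_succ]
      exact Submodule.mul_mem_mul hy ⟨_, rfl⟩
    | add x hx₁ y hy₁ ihx ihy =>
      rw [← pow_succ] at hx₁ hy₁
      rw [reesMonomial_add I hx₁ hy₁, map_add]
      exact add_mem (ihx hx₁) (ihy hy₁)

/-- The grading is defined through `Sym`, while computations take place in the Rees algebra;
products of degree one symbols lift to products of elements `r t`. -/
lemma deg_eq_map (hφ : Function.Surjective φ) (hI : I = 𝔞.comap φ) (d : ℕ) :
    deg φ I 𝔞 h d = (reesDeg I d).map (inr φ I 𝔞 h).toAddMonoidHom := by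
  refine le_antisymm ?_ ?_
  · rintro _ ⟨y, hy, rfl⟩
    have hy' : y ∈ LinearMap.range (Sym.ι 𝔞) ^ d := hy
    clear hy
    change inl φ I 𝔞 h y ∈ _
    induction d generalizing y with
    | zero =>
      rw [pow_zero] at hy'
      obtain ⟨a, rfl⟩ := hy'
      obtain ⟨r, rfl⟩ := hφ a
      refine ⟨algebraMap R _ r, reesMonomial_mem I 0 r (by simp), ?_⟩
      refine (inr_algebraMap r).trans ?_
      rw [Algebra.algebraMap_eq_smul_one]
      rfl
    | succ d ih =>
      rw [pow_succ] at hy'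
      induction hy' using Submodule.mul_induction_on' with
      | mem_mul_mem a ha b hb =>
        obtain ⟨p, hp, hp'⟩ := ih a ha
        obtain ⟨⟨b, hb'⟩, rfl⟩ := hb
        obtain ⟨r, rfl⟩ := hφ b
        have hr : r ∈ I := hI ▸ hb'
        refine ⟨p * reesMonomial I 1 r (by simpa using hr),
          SetLike.mul_mem_graded hp (reesMonomial_mem _ _ _ _), ?_⟩
        refine (map_mul (inr φ I 𝔞 h) _ _).trans ?_
        rw [inr_reesMonomial_one, map_mul]
        congr 1
      | add x _ y _ hx hy =>
        rw [map_add]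
        exact add_mem hx hy
  · rintro _ ⟨p, hp, rfl⟩
    rw [SetLike.mem_coe, mem_reesDeg_iff] at hp
    rw [hp]
    exact inr_reesMonomial_mem_deg _

lemma exists_of_mem_deg (hφ : Function.Surjective φ) (hI : I = 𝔞.comap φ) {d : ℕ}
    {b : QSym φ I 𝔞 h} (hb : b ∈ deg φ I 𝔞 h d) :
    ∃ (x : R) (hx : x ∈ I ^ d), b = inr φ I 𝔞 h (reesMonomial I d x hx) := by
  rw [deg_eq_map hφ hI] at hb
  obtain ⟨p, hp, rfl⟩ := hb
  exact ⟨_, p.2 d, congr(inr φ I 𝔞 h $((mem_reesDeg_iff I).mp hp))⟩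

/-- The grading of a quasi-symmetric algebra. -/
@[reducible]
def gradedRing (hφ : Function.Surjective φ) (hI : I = 𝔞.comap φ) : GradedRing (deg φ I 𝔞 h) :=
  gradedRingOfSurjective (reesDeg I) _ (inr φ I 𝔞 h) (inr_surjective hφ hI) (deg_eq_map hφ hI)
    (fun p hp d => by
      have h1 : p ∈ reesKer I (RingHom.ker φ) := ker_le_reesKer hφ hI hp
      rw [decompose_rees, inr_reesMonomial_eq_zero_iff hφ hI]
      exact h1 d)

end QSym
end Structure

end QSymBlowUp

namespace QSymBlowUp

namespace QSym

/-! ### Maps between quasi-symmetric algebras -/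

section Map

variable {R A R' A' R'' A'' : Type u} [CommRing R] [CommRing A] [CommRing R'] [CommRing A']
  [CommRing R''] [CommRing A'']
  {φ : R →+* A} {I : Ideal R} {𝔞 : Ideal A} {h : I ≤ 𝔞.comap φ}
  {φ' : R' →+* A'} {I' : Ideal R'} {𝔞' : Ideal A'} {h' : I' ≤ 𝔞'.comap φ'}
  {φ'' : R'' →+* A''} {I'' : Ideal R''} {𝔞'' : Ideal A''} {h'' : I'' ≤ 𝔞''.comap φ''}

lemma map_inr (r : R →+* R') (a : A →+* A') (comm : a.comp φ = φ'.comp r)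
    (hI : I ≤ I'.comap r) (ha : 𝔞 ≤ 𝔞'.comap a) (p : reesAlgebra I) :
    QSym.map (h := h) (h' := h') r a comm hI ha (inr φ I 𝔞 h p) =
      inr φ' I' 𝔞' h' (reesMap r I I' hI p) :=
  lift_inr _ _ _ p

lemma map_inl (r : R →+* R') (a : A →+* A') (comm : a.comp φ = φ'.comp r)
    (hI : I ≤ I'.comap r) (ha : 𝔞 ≤ 𝔞'.comap a) (p : Sym 𝔞) :
    QSym.map (h := h) (h' := h') r a comm hI ha (inl φ I 𝔞 h p) =
      inl φ' I' 𝔞' h' (symMap a 𝔞 𝔞' ha p) :=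
  lift_inl _ _ _ p

lemma reesMap_reesMonomial (r : R →+* R') (hI : I ≤ I'.comap r) {d : ℕ} {x : R} (hx : x ∈ I ^ d) :
    reesMap r I I' hI (reesMonomial I d x hx) = reesMonomial I' d (r x)
      (Ideal.mem_comap.mp ((Ideal.pow_right_mono hI d).trans (Ideal.le_comap_pow r d) hx)) := by
  ext1
  simp [reesMonomial]

lemma map_inr_reesMonomial (r : R →+* R') (a : A →+* A') (comm : a.comp φ = φ'.comp r)
    (hI : I ≤ I'.comap r) (ha : 𝔞 ≤ 𝔞'.comap a) {d : ℕ} {x : R} (hx : x ∈ I ^ d)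
    (hx' : r x ∈ I' ^ d) :
    QSym.map (h := h) (h' := h') r a comm hI ha (inr φ I 𝔞 h (reesMonomial I d x hx)) =
      inr φ' I' 𝔞' h' (reesMonomial I' d (r x) hx') :=
  (map_inr r a comm hI ha _).trans congr(inr φ' I' 𝔞' h' $(reesMap_reesMonomial r hI hx))

lemma map_mem_deg (hφ : Function.Surjective φ) (hI₀ : I = 𝔞.comap φ)
    (r : R →+* R') (a : A →+* A') (comm : a.comp φ = φ'.comp r)
    (hI : I ≤ I'.comap r) (ha : 𝔞 ≤ 𝔞'.comap a) {d : ℕ} {b : QSym φ I 𝔞 h}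
    (hb : b ∈ deg φ I 𝔞 h d) :
    QSym.map (h := h) (h' := h') r a comm hI ha b ∈ deg φ' I' 𝔞' h' d := by
  obtain ⟨x, hx, rfl⟩ := exists_of_mem_deg hφ hI₀ hb
  rw [map_inr, reesMap_reesMonomial]
  exact inr_reesMonomial_mem_deg _

/-- The Rees algebra surjects onto the source, so only the ambient ring maps have to be compared. -/
lemma map_map (hφ : Function.Surjective φ) (hI₀ : I = 𝔞.comap φ)
    (r : R →+* R') (a : A →+* A') (comm : a.comp φ = φ'.comp r)
    (hI : I ≤ I'.comap r) (ha : 𝔞 ≤ 𝔞'.comap a)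
    (r' : R' →+* R'') (a' : A' →+* A'') (comm' : a'.comp φ' = φ''.comp r')
    (hI' : I' ≤ I''.comap r') (ha' : 𝔞' ≤ 𝔞''.comap a')
    (r₁ : R →+* R'') (a₁ : A →+* A'') (comm₁ : a₁.comp φ = φ''.comp r₁)
    (hI₁ : I ≤ I''.comap r₁) (ha₁ : 𝔞 ≤ 𝔞''.comap a₁) (hr : ∀ x, r' (r x) = r₁ x)
    (x : QSym φ I 𝔞 h) :
    QSym.map (h := h') (h' := h'') r' a' comm' hI' ha'
      (QSym.map (h := h) (h' := h') r a comm hI ha x) =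
      QSym.map (h := h) (h' := h'') r₁ a₁ comm₁ hI₁ ha₁ x := by
  obtain ⟨p, rfl⟩ := inr_surjective hφ hI₀ x
  rw [map_inr, map_inr, map_inr]
  congr 1
  ext1
  simp only [coe_reesMap, Polynomial.map_map]
  congr 1
  ext x
  exact hr x

lemma map_id_apply (hφ : Function.Surjective φ) (hI₀ : I = 𝔞.comap φ)
    (r : R →+* R) (a : A →+* A) (comm : a.comp φ = φ.comp r)
    (hI : I ≤ I.comap r) (ha : 𝔞 ≤ 𝔞.comap a) (hr : ∀ x, r x = x)
    (x : QSym φ I 𝔞 h) :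
    QSym.map (h := h) (h' := h) r a comm hI ha x = x := by
  obtain ⟨p, rfl⟩ := inr_surjective hφ hI₀ x
  rw [map_inr]
  congr 1
  ext1
  obtain rfl : r = RingHom.id R := RingHom.ext hr
  simp

/-- A quasi-symmetric algebra of a localization is a localization. -/
lemma isLocalization_map (hφ : Function.Surjective φ) (hI₀ : I = 𝔞.comap φ)
    (hφ' : Function.Surjective φ') (hI₀' : I' = 𝔞'.comap φ')
    (r : R →+* R') (a : A →+* A') (comm : a.comp φ = φ'.comp r)
    (hI : I ≤ I'.comap r) (ha : 𝔞 ≤ 𝔞'.comap a) (f : R)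
    (hr : letI := r.toAlgebra; IsLocalization.Away f R') (hI' : I' = I.map r)
    (hK : RingHom.ker φ' = (RingHom.ker φ).map r) :
    letI := (QSym.map (h := h) (h' := h') r a comm hI ha).toAlgebra
    IsLocalization.Away (inl φ I 𝔞 h (algebraMap A _ (φ f))) (QSym φ' I' 𝔞' h') := by
  letI := (reesMap r I I' hI).toAlgebra
  letI := (QSym.map (h := h) (h' := h') r a comm hI ha).toAlgebra
  have h1 := rees_isLocalization r I I' hI f hr hI'
  -- The localization of Rees algebras passes to the quotients, provided the kernel upstairs is
  -- generated by the image of the kernel downstairs. This is checked on each monomial, using that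
  -- both `K` and `I` extend along `r`.
  have h2 := IsLocalization.of_surjective (Submonoid.powers (algebraMap R (reesAlgebra I) f))
    (S := reesAlgebra I') (inr φ I 𝔞 h) (inr_surjective hφ hI₀)
    (inr φ' I' 𝔞' h') (inr_surjective hφ' hI₀')
    (RingHom.ext fun p => (map_inr (h := h) (h' := h') r a comm hI ha p).symm) (by
      rw [ker_inr hφ' hI₀', ker_inr hφ hI₀]
      intro p hp
      rw [rees_eq_sum I' p]
      refine sum_mem fun d _ => ?_
      have hpd := hp d
      generalize_proofs _ h3
      have h4 : RingHom.ker φ' * I' ^ (d - 1) ≤ I' ^ d := by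
        obtain _ | d := d
        · simp
        · rw [Nat.add_one_sub_one, pow_succ']
          exact Ideal.mul_mono_left (ker_le_of_eq_comap hI₀')
      have h5 : RingHom.ker φ * I ^ (d - 1) ≤ I ^ d := by
        obtain _ | d := d
        · simp
        · rw [Nat.add_one_sub_one, pow_succ']
          exact Ideal.mul_mono_left (ker_le_of_eq_comap hI₀)
      have h6 : RingHom.ker φ' * I' ^ (d - 1) = (RingHom.ker φ * I ^ (d - 1)).map r := by
        rw [Ideal.map_mul, Ideal.map_pow, hK, hI']
      suffices H : ∀ y ∈ (RingHom.ker φ * I ^ (d - 1)).map r, ∀ hy : y ∈ I' ^ d,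
          reesMonomial I' d y hy ∈
            (reesKer I (RingHom.ker φ)).map (algebraMap (reesAlgebra I) (reesAlgebra I')) from
        H _ (h6 ▸ hpd) _
      intro y hy
      induction hy using Submodule.span_induction with
      | mem y hy =>
        obtain ⟨x, hx, rfl⟩ := hy
        intro hy
        have h7 := (reesMonomial_mem_reesKer (h5 hx)).mpr hx
        convert Ideal.mem_map_of_mem (algebraMap (reesAlgebra I) (reesAlgebra I')) h7 using 1
        exact (reesMap_reesMonomial r hI (h5 hx)).symm
      | zero =>
        intro _
        have h9 : reesMonomial I' d 0 (zero_mem _) = 0 := by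
          ext1
          simp [reesMonomial]
        rw [h9]
        exact zero_mem _
      | add x y hx hy ihx ihy =>
        intro h8
        rw [reesMonomial_add I' (h4 (h6 ▸ hx)) (h4 (h6 ▸ hy))]
        exact add_mem (ihx _) (ihy _)
      | smul c x hx ih =>
        intro h8
        have h9 : reesMonomial I' d (c • x) h8 =
            algebraMap R' _ c * reesMonomial I' d x (h4 (h6 ▸ hx)) := by
          ext1
          change _ = Polynomial.C c * _
          simp [reesMonomial, Polynomial.C_mul_monomial]
        rw [h9]
        exact Ideal.mul_mem_left _ _ (ih _))
  rw [Submonoid.map_powers] at h2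
  rw [← inr_algebraMap]
  exact h2

end Map

/-! ### Formally smooth embeddings -/

section Smooth

/-- Both maps are multiplicative, so on a product the difference expands by a Leibniz rule with a
quadratic correction. Each further factor from `I` contributes one more power of `I`, and the
correction is absorbed because `L ≤ I`. -/
lemma sub_lift_mem {C D : Type u} [CommRing C] [CommRing D] (q e : C →+* D) (I L : Ideal C)
    (hL : L ≤ I) (H : ∀ x, q x - e x ∈ L.map q) (n : ℕ) :
    ∀ x ∈ I ^ (n + 1), q x - e x ∈ (L * I ^ n).map q := by
  induction n with
  | zero => intro x _; simpa using H x
  | succ n ih =>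
    intro x hx
    rw [pow_succ] at hx
    induction hx using Submodule.mul_induction_on' with
    | mem_mul_mem x hx y hy =>
      have h1 : q (x * y) - e (x * y) = (q x - e x) * q y + q x * (q y - e y) -
          (q x - e x) * (q y - e y) := by
        simp only [map_mul]; ring
      have h2 : ∀ J, (L * I ^ n).map q * J.map q = (L * (I ^ n * J)).map q := fun J => by
        rw [← Ideal.map_mul, mul_assoc]
      rw [h1]
      refine sub_mem (add_mem ?_ ?_) ?_
      · rw [pow_succ, ← h2]
        exact Ideal.mul_mem_mul (ih x hx) (Ideal.mem_map_of_mem q hy)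
      · rw [mul_comm L, Ideal.map_mul]
        exact Ideal.mul_mem_mul (Ideal.mem_map_of_mem q hx) (H y)
      · have h3 := Ideal.mul_mem_mul (ih x hx) (H y)
        rw [h2] at h3
        refine Ideal.map_mono (Ideal.mul_mono_right ?_) h3
        rw [pow_succ]
        exact Ideal.mul_mono_right hL
    | add x _ y _ hx hy =>
      rw [map_add, map_add, add_sub_add_comm]
      exact add_mem hx hy

/-- If `R = C / L` is formally smooth, then `L ∩ I ^ d = L * I ^ (d - 1)` for `L ≤ I`. -/
lemma mem_mul_pow_of_formallySmooth {k C R : Type u} [CommRing k] [CommRing C] [CommRing R]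
    [Algebra k C] [Algebra k R] [Algebra.FormallySmooth k R] (r : C →ₐ[k] R)
    (hr : Function.Surjective r) (I : Ideal C) (hI : RingHom.ker r ≤ I) (d : ℕ) (x : C)
    (hx : x ∈ I ^ (d + 1)) (hx0 : r x = 0) : x ∈ RingHom.ker r * I ^ d := by
  set L := RingHom.ker r with hL
  -- Truncating modulo `L ^ (d + 1)` makes the kernel of the map to `R` nilpotent, so that formal
  -- smoothness provides a section. Nothing is lost, since `L ^ (d + 1) ≤ L * I ^ d`.
  let q : C →ₐ[k] C ⧸ L ^ (d + 1) := Ideal.Quotient.mkₐ k _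
  have hq : Function.Surjective q := Ideal.Quotient.mk_surjective
  let rbar : (C ⧸ L ^ (d + 1)) →ₐ[k] R := Ideal.Quotient.liftₐ (L ^ (d + 1)) r
    (fun a ha => Ideal.pow_le_self (by omega) ha)
  have hrbar : ∀ c, rbar (q c) = r c := fun c => rfl
  have hker : ∀ y, rbar y = 0 → y ∈ L.map (q : C →+* C ⧸ L ^ (d + 1)) := by
    intro y hy
    obtain ⟨c, rfl⟩ := hq y
    exact Ideal.mem_map_of_mem _ hy
  have hnil : IsNilpotent (RingHom.ker (rbar : (C ⧸ L ^ (d + 1)) →+* R)) := by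
    refine ⟨d + 1, ?_⟩
    rw [Ideal.zero_eq_bot, ← le_bot_iff]
    refine (Ideal.pow_right_mono (fun y hy => hker y hy) _).trans ?_
    rw [← Ideal.map_pow]
    exact (Ideal.map_quotient_self _).le
  have hrs : Function.Surjective rbar := fun y => by
    obtain ⟨c, rfl⟩ := hr y
    exact ⟨q c, rfl⟩
  let σ := Algebra.FormallySmooth.liftOfSurjective (AlgHom.id k R) rbar hrs hnil
  have hσ : ∀ y, rbar (σ y) = y := fun y =>
    Algebra.FormallySmooth.liftOfSurjective_apply (AlgHom.id k R) rbar hrs hnil y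
  -- The quotient map and `σ ∘ r` agree modulo `L`, and the latter kills `x`; so the class of `x`
  -- itself lies in the image of `L * I ^ d`.
  have h1 := sub_lift_mem (q : C →+* C ⧸ L ^ (d + 1)) ((σ.comp r : C →ₐ[k] C ⧸ L ^ (d + 1)) : C →+* C ⧸ L ^ (d + 1)) I L hI
    (fun x => hker _ (by
      rw [map_sub, sub_eq_zero]
      exact ((hσ (r x)).trans (hrbar x).symm).symm)) d x hx
  have h2 : ((σ.comp r : C →ₐ[k] C ⧸ L ^ (d + 1)) : C →+* C ⧸ L ^ (d + 1)) x = 0 := by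
    change σ (r x) = 0
    rw [hx0, map_zero]
  rw [h2, sub_zero] at h1
  obtain ⟨y, hy, hxy⟩ := (Ideal.mem_map_iff_of_surjective _ hq).mp h1
  have h3 : x - y ∈ L ^ (d + 1) := Ideal.Quotient.eq.mp hxy.symm
  have h4 : L ^ (d + 1) ≤ L * I ^ d := by
    rw [pow_succ']
    exact Ideal.mul_mono_right (Ideal.pow_right_mono hI d)
  have := add_mem (h4 h3) hy
  rwa [sub_add_cancel] at this

variable {k C R A : Type u} [CommRing k] [CommRing C] [CommRing R] [CommRing A]
  [Algebra k C] [Algebra k R]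
  {ψ : C →+* A} {J : Ideal C} {φ : R →+* A} {I : Ideal R} {𝔞 : Ideal A}
  {h' : J ≤ 𝔞.comap ψ} {h : I ≤ 𝔞.comap φ}

/-- If `R` is formally smooth, then `qSym_{C → A}(𝔞) → qSym_{R → A}(𝔞)` is an isomorphism. -/
lemma map_bijective_of_formallySmooth [Algebra.FormallySmooth k R]
    (hφ : Function.Surjective φ) (hI₀ : I = 𝔞.comap φ) (r : C →ₐ[k] R)
    (hr : Function.Surjective r)
    (comm : (RingHom.id A).comp ψ = φ.comp (r : C →+* R)) (hJ₀ : J = 𝔞.comap ψ)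
    (hJ : J ≤ I.comap (r : C →+* R)) (ha : 𝔞 ≤ 𝔞.comap (RingHom.id A)) :
    Function.Bijective
      (QSym.map (h := h') (h' := h) (r : C →+* R) (RingHom.id A) comm hJ ha) := by
  have hψr : ∀ c, ψ c = φ (r c) := fun c => congr($comm c)
  have hψ : Function.Surjective ψ := fun a => by
    obtain ⟨b, rfl⟩ := hφ a
    obtain ⟨c, rfl⟩ := hr b
    exact ⟨c, hψr c⟩
  have hJr : J = I.comap (r : C →+* R) := by
    rw [hJ₀, hI₀, Ideal.comap_comap, ← comm]
    rfl
  have hJI : J.map (r : C →+* R) = I := by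
    rw [hJr]
    exact Ideal.map_comap_of_surjective _ hr I
  have hKr : RingHom.ker ψ = (RingHom.ker φ).comap (r : C →+* R) := by
    ext c
    simp [RingHom.mem_ker, hψr]
  have hK : (RingHom.ker ψ).map (r : C →+* R) = RingHom.ker φ := by
    rw [hKr]
    exact Ideal.map_comap_of_surjective _ hr _
  have hLK : RingHom.ker r ≤ RingHom.ker ψ := by
    intro c hc
    rw [RingHom.mem_ker] at hc
    rw [RingHom.mem_ker, hψr, hc, map_zero]
  have hKJ : RingHom.ker ψ ≤ J := ker_le_of_eq_comap hJ₀
  constructor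
  · rw [injective_iff_map_eq_zero]
    intro x hx
    obtain ⟨p, rfl⟩ := inr_surjective hψ hJ₀ x
    rw [map_inr, ← RingHom.mem_ker, ker_inr hφ hI₀, mem_reesKer] at hx
    rw [← RingHom.mem_ker, ker_inr hψ hJ₀, mem_reesKer]
    intro d
    have h1 := hx d
    have hpd : (p : Polynomial C).coeff d ∈ J ^ d := p.2 d
    rw [coe_reesMap, Polynomial.coeff_map] at h1
    generalize (p : Polynomial C).coeff d = c at h1 hpd
    have h2 : RingHom.ker φ * I ^ (d - 1) =
        (RingHom.ker ψ * J ^ (d - 1)).map (r : C →+* R) := by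
      rw [Ideal.map_mul, Ideal.map_pow, hK, hJI]
    rw [h2] at h1
    obtain ⟨y, hy, hyc⟩ := (Ideal.mem_map_iff_of_surjective _ hr).mp h1
    have h3 : r (c - y) = 0 := by
      rw [map_sub, sub_eq_zero]
      exact hyc.symm
    -- The difference lies in `ker r ∩ J ^ d`, which is where formal smoothness enters. In degree
    -- zero the inclusion `ker r ≤ ker ψ` is enough.
    suffices h4 : c - y ∈ RingHom.ker ψ * J ^ (d - 1) by
      have := add_mem h4 hy
      rwa [sub_add_cancel] at this
    obtain _ | d := d
    · simpa using hLK h3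
    · have h5 : y ∈ J ^ (d + 1) := by
        rw [pow_succ']
        exact Ideal.mul_mono_left hKJ hy
      exact Ideal.mul_mono_left hLK
        (mem_mul_pow_of_formallySmooth r hr J (hLK.trans hKJ) d _ (sub_mem hpd h5) h3)
  · intro x
    obtain ⟨p, rfl⟩ := inr_surjective hφ hI₀ x
    have key : inr φ I 𝔞 h p ∈
        (QSym.map (h := h') (h' := h) (r : C →+* R) (RingHom.id A) comm hJ ha).range := by
      rw [rees_eq_sum I p, map_sum]
      refine sum_mem fun d _ => ?_
      have hx : (p : Polynomial R).coeff d ∈ I ^ d := p.2 d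
      change inr φ I 𝔞 h (reesMonomial I d _ hx) ∈ _
      generalize (p : Polynomial R).coeff d = y at hx ⊢
      have hx' := hx
      rw [← hJI, ← Ideal.map_pow] at hx'
      obtain ⟨z, hz, rfl⟩ := (Ideal.mem_map_iff_of_surjective _ hr).mp hx'
      refine ⟨inr _ _ _ _ (reesMonomial J d z hz), ?_⟩
      exact map_inr_reesMonomial _ _ comm hJ ha hz hx
    exact key

end Smooth

/-! ### The comparison map -/

section Comparison

variable {k R A S A' : Type u} [CommRing k] [CommRing R] [CommRing A] [CommRing S] [CommRing A']

/-- The fibre product of `ψ : S → A'` and `R → A → A'`. -/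
abbrev FiberProd (φ : R →+* A) (ψ : S →+* A') (a : A →+* A') : Subring (S × R) :=
  RingHom.eqLocus (ψ.comp (RingHom.fst S R)) ((a.comp φ).comp (RingHom.snd S R))

namespace FiberProd

variable (φ : R →+* A) (ψ : S →+* A') (a : A →+* A')

/-- The first projection. -/
def fst : FiberProd φ ψ a →+* S := (RingHom.fst S R).comp (FiberProd φ ψ a).subtype

/-- The second projection. -/
def snd : FiberProd φ ψ a →+* R := (RingHom.snd S R).comp (FiberProd φ ψ a).subtype

lemma comm : a.comp (φ.comp (snd φ ψ a)) = ψ.comp (fst φ ψ a) :=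
  RingHom.ext fun x => x.2.symm

lemma snd_surjective (hψ : Function.Surjective ψ) : Function.Surjective (snd φ ψ a) := fun r => by
  obtain ⟨s, hs⟩ := hψ (a (φ r))
  exact ⟨⟨(s, r), hs⟩, rfl⟩

variable {φ ψ a} in
/-- The universal property. -/
def lift {B : Type u} [CommRing B] (s : B →+* S) (r : B →+* R)
    (H : ∀ b, ψ (s b) = a (φ (r b))) : B →+* FiberProd φ ψ a :=
  (s.prod r).codRestrict (FiberProd φ ψ a) H

end FiberProd

variable {φ : R →+* A} {I : Ideal R} {𝔞 : Ideal A} {h : I ≤ 𝔞.comap φ}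
  {ψ : S →+* A'} {I' : Ideal S} {𝔞' : Ideal A'} {h' : I' ≤ 𝔞'.comap ψ}

/-- The map from the quasi-symmetric algebra of the fibre product to that of the second factor. -/
def fiberSnd (hI : I = 𝔞.comap φ) (ψ : S →+* A') (a : A →+* A') :
    QSym (φ.comp (FiberProd.snd φ ψ a)) _ 𝔞 le_rfl →+* QSym φ I 𝔞 h :=
  QSym.map (FiberProd.snd φ ψ a) (RingHom.id A) (RingHom.id_comp _)
    (by rw [hI, Ideal.comap_comap]) (fun _ hx => hx)

/-- The map from the quasi-symmetric algebra of the fibre product to that of the first factor. -/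
def fiberFst (φ : R →+* A) (a : A →+* A') (hI' : I' = 𝔞'.comap ψ) (ha : 𝔞 ≤ 𝔞'.comap a) :
    QSym (φ.comp (FiberProd.snd φ ψ a)) _ 𝔞 le_rfl →+* QSym ψ I' 𝔞' h' :=
  QSym.map (FiberProd.fst φ ψ a) a (FiberProd.comm φ ψ a)
    (by
      rw [hI', Ideal.comap_comap, ← FiberProd.comm φ ψ a, ← Ideal.comap_comap]
      exact Ideal.comap_mono (f := φ.comp (FiberProd.snd φ ψ a)) ha) ha

/-- Surjectivity of `ψ` makes the second projection onto the formally smooth `R` surjective, and the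
two structure maps from `k` combine into one to the fibre product by `hRS`. -/
lemma fiberSnd_bijective (hφ : Function.Surjective φ) (hI : I = 𝔞.comap φ)
    (hψ : Function.Surjective ψ) (a : A →+* A') (κR : k →+* R) (hκ : κR.FormallySmooth)
    (κS : k →+* S) (hRS : ∀ c, ψ (κS c) = a (φ (κR c))) :
    Function.Bijective (fiberSnd (h := h) hI ψ a) := by
  letI : Algebra k R := κR.toAlgebra
  letI : Algebra k (FiberProd φ ψ a) := (FiberProd.lift κS κR hRS).toAlgebra
  haveI : Algebra.FormallySmooth k R := hκ
  let r : FiberProd φ ψ a →ₐ[k] R := { FiberProd.snd φ ψ a with commutes' := fun c => rfl }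
  exact map_bijective_of_formallySmooth hφ hI r (FiberProd.snd_surjective φ ψ a hψ)
    (RingHom.id_comp _) rfl _ _

/-- The comparison map `qSym_{R → A}(𝔞) → qSym_{S → A'}(𝔞')`, for `R` formally smooth. -/
def comparison (hI : I = 𝔞.comap φ) (hI' : I' = 𝔞'.comap ψ) (a : A →+* A')
    (ha : 𝔞 ≤ 𝔞'.comap a) (hb : Function.Bijective (fiberSnd (h := h) hI ψ a)) :
    QSym φ I 𝔞 h →+* QSym ψ I' 𝔞' h' :=
  (fiberFst φ a hI' ha).comp (RingEquiv.ofBijective _ hb).symm.toRingHom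

lemma comparison_fiberSnd (hI : I = 𝔞.comap φ) (hI' : I' = 𝔞'.comap ψ) (a : A →+* A')
    (ha : 𝔞 ≤ 𝔞'.comap a) (hb : Function.Bijective (fiberSnd (h := h) hI ψ a)) (c) :
    comparison (h' := h') hI hI' a ha hb (fiberSnd hI ψ a c) = fiberFst φ a hI' ha c :=
  congr(fiberFst φ a hI' ha $((RingEquiv.ofBijective _ hb).symm_apply_apply c))

/-- The comparison map is determined by its compatibility with maps from a common source. -/
lemma comparison_map (hI : I = 𝔞.comap φ)
    (hI' : I' = 𝔞'.comap ψ) (a : A →+* A')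
    (ha : 𝔞 ≤ 𝔞'.comap a) (hb : Function.Bijective (fiberSnd (h := h) hI ψ a))
    {B A₀ : Type u} [CommRing B] [CommRing A₀] {β : B →+* A₀} {I₀ : Ideal B} {𝔞₀ : Ideal A₀}
    {h₀ : I₀ ≤ 𝔞₀.comap β} (hβ : Function.Surjective β) (hI₀ : I₀ = 𝔞₀.comap β)
    (r : B →+* R) (a₁ : A₀ →+* A) (comm₁ : a₁.comp β = φ.comp r) (hI₁ : I₀ ≤ I.comap r)
    (ha₁ : 𝔞₀ ≤ 𝔞.comap a₁)
    (s : B →+* S) (a₂ : A₀ →+* A') (comm₂ : a₂.comp β = ψ.comp s) (hI₂ : I₀ ≤ I'.comap s)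
    (ha₂ : 𝔞₀ ≤ 𝔞'.comap a₂) (H : ∀ b, a (a₁ b) = a₂ b) (c : QSym β I₀ 𝔞₀ h₀) :
    comparison (h' := h') hI hI' a ha hb (QSym.map (h' := h) r a₁ comm₁ hI₁ ha₁ c) =
      QSym.map (h' := h') s a₂ comm₂ hI₂ ha₂ c := by
  have H' : ∀ b, ψ (s b) = a (φ (r b)) := fun b => by
    have h1 : a₂ (β b) = ψ (s b) := congr($comm₂ b)
    have h2 : a₁ (β b) = φ (r b) := congr($comm₁ b)
    rw [← h1, ← h2, H]
  have h3 : a₁.comp β = (φ.comp (FiberProd.snd φ ψ a)).comp (FiberProd.lift s r H') := comm₁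
  have h4 : I₀ ≤ (𝔞.comap (φ.comp (FiberProd.snd φ ψ a))).comap (FiberProd.lift s r H') := by
    rw [Ideal.comap_comap, ← h3, hI₀, ← Ideal.comap_comap]
    exact Ideal.comap_mono ha₁
  -- The two maps out of `B` agree in `A'`, so they factor through the fibre product, on which the
  -- comparison is known.
  have h5 : QSym.map (h' := h) r a₁ comm₁ hI₁ ha₁ c =
      fiberSnd hI ψ a (QSym.map (h' := le_rfl) (FiberProd.lift s r H') a₁ h3 h4 ha₁ c) :=
    (map_map hβ hI₀ _ _ _ _ _ _ _ _ _ _ _ _ _ _ _ (fun _ => rfl) c).symm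
  rw [h5, comparison_fiberSnd]
  exact map_map hβ hI₀ _ _ _ _ _ _ _ _ _ _ _ _ _ _ _ (fun _ => rfl) c

lemma comparison_mem_deg (hφ : Function.Surjective φ) (hI : I = 𝔞.comap φ)
    (hψ : Function.Surjective ψ) (hI' : I' = 𝔞'.comap ψ) (a : A →+* A')
    (ha : 𝔞 ≤ 𝔞'.comap a) (hb : Function.Bijective (fiberSnd (h := h) hI ψ a)) {d : ℕ}
    {x : QSym φ I 𝔞 h} (hx : x ∈ deg φ I 𝔞 h d) :
    comparison (h' := h') hI hI' a ha hb x ∈ deg ψ I' 𝔞' h' d := by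
  obtain ⟨y, hy, rfl⟩ := exists_of_mem_deg hφ hI hx
  have hs := FiberProd.snd_surjective φ ψ a hψ
  have hy' := hy
  -- An element of `I ^ d` lifts to the `d`-th power of the preimage of `I` in the fibre product, so
  -- a homogeneous element has a homogeneous lift there.
  rw [hI, ← Ideal.map_comap_of_surjective _ hs (𝔞.comap φ), ← Ideal.map_pow] at hy'
  obtain ⟨z, hz, rfl⟩ := (Ideal.mem_map_iff_of_surjective _ hs).mp hy'
  have h1 : inr φ I 𝔞 h (reesMonomial I d _ hy) = fiberSnd hI ψ a (inr _ _ _ le_rfl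
      (reesMonomial (𝔞.comap (φ.comp (FiberProd.snd φ ψ a))) d z hz)) :=
    (map_inr_reesMonomial _ _ _ _ _ hz hy).symm
  rw [h1, comparison_fiberSnd]
  have hsurj : Function.Surjective (φ.comp (FiberProd.snd φ ψ a)) := hφ.comp hs
  exact map_mem_deg hsurj rfl _ _ _ _ _ (inr_reesMonomial_mem_deg _)

/-- Naturality of the comparison map. -/
lemma comparison_naturality (hφ : Function.Surjective φ) (hI : I = 𝔞.comap φ)
    (hψ : Function.Surjective ψ) (hI' : I' = 𝔞'.comap ψ) (a : A →+* A')
    (ha : 𝔞 ≤ 𝔞'.comap a) (hb : Function.Bijective (fiberSnd (h := h) hI ψ a))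
    {R₁ A₁ S₁ A₁' : Type u} [CommRing R₁] [CommRing A₁] [CommRing S₁] [CommRing A₁']
    {φ₁ : R₁ →+* A₁} {I₁ : Ideal R₁} {𝔞₁ : Ideal A₁} {h₁ : I₁ ≤ 𝔞₁.comap φ₁}
    {ψ₁ : S₁ →+* A₁'} {I₁' : Ideal S₁} {𝔞₁' : Ideal A₁'} {h₁' : I₁' ≤ 𝔞₁'.comap ψ₁}
    (hI₁ : I₁ = 𝔞₁.comap φ₁)
    (hI₁' : I₁' = 𝔞₁'.comap ψ₁) (a₁ : A₁ →+* A₁')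
    (ha₁ : 𝔞₁ ≤ 𝔞₁'.comap a₁) (hb₁ : Function.Bijective (fiberSnd (h := h₁) hI₁ ψ₁ a₁))
    (r : R →+* R₁) (b : A →+* A₁) (comm : b.comp φ = φ₁.comp r) (hIr : I ≤ I₁.comap r)
    (hab : 𝔞 ≤ 𝔞₁.comap b)
    (s : S →+* S₁) (b' : A' →+* A₁') (comm' : b'.comp ψ = ψ₁.comp s) (hIs : I' ≤ I₁'.comap s)
    (hab' : 𝔞' ≤ 𝔞₁'.comap b') (H : ∀ x, a₁ (b x) = b' (a x)) (x : QSym φ I 𝔞 h) :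
    comparison (h' := h₁') hI₁ hI₁' a₁ ha₁ hb₁ (QSym.map (h' := h₁) r b comm hIr hab x) =
      QSym.map (h' := h₁') s b' comm' hIs hab' (comparison (h' := h') hI hI' a ha hb x) := by
  obtain ⟨c, rfl⟩ := hb.surjective x
  have hsurj : Function.Surjective (φ.comp (FiberProd.snd φ ψ a)) :=
    hφ.comp (FiberProd.snd_surjective φ ψ a hψ)
  rw [comparison_fiberSnd]
  have e1 : b.comp (φ.comp (FiberProd.snd φ ψ a)) = φ₁.comp (r.comp (FiberProd.snd φ ψ a)) := by
    rw [← RingHom.comp_assoc, comm, RingHom.comp_assoc]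
  have e2 : (b'.comp a).comp (φ.comp (FiberProd.snd φ ψ a)) =
      ψ₁.comp (s.comp (FiberProd.fst φ ψ a)) := by
    rw [RingHom.comp_assoc, FiberProd.comm, ← RingHom.comp_assoc, comm', RingHom.comp_assoc]
  have e3 : 𝔞 ≤ 𝔞₁'.comap (b'.comp a) := by
    rw [← Ideal.comap_comap]
    exact ha.trans (Ideal.comap_mono hab')
  have e4 : 𝔞.comap (φ.comp (FiberProd.snd φ ψ a)) ≤
      I₁.comap (r.comp (FiberProd.snd φ ψ a)) := by
    rw [hI₁, Ideal.comap_comap, ← e1, ← Ideal.comap_comap (g := b)]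
    exact Ideal.comap_mono hab
  have e5 : 𝔞.comap (φ.comp (FiberProd.snd φ ψ a)) ≤
      I₁'.comap (s.comp (FiberProd.fst φ ψ a)) := by
    rw [hI₁', Ideal.comap_comap, ← e2, ← Ideal.comap_comap (g := b'.comp a)]
    exact Ideal.comap_mono e3
  have h1 : QSym.map (h := h) (h' := h₁) r b comm hIr hab (fiberSnd hI ψ a c) =
      QSym.map (h' := h₁) _ b e1 e4 hab c :=
    map_map hsurj rfl _ _ _ _ _ _ _ _ _ _ _ _ _ _ _ (fun _ => rfl) c
  have h2 : QSym.map (h' := h₁') s b' comm' hIs hab' (fiberFst (h' := h') φ a hI' ha c) =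
      QSym.map (h' := h₁') _ _ e2 e5 e3 c :=
    map_map hsurj rfl _ _ _ _ _ _ _ _ _ _ _ _ _ _ _ (fun _ => rfl) c
  rw [h1, h2]
  -- With `x` replaced by its lift `c`, both sides come from the quasi-symmetric algebra of the
  -- first fibre product, a common source in the sense of `comparison_map`.
  exact comparison_map hI₁ hI₁' a₁ ha₁ hb₁ hsurj rfl _ _ _ _ _ _ _ _ _ _ H c

end Comparison

end QSym

end QSymBlowUp

namespace QSymBlowUp

open Scheme

/-! ### Gluing in localizations -/

section Glue

/-- Were the annihilator of `x` proper, it would be disjoint from the powers of some `g t`. -/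
lemma eq_zero_of_span_eq_top {B : Type*} [CommRing B] {T : Type*} (g : T → B)
    (hspan : Ideal.span (Set.range g) = ⊤) (x : B) (h : ∀ t, ∃ n : ℕ, g t ^ n * x = 0) : x = 0 := by
  let I : Ideal B := Ideal.span {x} |>.annihilator
  have hI : ∀ b, b ∈ I ↔ b * x = 0 := fun b => Submodule.mem_annihilator_span_singleton x b
  by_contra hx
  have hne : I ≠ ⊤ := fun h1 => hx (by
    have := (hI 1).mp (h1 ▸ Submodule.mem_top)
    rwa [one_mul] at this)
  obtain ⟨_, ⟨t, rfl⟩, hr⟩ := Ideal.exists_disjoint_powers_of_span_eq_top _ hspan I hne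
  obtain ⟨n, hn⟩ := h t
  exact Set.disjoint_left.mp hr ((hI _).mpr hn) ⟨n, rfl⟩

/-- The usual gluing of sections by a partition of unity. Agreement on overlaps is phrased by
cross-multiplying numerators inside `B`, so that no ring over the overlap of two members has to be
named. -/
lemma exists_of_span_eq_top {B : Type*} [CommRing B] {T : Type*} [Finite T] (g : T → B)
    (hspan : Ideal.span (Set.range g) = ⊤) {C : T → Type*} [∀ t, CommRing (C t)]
    (u : ∀ t, B →+* C t) (hunit : ∀ t, IsUnit (u t (g t)))
    (hsurj : ∀ t c, ∃ (n : ℕ) (x : B), u t (g t) ^ n * c = u t x)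
    (c : ∀ t, C t)
    (hc : ∀ t s (n m : ℕ) (x y : B), u t (g t) ^ n * c t = u t x → u s (g s) ^ m * c s = u s y →
      ∃ N : ℕ, (g t * g s) ^ N * (g s ^ m * x) = (g t * g s) ^ N * (g t ^ n * y)) :
    ∃ b, ∀ t, u t b = c t := by
  classical
  have := Fintype.ofFinite T
  choose n x hx using fun t => hsurj t (c t)
  choose N hN using fun t s => hc t s _ _ _ _ (hx t) (hx s)
  let N' : ℕ := ∑ t, ∑ s, N t s
  have hNle : ∀ t s, N t s ≤ N' := fun t s =>
    (Finset.single_le_sum (f := fun s => N t s) (fun _ _ => Nat.zero_le _)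
      (Finset.mem_univ s)).trans
    (Finset.single_le_sum (f := fun t => ∑ s, N t s) (fun _ _ => Nat.zero_le _)
      (Finset.mem_univ t))
  let n' : ℕ := ∑ t, n t
  have hnle : ∀ t, n t ≤ n' := fun t =>
    Finset.single_le_sum (f := n) (fun _ _ => Nat.zero_le _) (Finset.mem_univ t)
  let m := n' + N'
  -- Numerators over the common denominator exponent `m = n' + N'`. The additional factor `g t ^ N'`
  -- absorbs the powers in `hN`, so that the cross-multiplied identity `hyy` holds exactly.
  let y : T → B := fun t => g t ^ N' * g t ^ (n' - n t) * x t
  have hy : ∀ t, u t (g t) ^ m * c t = u t (y t) := by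
    intro t
    simp only [y, map_mul, map_pow, ← hx]
    have h1 : m = N' + (n' - n t) + n t := by have := hnle t; omega
    rw [h1, pow_add, pow_add]
    ring
  have hyy : ∀ t s, g s ^ m * y t = g t ^ m * y s := by
    intro t s
    obtain ⟨a, ha⟩ := Nat.exists_eq_add_of_le (hNle t s)
    obtain ⟨b, hb⟩ := Nat.exists_eq_add_of_le (hnle t)
    obtain ⟨c, hc⟩ := Nat.exists_eq_add_of_le (hnle s)
    have h1 := hN t s
    simp only [y, m]
    have e1 : n' - n t = b := by omega
    have e2 : n' - n s = c := by omega
    rw [e1, e2, pow_add (g s), pow_add (g t)]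
    calc g s ^ n' * g s ^ N' * (g t ^ N' * g t ^ b * x t)
        = (g t * g s) ^ a * g t ^ b * g s ^ c * ((g t * g s) ^ N t s * (g s ^ n s * x t)) := by
          rw [ha, hc]; ring
      _ = (g t * g s) ^ a * g t ^ b * g s ^ c * ((g t * g s) ^ N t s * (g t ^ n t * x s)) := by
          rw [h1]
      _ = g t ^ n' * g t ^ N' * (g s ^ N' * g s ^ c * x s) := by
          rw [ha, hb]; ring
  -- The powers `g t ^ m` still generate the unit ideal; the coefficients of `1` form the partition
  -- of unity.
  have h1 : (1 : B) ∈ Ideal.span (Set.range fun t => g t ^ m) := by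
    have h2 := Ideal.span_pow_eq_top _ hspan m
    rw [← Set.range_comp] at h2
    exact (Ideal.eq_top_iff_one _).mp h2
  obtain ⟨e, he⟩ := Ideal.mem_span_range_iff_exists_fun.mp h1
  refine ⟨∑ t, e t * y t, fun s => ?_⟩
  have h3 : g s ^ m * ∑ t, e t * y t = y s := by
    rw [Finset.mul_sum]
    calc ∑ t, g s ^ m * (e t * y t) = ∑ t, e t * g t ^ m * y s := by
          refine Finset.sum_congr rfl fun t _ => ?_
          rw [mul_left_comm, hyy, mul_assoc]
      _ = y s := by rw [← Finset.sum_mul, he, one_mul]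
  have h4 : u s (g s) ^ m * u s (∑ t, e t * y t) = u s (g s) ^ m * c s := by
    rw [← map_pow, ← map_mul, h3, map_pow, hy]
  exact ((hunit s).pow m).mul_left_cancel h4

end Glue

/-! ### The relative quasi-symmetric algebras as sheaves on an ambient scheme. -/

namespace Ambient

variable {k : Type u} [Field k] {X Y : Scheme.{u}} {sX : X ⟶ Spec (.of k)}
  (j : Y ⟶ X) [IsClosedImmersion j]

lemma id_appLE {Z : Scheme.{u}} {U V : Z.Opens} (h : V ≤ 𝟙 Z ⁻¹ᵁ U) :
    Scheme.Hom.appLE (𝟙 Z) U V h = Z.presheaf.map (homOfLE (show V ≤ U from h)).op := by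
  rw [Scheme.Hom.appLE, Scheme.Hom.id_app]
  exact Category.id_comp _

lemma resHom_surjective (M : Ambient sX) (V : M.scheme.affineOpens) :
    Function.Surjective (M.resHom V) :=
  M.ι.app_surjective V.1 V.2

instance (M : Ambient sX) (V : M.scheme.affineOpens) : GradedRing (M.qSymDeg j V) :=
  QSym.gradedRing (M.resHom_surjective V) (M.ideal_eq_comap j V)

/-- The identity. -/
def Hom.id (M : Ambient sX) : Hom M M where
  hom := 𝟙 _
  ι_hom := Category.comp_id _
  hom_str := Category.id_comp _

lemma qSymMap_qSymMap {M N P : Ambient sX} (g : Hom M N) (g' : Hom N P) (g'' : Hom M P)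
    (hg : g.hom ≫ g'.hom = g''.hom) {V : P.scheme.affineOpens} {V' : N.scheme.affineOpens}
    {V'' : M.scheme.affineOpens} (e : V'.1 ≤ g'.hom ⁻¹ᵁ V.1) (e' : V''.1 ≤ g.hom ⁻¹ᵁ V'.1)
    (e'' : V''.1 ≤ g''.hom ⁻¹ᵁ V.1) (x : P.qSym j V) :
    qSymMap j g e' (qSymMap j g' e x) = qSymMap j g'' e'' x := by
  refine QSym.map_map (P.resHom_surjective V) (P.ideal_eq_comap j V) _ _ _ _ _ _ _ _ _ _ _ _ _ _ _
    (fun y => ?_) x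
  have h1 := Scheme.Hom.appLE_comp_appLE g.hom g'.hom V.1 V'.1 V''.1 e e'
  simp only [hg] at h1
  exact congr($h1 y)

/-- The restriction maps. -/
def qSymRes (M : Ambient sX) {V V' : M.scheme.affineOpens} (h : V' ≤ V) :
    M.qSym j V →+* M.qSym j V' :=
  qSymMap j (Hom.id M) h

lemma qSymRes_qSymRes (M : Ambient sX) {V V' V'' : M.scheme.affineOpens} (h : V' ≤ V)
    (h' : V'' ≤ V') (x : M.qSym j V) :
    M.qSymRes j h' (M.qSymRes j h x) = M.qSymRes j (h'.trans h) x :=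
  qSymMap_qSymMap j _ _ _ (Category.comp_id _) _ _ _ x

lemma qSymRes_self (M : Ambient sX) {V : M.scheme.affineOpens} (h : V ≤ V) (x : M.qSym j V) :
    M.qSymRes j h x = x := by
  refine QSym.map_id_apply (M.resHom_surjective V) (M.ideal_eq_comap j V) _ _
    (resHom_comp (Hom.id M) h) _ _ (fun y => ?_) x
  have h1 : Scheme.Hom.appLE (𝟙 M.scheme) V.1 V.1 h = 𝟙 _ := by
    exact (id_appLE h).trans (M.scheme.presheaf.map_id _)
  exact congr($h1 y)

lemma qSymRes_qSymMap {M N : Ambient sX} (g : Hom M N) {V : N.scheme.affineOpens}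
    {V' V'' : M.scheme.affineOpens} (e : V'.1 ≤ g.hom ⁻¹ᵁ V.1) (h : V'' ≤ V') (x : N.qSym j V) :
    M.qSymRes j h (qSymMap j g e x) = qSymMap j g (le_trans (show V''.1 ≤ V'.1 from h) e) x :=
  qSymMap_qSymMap j _ _ _ (Category.id_comp _) _ _ _ x

lemma qSymMap_qSymRes {M N : Ambient sX} (g : Hom M N) {V V₁ : N.scheme.affineOpens}
    {V' : M.scheme.affineOpens} (h : V₁ ≤ V) (e : V'.1 ≤ g.hom ⁻¹ᵁ V₁.1) (x : N.qSym j V) :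
    qSymMap j g e (N.qSymRes j h x) = qSymMap j g (fun _ hy => h (e hy)) x :=
  qSymMap_qSymMap j _ _ _ (Category.comp_id _) _ _ _ x

lemma qSymMap_mem_deg {M N : Ambient sX} (g : Hom M N) {V : N.scheme.affineOpens}
    {V' : M.scheme.affineOpens} (e : V'.1 ≤ g.hom ⁻¹ᵁ V.1) {d : ℕ} {x : N.qSym j V}
    (hx : x ∈ N.qSymDeg j V d) : qSymMap j g e x ∈ M.qSymDeg j V' d :=
  QSym.map_mem_deg (N.resHom_surjective V) (N.ideal_eq_comap j V) _ _ _ _ _ hx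

/-- The maps between quasi-symmetric algebras as graded maps. -/
def qSymGradedMap {M N : Ambient sX} (g : Hom M N) {V : N.scheme.affineOpens}
    {V' : M.scheme.affineOpens} (e : V'.1 ≤ g.hom ⁻¹ᵁ V.1) :
    N.qSymDeg j V →+*ᵍ M.qSymDeg j V' where
  __ := qSymMap j g e
  map_mem := qSymMap_mem_deg j g e

lemma qSymMap_qSymStr {M N : Ambient sX} (g : Hom M N) {V : N.scheme.affineOpens}
    {V' : M.scheme.affineOpens} (e : V'.1 ≤ g.hom ⁻¹ᵁ V.1) (r : Γ(X, (N.res V).1)) :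
    qSymMap j g e (N.qSymStr j V r) =
      M.qSymStr j V' (X.presheaf.map (homOfLE (res_le g e)).op r) :=
  (QSym.map_inl _ _ _ _ _ _).trans congr(QSym.inl _ _ _ _ $(symMap_algebraMap _ _ _ _ r))

lemma res_affineBasicOpen (M : Ambient sX) (V : M.scheme.affineOpens) (f : Γ(M.scheme, V.1)) :
    (M.res (M.scheme.affineBasicOpen f)).1 = X.basicOpen (M.resHom V f) :=
  Scheme.preimage_basicOpen M.ι f

/-- Quasi-coherence of the relative quasi-symmetric algebras. -/
lemma isLocalization_qSymRes (M : Ambient sX) (V : M.scheme.affineOpens)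
    (f : Γ(M.scheme, V.1)) :
    letI := (M.qSymRes j (M.scheme.affineBasicOpen_le f)).toAlgebra
    IsLocalization.Away (M.qSymStr j V (M.resHom V f))
      (M.qSym j (M.scheme.affineBasicOpen f)) := by
  have h0 : (Hom.id M).hom.appLE V.1 (M.scheme.affineBasicOpen f).1
      (M.scheme.affineBasicOpen_le f) =
      M.scheme.presheaf.map (homOfLE (M.scheme.affineBasicOpen_le f)).op := id_appLE _
  have hker : ∀ V, RingHom.ker (M.resHom V) = M.ι.ker.ideal V := fun V =>
    (Scheme.Hom.ker_apply M.ι V).symm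
  refine QSym.isLocalization_map (M.resHom_surjective V) (M.ideal_eq_comap j V)
    (M.resHom_surjective _) (M.ideal_eq_comap j _) _ _
    (resHom_comp (Hom.id M) (M.scheme.affineBasicOpen_le f)) _ _ f ?_ ?_ ?_
  · rw [h0]
    exact V.2.isLocalization_basicOpen f
  · rw [h0]
    exact ((j ≫ M.ι).ker.map_ideal_basicOpen V f).symm
  · rw [h0, hker, hker]
    exact (M.ι.ker.map_ideal_basicOpen V f).symm


lemma isUnit_qSymRes (M : Ambient sX) (V : M.scheme.affineOpens) (f : Γ(M.scheme, V.1)) :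
    IsUnit (M.qSymRes j (M.scheme.affineBasicOpen_le f) (M.qSymStr j V (M.resHom V f))) := by
  letI := (M.qSymRes j (M.scheme.affineBasicOpen_le f)).toAlgebra
  have := M.isLocalization_qSymRes j V f
  exact IsLocalization.Away.algebraMap_isUnit (S := M.qSym j (M.scheme.affineBasicOpen f))
    (M.qSymStr j V (M.resHom V f))

lemma exists_pow_mul_qSymRes_eq (M : Ambient sX) (V : M.scheme.affineOpens)
    (f : Γ(M.scheme, V.1)) (c : M.qSym j (M.scheme.affineBasicOpen f)) :
    ∃ (n : ℕ) (x : M.qSym j V),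
      M.qSymRes j (M.scheme.affineBasicOpen_le f) (M.qSymStr j V (M.resHom V f)) ^ n * c =
        M.qSymRes j (M.scheme.affineBasicOpen_le f) x := by
  letI := (M.qSymRes j (M.scheme.affineBasicOpen_le f)).toAlgebra
  have := M.isLocalization_qSymRes j V f
  obtain ⟨⟨x, ⟨_, n, rfl⟩⟩, h⟩ := IsLocalization.surj
    (Submonoid.powers (M.qSymStr j V (M.resHom V f))) c
  refine ⟨n, x, ?_⟩
  rw [mul_comm, ← map_pow]
  exact h

lemma exists_pow_mul_eq_of_qSymRes_eq (M : Ambient sX) (V : M.scheme.affineOpens)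
    (f : Γ(M.scheme, V.1)) (x y : M.qSym j V)
    (h : M.qSymRes j (M.scheme.affineBasicOpen_le f) x =
      M.qSymRes j (M.scheme.affineBasicOpen_le f) y) :
    ∃ n : ℕ, M.qSymStr j V (M.resHom V f) ^ n * x = M.qSymStr j V (M.resHom V f) ^ n * y := by
  letI := (M.qSymRes j (M.scheme.affineBasicOpen_le f)).toAlgebra
  have := M.isLocalization_qSymRes j V f
  obtain ⟨⟨_, n, rfl⟩, h⟩ := IsLocalization.exists_of_eq
    (M := Submonoid.powers (M.qSymStr j V (M.resHom V f))) h
  exact ⟨n, h⟩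

/-- `X` carries the topology induced from the ambient scheme, so the traces of the basic opens of
`V` form a base of `V ∩ X`. -/
lemma exists_basicOpen_res_le (M : Ambient sX) (V : M.scheme.affineOpens) (O : X.Opens) {p : X}
    (hp : p ∈ (M.res V).1) (hpO : p ∈ O) :
    ∃ f : Γ(M.scheme, V.1), p ∈ (M.res (M.scheme.affineBasicOpen f)).1 ∧
      (M.res (M.scheme.affineBasicOpen f)).1 ≤ O := by
  obtain ⟨O', hO', h⟩ := M.ι.isClosedEmbedding.isInducing.isOpen_iff.mp O.2
  have hO : ∀ q, M.ι q ∈ O' ↔ q ∈ O := fun q => iff_of_eq (congr(q ∈ $h))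
  obtain ⟨f, hf, hpf⟩ := V.2.exists_basicOpen_le (V := ⟨O', hO'⟩) ⟨M.ι p, (hO p).mpr hpO⟩ hp
  exact ⟨f, hpf, fun q hq => (hO q).mp (hf hq)⟩

/-- The functions `f t` need only generate the unit ideal on `V ∩ X`, not on `V`: their action on
the quasi-symmetric algebra factors through functions on `X`. -/
lemma span_qSymStr_eq_top (M : Ambient sX) (V : M.scheme.affineOpens) {T : Type*}
    (f : T → Γ(M.scheme, V.1))
    (hf : ∀ p ∈ (M.res V).1, ∃ t, p ∈ (M.res (M.scheme.affineBasicOpen (f t))).1) :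
    Ideal.span (Set.range fun t => M.qSymStr j V (M.resHom V (f t))) = ⊤ := by
  have h1 : Ideal.span (Set.range fun t => M.resHom V (f t)) = ⊤ := by
    rw [← (M.res V).2.iSup_basicOpen_eq_self_iff]
    refine le_antisymm (iSup_le fun x => X.basicOpen_le _) fun p hp => ?_
    obtain ⟨t, ht⟩ := hf p hp
    rw [res_affineBasicOpen] at ht
    exact Opens.mem_iSup.mpr ⟨⟨_, t, rfl⟩, ht⟩
  have h2 := congr(Ideal.map (M.qSymStr j V) $h1)
  rw [Ideal.map_span, Ideal.map_top, ← Set.range_comp] at h2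
  exact h2

/-- Sections of the quasi-symmetric algebra which agree locally are equal. -/
lemma qSym_ext (M : Ambient sX) {V : M.scheme.affineOpens} {x y : M.qSym j V}
    (h : ∀ p ∈ (M.res V).1, ∃ (V' : M.scheme.affineOpens) (h : V' ≤ V), p ∈ (M.res V').1 ∧
      M.qSymRes j h x = M.qSymRes j h y) : x = y := by
  have h1 : ∀ p : (M.res V).1, ∃ f : Γ(M.scheme, V.1),
      p.1 ∈ (M.res (M.scheme.affineBasicOpen f)).1 ∧
      M.qSymRes j (M.scheme.affineBasicOpen_le f) x =
        M.qSymRes j (M.scheme.affineBasicOpen_le f) y := by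
    intro p
    obtain ⟨V', hV', hp, he⟩ := h p.1 p.2
    obtain ⟨f, hf, hpf⟩ := V.2.exists_basicOpen_le (V := V'.1) ⟨M.ι p.1, hp⟩ p.2
    refine ⟨f, hpf, ?_⟩
    have h2 : M.scheme.affineBasicOpen f ≤ V' := hf
    rw [← M.qSymRes_qSymRes j hV' h2, ← M.qSymRes_qSymRes j hV' h2, he]
  choose f hf hxy using h1
  rw [← sub_eq_zero]
  refine eq_zero_of_span_eq_top _ (M.span_qSymStr_eq_top j V f fun p hp => ⟨⟨p, hp⟩, hf _⟩) _
    fun p => ?_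
  obtain ⟨n, hn⟩ := M.exists_pow_mul_eq_of_qSymRes_eq j V (f p) x y (hxy p)
  exact ⟨n, by rw [mul_sub, hn, sub_self]⟩

/-! ### Comparison maps out of a smooth ambient scheme -/

section Comparison

variable (M : Ambient sX) [Smooth M.str]

/-- Smoothness of `M` is converted here into formal smoothness of the functions on `V`. The
structure maps of `M` and `N` both restrict to that of `X`, so they agree on the smaller trace. -/
lemma fiberSnd_bijective (N : Ambient sX) {V : M.scheme.affineOpens} {V' : N.scheme.affineOpens}
    (e : N.res V' ≤ M.res V) :
    Function.Bijective (QSym.fiberSnd (h := (M.ideal_eq_comap j V).le) (M.ideal_eq_comap j V)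
      (N.resHom V') (X.presheaf.map (homOfLE e).op).hom) := by
  refine QSym.fiberSnd_bijective (M.resHom_surjective V) _ (N.resHom_surjective V') _
    (M.str.appLE ⊤ V.1 le_top).hom ?_ (N.str.appLE ⊤ V'.1 le_top).hom fun c => ?_
  · have h1 := HasRingHomProperty.appLE @Smooth M.str inferInstance ⟨⊤, isAffineOpen_top _⟩ V le_top
    exact (RingHom.smooth_def.mp h1).1
  · have h1 : ∀ (N : Ambient sX) (V : N.scheme.affineOpens), N.str.appLE ⊤ V.1 le_top ≫ N.ι.app V.1 =
        sX.appLE ⊤ (N.res V).1 le_top := by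
      intro N V
      have h3 := Hom.appLE_comp_appLE N.ι N.str ⊤ V.1 (N.res V).1 le_top le_rfl
      rw [N.ι.app_eq_appLE]
      refine h3.trans ?_
      congr 1
      exact N.ι_str
    have h2 := sX.appLE_map (U := ⊤) (V := (M.res V).1) le_top (homOfLE e).op
    rw [← h1 M V, ← h1 N V'] at h2
    exact congr($h2 c).symm

/-- The comparison map, for `V ⊆ M` and `V' ⊆ N` with `V' ∩ X ⊆ V ∩ X`. -/
def cmp {N : Ambient sX} {V : M.scheme.affineOpens} {V' : N.scheme.affineOpens}
    (e : N.res V' ≤ M.res V) : M.qSym j V →+* N.qSym j V' :=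
  QSym.comparison (h' := (N.ideal_eq_comap j V').le) (M.ideal_eq_comap j V)
    (N.ideal_eq_comap j V') _ (IdealSheafData.ideal_le_comap_ideal _ e)
    (fiberSnd_bijective j M N e)

lemma cmp_mem_deg {N : Ambient sX} {V : M.scheme.affineOpens} {V' : N.scheme.affineOpens}
    (e : N.res V' ≤ M.res V) {d : ℕ} {x : M.qSym j V} (hx : x ∈ M.qSymDeg j V d) :
    M.cmp j e x ∈ N.qSymDeg j V' d :=
  QSym.comparison_mem_deg (M.resHom_surjective V) _ (N.resHom_surjective V') _ _ _ _ hx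

lemma presheaf_map_map {U V W : X.Opens} (h : V ≤ U) (h' : W ≤ V) (x : Γ(X, U)) :
    (X.presheaf.map (homOfLE h').op).hom ((X.presheaf.map (homOfLE h).op).hom x) =
      (X.presheaf.map (homOfLE (h'.trans h)).op).hom x := by
  rw [← CommRingCat.comp_apply, ← Functor.map_comp]
  rfl

/-- If `M` and `N` both embed in `P`, the comparison carries what `P` induces on `M` to what it
induces on `N`. Once such a `P` is available, this determines the member at `N` of a compatible
family from the one at `M`. -/
lemma cmp_qSymMap {N P : Ambient sX} {V : M.scheme.affineOpens} {V' : N.scheme.affineOpens}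
    (e : N.res V' ≤ M.res V) (g : Hom M P) (g' : Hom N P) {W : P.scheme.affineOpens}
    (h : V.1 ≤ g.hom ⁻¹ᵁ W.1) (h' : V'.1 ≤ g'.hom ⁻¹ᵁ W.1) (x : P.qSym j W) :
    M.cmp j e (qSymMap j g h x) = qSymMap j g' h' x :=
  QSym.comparison_map _ _ _ _ _ (P.resHom_surjective W) (P.ideal_eq_comap j W) _ _ _ _ _ _ _ _ _ _
    (fun b => presheaf_map_map _ _ b) x

lemma qSymMap_cmp {N N' : Ambient sX} {V V₁ : M.scheme.affineOpens} {V' : N.scheme.affineOpens}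
    {V₁' : N'.scheme.affineOpens} (e : N.res V' ≤ M.res V) (e₁ : N'.res V₁' ≤ M.res V₁)
    (h : V₁ ≤ V) (g : Hom N' N) (h' : V₁'.1 ≤ g.hom ⁻¹ᵁ V'.1) (x : M.qSym j V) :
    qSymMap j g h' (M.cmp j e x) = M.cmp j e₁ (M.qSymRes j h x) :=
  (QSym.comparison_naturality (M.resHom_surjective V) _ (N.resHom_surjective V') _ _ _ _ _ _ _ _ _
    _ _ (resHom_comp (Hom.id M) h) _ _ _ _ (resHom_comp g h') _ _ (fun b => by
      refine (presheaf_map_map _ _ b).trans ?_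
      exact (presheaf_map_map _ _ b).symm) x).symm

/-- This is `cmp_qSymMap` with `M` embedded in itself by the identity on both sides. -/
lemma cmp_eq_qSymRes {V V' : M.scheme.affineOpens} (h : V' ≤ V) (e : M.res V' ≤ M.res V)
    (x : M.qSym j V) : M.cmp j e x = M.qSymRes j h x := by
  have h1 := cmp_qSymMap j M e (Hom.id M) (Hom.id M) (W := V) (le_refl V.1) h x
  have h2 : qSymMap j (Hom.id M) (le_refl V.1) x = x := M.qSymRes_self j le_rfl x
  rw [h2] at h1
  exact h1

lemma qSymRes_cmp {N : Ambient sX} {V V₁ : M.scheme.affineOpens} {V' V₁' : N.scheme.affineOpens}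
    (e : N.res V' ≤ M.res V) (e₁ : N.res V₁' ≤ M.res V₁)
    (h : V₁ ≤ V) (h' : V₁' ≤ V') (x : M.qSym j V) :
    N.qSymRes j h' (M.cmp j e x) = M.cmp j e₁ (M.qSymRes j h x) :=
  qSymMap_cmp j M e e₁ h (Hom.id N) h' x

end Comparison

end Ambient

end QSymBlowUp

namespace QSymBlowUp

open Scheme

lemma exists_affineOpens_le_inf {Z : Scheme.{u}} (U V : Z.affineOpens) {x : Z} (hU : x ∈ U.1)
    (hV : x ∈ V.1) : ∃ (W : Z.affineOpens) (_ : W ≤ U) (_ : W ≤ V), x ∈ W.1 := by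
  obtain ⟨f, g, hfg, hx⟩ := exists_basicOpen_le_affine_inter U.2 V.2 x ⟨hU, hV⟩
  exact ⟨Z.affineBasicOpen f, Z.affineBasicOpen_le f,
    hfg.le.trans (Z.affineBasicOpen_le g : Z.basicOpen g ≤ V.1), hx⟩

lemma map_decompose {A B : Type u} [CommRing A] [CommRing B] {𝒜 : ℕ → AddSubgroup A}
    {ℬ : ℕ → AddSubgroup B} [GradedRing 𝒜] [GradedRing ℬ] (ψ : 𝒜 →+*ᵍ ℬ) (x : A) (d : ℕ) :
    ψ (DirectSum.decompose 𝒜 x d) = DirectSum.decompose ℬ (ψ x) d := by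
  rw [ψ.map_directSumDecompose]

namespace Ambient

variable {k : Type u} [Field k] {X Y : Scheme.{u}} {sX : X ⟶ Spec (.of k)}
  (j : Y ⟶ X) [IsClosedImmersion j]

/-! ### Gluing sections along the comparison maps -/

/-- A family of sections over affine opens of `M`, agreeing locally on `X`. -/
def LocallyAgree (M : Ambient sX) {T : Type*} {V : T → M.scheme.affineOpens}
    (z : ∀ a, M.qSym j (V a)) : Prop :=
  ∀ a b, ∀ p ∈ (M.res (V a)).1, p ∈ (M.res (V b)).1 →
    ∃ (W : M.scheme.affineOpens) (h : W ≤ V a) (h' : W ≤ V b), p ∈ (M.res W).1 ∧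
      M.qSymRes j h (z a) = M.qSymRes j h' (z b)

variable (M : Ambient sX) [Smooth M.str] {T : Type*} {V : T → M.scheme.affineOpens}
  (z : ∀ a, M.qSym j (V a))

/-- `t` is glued from the comparison images of the sections `z a`. -/
def IsGlued {N : Ambient sX} {W : N.scheme.affineOpens} (t : N.qSym j W) : Prop :=
  ∀ (a : T) (W' : N.scheme.affineOpens) (h : W' ≤ W) (e : N.res W' ≤ M.res (V a)),
    N.qSymRes j h t = M.cmp j e (z a)

variable {M z}

lemma exists_affineOpens_res_le (N : Ambient sX) {W : N.scheme.affineOpens} (O : X.Opens) {p : X}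
    (hp : p ∈ (N.res W).1) (hpO : p ∈ O) :
    ∃ W' : N.scheme.affineOpens, W' ≤ W ∧ p ∈ (N.res W').1 ∧ (N.res W').1 ≤ O := by
  obtain ⟨f, h1, h2⟩ := N.exists_basicOpen_res_le W O hp hpO
  exact ⟨_, N.scheme.affineBasicOpen_le f, h1, h2⟩

/-- Near each point both sides are comparison images of one section, over an open of `M` on which `z
a` and `z b` coincide. -/
lemma LocallyAgree.cmp_eq (hz : LocallyAgree j M z) {N : Ambient sX} {W : N.scheme.affineOpens}
    {a b : T} (e : N.res W ≤ M.res (V a)) (e' : N.res W ≤ M.res (V b)) :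
    M.cmp j e (z a) = M.cmp j e' (z b) := by
  refine N.qSym_ext j fun p hp => ?_
  obtain ⟨W₁, h, h', hp₁, heq⟩ := hz a b p (e hp) (e' hp)
  obtain ⟨W', hW', hpW', hle⟩ := N.exists_affineOpens_res_le (M.res W₁).1 hp hp₁
  exact ⟨W', hW', hpW', by rw [qSymRes_cmp j M e hle h hW', qSymRes_cmp j M e' hle h' hW', heq]⟩

lemma IsGlued.ext {N : Ambient sX} {W : N.scheme.affineOpens} {t t' : N.qSym j W}
    (ht : IsGlued j M z t) (ht' : IsGlued j M z t')
    (hcov : ∀ p ∈ (N.res W).1, ∃ a, p ∈ (M.res (V a)).1) : t = t' := by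
  refine N.qSym_ext j fun p hp => ?_
  obtain ⟨a, ha⟩ := hcov p hp
  obtain ⟨W', hW', hpW', hle⟩ := N.exists_affineOpens_res_le (M.res (V a)).1 hp ha
  exact ⟨W', hW', hpW', by rw [ht a W' hW' hle, ht' a W' hW' hle]⟩

/-- Finitely many basic opens of `W` have traces covering that of `W`, each inside the trace of some
`V a`. The comparison images over them are glued by the partition of unity argument, for which a
cover of the trace is sufficient. -/
lemma LocallyAgree.exists_isGlued (hz : LocallyAgree j M z) (N : Ambient sX)
    (W : N.scheme.affineOpens) (hcov : ∀ p ∈ (N.res W).1, ∃ a, p ∈ (M.res (V a)).1) :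
    ∃ t : N.qSym j W, IsGlued j M z t := by
  choose a ha using fun p : (N.res W).1 => hcov p.1 p.2
  choose f hpf hf using fun p : (N.res W).1 =>
    N.exists_basicOpen_res_le W (M.res (V (a p))).1 p.2 (ha p)
  obtain ⟨s, hs⟩ := (N.res W).2.isCompact.elim_finite_subcover
    (fun p : (N.res W).1 => ((N.res (N.scheme.affineBasicOpen (f p))).1 : Set X))
    (fun p => (N.res (N.scheme.affineBasicOpen (f p))).1.2)
    (fun p hp => Set.mem_iUnion.mpr ⟨⟨p, hp⟩, hpf _⟩)
  have hs' : ∀ p ∈ (N.res W).1, ∃ t : s, p ∈ (N.res (N.scheme.affineBasicOpen (f t.1))).1 := by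
    intro p hp
    obtain ⟨t, ht, h⟩ := Set.mem_iUnion₂.mp (hs hp)
    exact ⟨⟨t, ht⟩, h⟩
  obtain ⟨b, hb⟩ := exists_of_span_eq_top (B := N.qSym j W) (T := s)
    (fun t => N.qSymStr j W (N.resHom W (f t.1))) (N.span_qSymStr_eq_top j W _ hs')
    (C := fun t => N.qSym j (N.scheme.affineBasicOpen (f t.1)))
    (fun t => N.qSymRes j (N.scheme.affineBasicOpen_le (f t.1)))
    (fun t => N.isUnit_qSymRes j W (f t.1))
    (fun t c => N.exists_pow_mul_qSymRes_eq j W (f t.1) c)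
    (fun t => M.cmp j (hf t.1) (z (a t.1))) (fun t s n m x y hx hy => by
      have h1 : N.scheme.affineBasicOpen (f t.1 * f s.1) ≤ N.scheme.affineBasicOpen (f t.1) :=
        (N.scheme.basicOpen_mul _ _).le.trans inf_le_left
      have h2 : N.scheme.affineBasicOpen (f t.1 * f s.1) ≤ N.scheme.affineBasicOpen (f s.1) :=
        (N.scheme.basicOpen_mul _ _).le.trans inf_le_right
      rw [← map_mul, ← map_mul]
      -- The overlap condition becomes an equality after inverting `f t * f s`; over that basic open
      -- both sections are comparison images, equal by `hz`.
      refine N.exists_pow_mul_eq_of_qSymRes_eq j W (f t.1 * f s.1) _ _ ?_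
      have hx' := congr(N.qSymRes j h1 $hx)
      have hy' := congr(N.qSymRes j h2 $hy)
      simp only [map_mul, map_pow, qSymRes_qSymRes] at hx' hy' ⊢
      rw [← hx', ← hy',
        qSymRes_cmp j M (hf t.1) (le_trans (fun _ h => h1 h) (hf t.1)) le_rfl h1,
        qSymRes_cmp j M (hf s.1) (le_trans (fun _ h => h2 h) (hf s.1)) le_rfl h2,
        qSymRes_self, qSymRes_self, hz.cmp_eq j _ (le_trans (fun _ h => h2 h) (hf s.1))]
      ring)
  -- The gluing condition has to be verified for arbitrary `W'` and not only for members of the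
  -- cover, hence locally on intersections of `W'` with them.
  refine ⟨b, fun c W' h e => N.qSym_ext j fun p hp => ?_⟩
  obtain ⟨t, ht⟩ := hs' p (h hp)
  obtain ⟨W'', hW'', hle, hpW''⟩ :=
    exists_affineOpens_le_inf W' (N.scheme.affineBasicOpen (f t.1)) (x := N.ι p) hp ht
  refine ⟨W'', hW'', hpW'', ?_⟩
  have h3 := congr(N.qSymRes j hle $(hb t))
  rw [qSymRes_qSymRes] at h3 ⊢
  rw [h3, qSymRes_cmp j M (hf t.1) (le_trans (fun _ h => hle h) (hf t.1)) le_rfl hle,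
    qSymRes_cmp j M e (le_trans (fun _ h => hW'' h) e) le_rfl hW'',
    qSymRes_self, qSymRes_self]
  exact hz.cmp_eq j _ _

/-- The gluing property of `t` can only be applied over opens of `N` with trace in some `V a`. Such
an open `W₂` is chosen near the point, then an open `W₃` of `N'` mapping into it, and naturality of
the comparison finishes. -/
lemma IsGlued.qSymMap {N N' : Ambient sX} (g : Hom N' N) {W : N.scheme.affineOpens}
    {W' : N'.scheme.affineOpens} (e : W'.1 ≤ g.hom ⁻¹ᵁ W.1) {t : N.qSym j W}
    (ht : IsGlued j M z t) : IsGlued j M z (qSymMap j g e t) := by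
  intro a W₁ h e₁
  refine N'.qSym_ext j fun p hp => ?_
  have hp' : p ∈ (N.res W).1 := res_le g e (h hp)
  obtain ⟨W₂, hW₂, hpW₂, hle⟩ := N.exists_affineOpens_res_le (M.res (V a)).1 hp' (e₁ hp)
  have h2 : g.hom (N'.ι p) ∈ W₂.1 := by
    rw [← Scheme.Hom.comp_apply, g.ι_hom]
    exact hpW₂
  obtain ⟨f, hf, hpf⟩ := W₁.2.exists_basicOpen_le (V := g.hom ⁻¹ᵁ W₂.1) ⟨N'.ι p, h2⟩ hp
  let W₃ := N'.scheme.affineBasicOpen f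
  have h3 : W₃ ≤ W₁ := N'.scheme.affineBasicOpen_le f
  refine ⟨W₃, h3, hpf, ?_⟩
  have h4 : W₃.1 ≤ g.hom ⁻¹ᵁ W₂.1 := hf
  have h5 : N'.res W₃ ≤ M.res (V a) := fun _ h => e₁ (h3 h)
  rw [qSymRes_qSymRes, qSymRes_qSymMap, ← qSymMap_qSymRes j g hW₂ h4, ht a W₂ hW₂ hle,
    qSymMap_cmp j M hle h5 le_rfl g h4, qSymRes_cmp j M e₁ h5 le_rfl h3]

/-- Restriction is graded, so `t` agrees locally, and therefore globally, with its component of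
degree `d`. -/
lemma mem_qSymDeg_of_locally (N : Ambient sX) {W : N.scheme.affineOpens} {d : ℕ} {t : N.qSym j W}
    (h : ∀ p ∈ (N.res W).1, ∃ (W' : N.scheme.affineOpens) (h : W' ≤ W), p ∈ (N.res W').1 ∧
      N.qSymRes j h t ∈ N.qSymDeg j W' d) : t ∈ N.qSymDeg j W d := by
  have h1 : t = DirectSum.decompose (N.qSymDeg j W) t d := by
    refine N.qSym_ext j fun p hp => ?_
    obtain ⟨W', hW', hpW', hd⟩ := h p hp
    refine ⟨W', hW', hpW', ?_⟩
    have h2 := map_decompose (𝒜 := N.qSymDeg j W) (ℬ := N.qSymDeg j W')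
      (qSymGradedMap j (Hom.id N) (V' := W') hW') t d
    refine (DirectSum.decompose_of_mem_same _ hd).symm.trans ?_
    exact h2.symm
  rw [h1]
  exact SetLike.coe_mem _

lemma IsGlued.mem_qSymDeg {N : Ambient sX} {W : N.scheme.affineOpens} {t : N.qSym j W}
    (ht : IsGlued j M z t) (hcov : ∀ p ∈ (N.res W).1, ∃ a, p ∈ (M.res (V a)).1) {d : ℕ}
    (hz : ∀ a, z a ∈ M.qSymDeg j (V a) d) : t ∈ N.qSymDeg j W d := by
  refine N.mem_qSymDeg_of_locally j fun p hp => ?_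
  obtain ⟨a, ha⟩ := hcov p hp
  obtain ⟨W', hW', hpW', hle⟩ := N.exists_affineOpens_res_le (M.res (V a)).1 hp ha
  exact ⟨W', hW', hpW', by rw [ht a W' hW' hle]; exact M.cmp_mem_deg j hle (hz a)⟩

end Ambient

end QSymBlowUp

namespace QSymBlowUp

open Scheme

namespace QSym

/-! ### Infinitesimal neighbourhoods do not change the quasi-symmetric algebra in low degrees -/

/-- Here `R'` is the quotient of `R` by an ideal contained in `K ^ (n + 1)`, where `K = ker φ`.
Since `K ≤ I` and `d - 1 ≤ n`, this ideal lies in `K * I ^ (d - 1)`, so it adds no new relation in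
degree `d`. -/
lemma eq_zero_of_map_eq_zero {R A R' A' : Type u} [CommRing R] [CommRing A] [CommRing R']
    [CommRing A'] {φ : R →+* A} {I : Ideal R} {𝔞 : Ideal A} {h : I ≤ 𝔞.comap φ}
    {φ' : R' →+* A'} {I' : Ideal R'} {𝔞' : Ideal A'} {h' : I' ≤ 𝔞'.comap φ'}
    (hφ : Function.Surjective φ) (hI₀ : I = 𝔞.comap φ)
    (hφ' : Function.Surjective φ') (hI₀' : I' = 𝔞'.comap φ')
    (r : R →+* R') (a : A →+* A') (comm : a.comp φ = φ'.comp r)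
    (hI : I ≤ I'.comap r) (ha : 𝔞 ≤ 𝔞'.comap a)
    (hr : Function.Surjective r) (hinj : Function.Injective a) (ha' : 𝔞'.comap a ≤ 𝔞) {n : ℕ}
    (hker : RingHom.ker r ≤ RingHom.ker φ ^ (n + 1)) {d : ℕ} (hd : d ≤ n + 1)
    {x : QSym φ I 𝔞 h} (hx : x ∈ deg φ I 𝔞 h d)
    (h0 : QSym.map (h' := h') r a comm hI ha x = 0) : x = 0 := by
  obtain ⟨y, hy, rfl⟩ := exists_of_mem_deg hφ hI₀ hx
  have hcomm : ∀ y, a (φ y) = φ' (r y) := fun y => congr($comm y)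
  have hy' : r y ∈ I' ^ d := by
    have h1 := Ideal.mem_map_of_mem r hy
    rw [Ideal.map_pow] at h1
    exact Ideal.pow_right_mono (Ideal.map_le_iff_le_comap.mpr hI) d h1
  rw [map_inr_reesMonomial _ _ _ _ _ hy hy', inr_reesMonomial_eq_zero_iff hφ' hI₀'] at h0
  rw [inr_reesMonomial_eq_zero_iff hφ hI₀]
  have hK : RingHom.ker φ' = (RingHom.ker φ).map r := by
    refine le_antisymm (fun z hz => ?_) (Ideal.map_le_iff_le_comap.mpr fun z hz => ?_)
    · obtain ⟨z, rfl⟩ := hr z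
      refine Ideal.mem_map_of_mem r (hinj ?_)
      rw [hcomm, map_zero]
      exact hz
    · change φ' (r z) = 0
      rw [← hcomm, show φ z = 0 from hz, map_zero]
  have hI' : I' = I.map r := by
    refine le_antisymm (fun z hz => ?_) (Ideal.map_le_iff_le_comap.mpr hI)
    obtain ⟨z, rfl⟩ := hr z
    refine Ideal.mem_map_of_mem r ?_
    rw [hI₀]
    rw [hI₀'] at hz
    refine ha' ?_
    change a (φ z) ∈ 𝔞'
    rw [hcomm]
    exact hz
  rw [hK, hI', ← Ideal.map_pow, ← Ideal.map_mul, ← Ideal.mem_comap,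
    Ideal.comap_map_of_surjective _ hr] at h0
  have hKI : RingHom.ker φ ≤ I := hI₀ ▸ fun z hz => by
    change φ z ∈ 𝔞
    rw [show φ z = 0 from hz]
    exact zero_mem _
  have h2 : RingHom.ker φ ^ (n + 1) ≤ RingHom.ker φ * I ^ (d - 1) := by
    rw [pow_succ']
    exact Ideal.mul_mono_right ((Ideal.pow_right_mono hKI n).trans
      (Ideal.pow_le_pow_right (by omega)))
  exact (sup_le le_rfl (hker.trans h2)) h0

end QSym

/-! ### Infinitesimal neighbourhoods of `X` in an ambient scheme. -/

namespace Ambient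

variable {k : Type u} [Field k] {X Y : Scheme.{u}} {sX : X ⟶ Spec (.of k)}
  (j : Y ⟶ X) [IsClosedImmersion j]

attribute [instance] Ambient.locallyOfFiniteType Ambient.quasiCompact Hom.isClosedImmersion

/-- The infinitesimal neighbourhood of order `n` of `X` in `N`. -/
def thickening (N : Ambient sX) (n : ℕ) : Ambient sX where
  scheme := (N.ι.ker ^ (n + 1)).subscheme
  str := (N.ι.ker ^ (n + 1)).subschemeι ≫ N.str
  ι := IsClosedImmersion.lift (N.ι.ker ^ (n + 1)).subschemeι N.ι (by
    rw [IdealSheafData.ker_subschemeι]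
    exact fun U => Ideal.pow_le_self n.succ_ne_zero)
  isClosedImmersion := by
    have : IsClosedImmersion (IsClosedImmersion.lift (N.ι.ker ^ (n + 1)).subschemeι N.ι (by
        rw [IdealSheafData.ker_subschemeι]
        exact fun U => Ideal.pow_le_self n.succ_ne_zero) ≫ (N.ι.ker ^ (n + 1)).subschemeι) := by
      rw [IsClosedImmersion.lift_fac]
      infer_instance
    exact IsClosedImmersion.of_comp_isClosedImmersion _ (N.ι.ker ^ (n + 1)).subschemeι
  ι_str := by rw [IsClosedImmersion.lift_fac_assoc, N.ι_str]

/-- The embedding of the infinitesimal neighbourhood. -/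
def thickeningHom (N : Ambient sX) (n : ℕ) : Hom (N.thickening n) N where
  hom := (N.ι.ker ^ (n + 1)).subschemeι
  isClosedImmersion := inferInstanceAs (IsClosedImmersion (N.ι.ker ^ (n + 1)).subschemeι)
  ι_hom :=
    have h := IsClosedImmersion.lift_fac (N.ι.ker ^ (n + 1)).subschemeι N.ι (by
      rw [IdealSheafData.ker_subschemeι]
      exact fun U => Ideal.pow_le_self n.succ_ne_zero)
    h
  hom_str := rfl

/-- A power of an ideal sheaf has the same support. Having the same points as `X`, the neighbourhood
can be glued to `M` along `X` without new points, which makes the pushout below manageable. -/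
lemma thickening_ι_surjective (N : Ambient sX) (n : ℕ) :
    Function.Surjective (N.thickening n).ι := by
  intro x
  have h1 : (N.thickeningHom n).hom x ∈ Set.range N.ι := by
    have h2 : (N.thickeningHom n).hom x ∈ (N.ι.ker ^ (n + 1)).support := by
      rw [← SetLike.mem_coe, ← IdealSheafData.range_subschemeι]
      exact ⟨x, rfl⟩
    rw [← N.ι.isClosedEmbedding.isClosed_range.closure_eq, ← Scheme.Hom.support_ker]
    exact h2
  obtain ⟨y, hy⟩ := h1
  refine ⟨y, (N.thickeningHom n).hom.isClosedEmbedding.injective ?_⟩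
  rw [← Scheme.Hom.comp_apply, (N.thickeningHom n).ι_hom, hy]

/-- The trace of an affine open on the infinitesimal neighbourhood. -/
def thickeningRes (N : Ambient sX) (n : ℕ) (V : N.scheme.affineOpens) :
    (N.thickening n).scheme.affineOpens :=
  ⟨(N.thickeningHom n).hom ⁻¹ᵁ V.1, V.2.preimage _⟩

lemma res_thickeningRes (N : Ambient sX) (n : ℕ) (V : N.scheme.affineOpens) :
    (N.thickening n).res (N.thickeningRes n V) = N.res V := by
  refine Subtype.ext ?_
  change (N.thickening n).ι ⁻¹ᵁ (N.thickeningHom n).hom ⁻¹ᵁ V.1 = N.ι ⁻¹ᵁ V.1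
  rw [← Scheme.Hom.comp_preimage, (N.thickeningHom n).ι_hom]

lemma presheaf_map_injective_of_eq {U V : X.Opens} (h : V ≤ U) (h' : U ≤ V) :
    Function.Injective (X.presheaf.map (homOfLE h).op).hom := by
  intro x y hxy
  obtain rfl := le_antisymm h h'
  have h1 : X.presheaf.map (homOfLE h).op = 𝟙 _ := X.presheaf.map_id _
  rw [h1] at hxy
  exact hxy

/-- The neighbourhood is cut out by the power `n + 1` of the ideal of `X`, to which
`QSym.eq_zero_of_map_eq_zero` applies. It allows the equality of two sections of degree `d` on `N`
to be tested on the neighbourhood. -/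
lemma eq_zero_of_qSymMap_thickeningHom (N : Ambient sX) {n : ℕ} {V : N.scheme.affineOpens} {d : ℕ}
    (hd : d ≤ n + 1) {x : N.qSym j V} (hx : x ∈ N.qSymDeg j V d)
    (h0 : qSymMap j (N.thickeningHom n) (V' := N.thickeningRes n V) le_rfl x = 0) : x = 0 := by
  have hle : N.res V ≤ (N.thickening n).res (N.thickeningRes n V) := (N.res_thickeningRes n V).ge
  have happ : (N.thickeningHom n).hom.appLE V.1 (N.thickeningRes n V).1 le_rfl =
    (N.ι.ker ^ (n + 1)).subschemeι.app V.1 := Scheme.Hom.appLE_eq_app _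
  refine QSym.eq_zero_of_map_eq_zero (N.resHom_surjective V) (N.ideal_eq_comap j V)
    (resHom_surjective _ _) (ideal_eq_comap j _ _) _ _ (resHom_comp (N.thickeningHom n) _) _ _
    ?_ (presheaf_map_injective_of_eq _ hle) ?_ ?_ hd hx h0
  · rw [happ]
    exact IdealSheafData.subschemeι_app_surjective _ V
  · intro y hy
    have h1 := IdealSheafData.ideal_le_comap_ideal j.ker hle hy
    rw [Ideal.mem_comap] at h1
    have h2 := presheaf_map_map (res_le (N.thickeningHom n) (V := V)
      (V' := N.thickeningRes n V) (le_refl _)) hle y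
    have h3 : X.presheaf.map (homOfLE (le_refl (N.res V).1)).op = 𝟙 _ := X.presheaf.map_id _
    have h4 : (X.presheaf.map (homOfLE (le_refl (N.res V).1)).op).hom y = y := by rw [h3]; rfl
    exact (h2.trans h4) ▸ h1
  · rw [happ]
    refine (IdealSheafData.ker_subschemeι_app _ V).trans_le ?_
    rw [IdealSheafData.ideal_pow, Pi.pow_apply, Scheme.Hom.ker_apply]
    exact le_rfl

end Ambient

end QSymBlowUp

namespace QSymBlowUp

open Scheme Limits

/-! ### Fibre products of rings -/

section FiberProd

namespace QSym.FiberProd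

variable {R A S A' : Type u} [CommRing R] [CommRing A] [CommRing S] [CommRing A']
  (φ : R →+* A) (ψ : S →+* A') (a : A →+* A')

lemma fst_surjective (h : Function.Surjective (a.comp φ)) :
    Function.Surjective (fst φ ψ a) := fun s => by
  obtain ⟨r, hr⟩ := h (ψ s)
  exact ⟨⟨(s, r), hr.symm⟩, rfl⟩

variable {φ ψ a}

lemma ext {x y : FiberProd φ ψ a} (h₁ : fst φ ψ a x = fst φ ψ a y)
    (h₂ : snd φ ψ a x = snd φ ψ a y) : x = y :=
  Subtype.ext (Prod.ext h₁ h₂)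

lemma comm_apply (x : FiberProd φ ψ a) : ψ (fst φ ψ a x) = a (φ (snd φ ψ a x)) := x.2

section Map

variable {R₁ A₁ S₁ A₁' : Type u} [CommRing R₁] [CommRing A₁] [CommRing S₁] [CommRing A₁']
  {φ₁ : R₁ →+* A₁} {ψ₁ : S₁ →+* A₁'} {a₁ : A₁ →+* A₁'}

/-- The map of fibre products induced by a map of diagrams. -/
def map (r : R →+* R₁) (s : S →+* S₁) (c : A' →+* A₁')
    (hr : ∀ x, c (a (φ x)) = a₁ (φ₁ (r x))) (hs : ∀ x, c (ψ x) = ψ₁ (s x)) :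
    FiberProd φ ψ a →+* FiberProd φ₁ ψ₁ a₁ :=
  lift (s.comp (fst φ ψ a)) (r.comp (snd φ ψ a)) fun b => by
    simp only [RingHom.comp_apply]
    rw [← hs, ← hr, comm_apply]

/-- Fibre products commute with localization. -/
lemma isLocalization_map (r : R →+* R₁) (s : S →+* S₁) (c : A' →+* A₁')
    (hr : ∀ x, c (a (φ x)) = a₁ (φ₁ (r x))) (hs : ∀ x, c (ψ x) = ψ₁ (s x))
    (b : FiberProd φ ψ a)
    (hR : letI := r.toAlgebra; IsLocalization.Away (snd φ ψ a b) R₁)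
    (hS : letI := s.toAlgebra; IsLocalization.Away (fst φ ψ a b) S₁)
    (hA : letI := c.toAlgebra; IsLocalization.Away (ψ (fst φ ψ a b)) A₁') :
    letI := (map (φ₁ := φ₁) (ψ₁ := ψ₁) (a₁ := a₁) r s c hr hs).toAlgebra
    IsLocalization.Away b (FiberProd φ₁ ψ₁ a₁) := by
  letI := r.toAlgebra
  letI := s.toAlgebra
  letI := c.toAlgebra
  letI := (map (φ₁ := φ₁) (ψ₁ := ψ₁) (a₁ := a₁) r s c hr hs).toAlgebra
  have h1 : ∀ x, fst φ₁ ψ₁ a₁ (algebraMap _ (FiberProd φ₁ ψ₁ a₁) x) = s (fst φ ψ a x) :=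
    fun x => rfl
  have h2 : ∀ x, snd φ₁ ψ₁ a₁ (algebraMap _ (FiberProd φ₁ ψ₁ a₁) x) = r (snd φ ψ a x) :=
    fun x => rfl
  refine ⟨?_, ?_, ?_⟩
  · rintro ⟨_, n, rfl⟩
    simp only [map_pow]
    refine IsUnit.pow _ ?_
    obtain ⟨v, hv⟩ := (IsLocalization.Away.algebraMap_isUnit (S := R₁)
      (snd φ ψ a b)).exists_right_inv
    obtain ⟨w, hw⟩ := (IsLocalization.Away.algebraMap_isUnit (S := S₁)
      (fst φ ψ a b)).exists_right_inv
    have hv' : r (snd φ ψ a b) * v = 1 := hv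
    have hw' : s (fst φ ψ a b) * w = 1 := hw
    have h3 : ψ₁ (s (fst φ ψ a b)) = a₁ (φ₁ (r (snd φ ψ a b))) := by
      rw [← hs, ← hr, comm_apply]
    have h4 : ψ₁ w = a₁ (φ₁ v) := by
      have e1 := congr(ψ₁ $hw')
      have e2 := congr(a₁ (φ₁ $hv'))
      simp only [map_mul, map_one] at e1 e2
      calc ψ₁ w = (a₁ (φ₁ (r (snd φ ψ a b))) * a₁ (φ₁ v)) * ψ₁ w := by rw [e2, one_mul]
        _ = (ψ₁ (s (fst φ ψ a b)) * ψ₁ w) * a₁ (φ₁ v) := by rw [← h3]; ring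
        _ = a₁ (φ₁ v) := by rw [e1, one_mul]
    refine IsUnit.of_mul_eq_one (⟨(w, v), h4⟩ : FiberProd φ₁ ψ₁ a₁) (ext ?_ ?_)
    · rw [map_mul, map_one]
      exact hw'
    · rw [map_mul, map_one]
      exact hv'
  · intro z
    obtain ⟨⟨x, ⟨_, n, rfl⟩⟩, hx⟩ := IsLocalization.surj
      (Submonoid.powers (snd φ ψ a b)) (snd φ₁ ψ₁ a₁ z)
    obtain ⟨⟨y, ⟨_, m, rfl⟩⟩, hy⟩ := IsLocalization.surj
      (Submonoid.powers (fst φ ψ a b)) (fst φ₁ ψ₁ a₁ z)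
    replace hx : snd φ₁ ψ₁ a₁ z * r (snd φ ψ a b ^ n) = r x := hx
    replace hy : fst φ₁ ψ₁ a₁ z * s (fst φ ψ a b ^ m) = s y := hy
    have h3 : c (ψ (fst φ ψ a b ^ n * y)) = c (a (φ (snd φ ψ a b ^ m * x))) := by
      rw [hs, hr, map_mul s, map_mul r, ← hx, ← hy]
      simp only [map_mul, map_pow]
      have h4 : ψ₁ (s (fst φ ψ a b)) = a₁ (φ₁ (r (snd φ ψ a b))) := by
        rw [← hs, ← hr, comm_apply]
      rw [comm_apply, h4]
      ring
    -- Numerators chosen separately in `S` and `R` need to agree only after passing to `A₁'`. A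
    -- further power `p` of `b` makes them agree in `A'`, so that they define an element of the
    -- fibre product.
    obtain ⟨⟨_, p, rfl⟩, hp⟩ := IsLocalization.exists_of_eq
      (M := Submonoid.powers (ψ (fst φ ψ a b))) h3
    refine ⟨(⟨(fst φ ψ a b ^ (p + n) * y, snd φ ψ a b ^ (p + m) * x), ?_⟩,
      ⟨_, p + n + m, rfl⟩), ext ?_ ?_⟩
    · change ψ (fst φ ψ a b ^ (p + n) * y) = a (φ (snd φ ψ a b ^ (p + m) * x))
      simp only [map_mul, map_pow, pow_add, ← comm_apply] at hp ⊢
      rw [mul_assoc, hp, mul_assoc]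
    · rw [map_mul, map_pow, map_pow, h1, h1]
      change _ = s (fst φ ψ a b ^ (p + n) * y)
      rw [map_mul, ← hy]
      simp only [map_pow]
      ring
    · rw [map_mul, map_pow, map_pow, h2, h2]
      change _ = r (snd φ ψ a b ^ (p + m) * x)
      rw [map_mul, ← hx]
      simp only [map_pow]
      ring
  · intro x y hxy
    have e1 : s (fst φ ψ a x) = s (fst φ ψ a y) := congr(fst φ₁ ψ₁ a₁ $hxy)
    have e2 : r (snd φ ψ a x) = r (snd φ ψ a y) := congr(snd φ₁ ψ₁ a₁ $hxy)
    obtain ⟨⟨_, p, rfl⟩, hp⟩ := IsLocalization.exists_of_eq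
      (M := Submonoid.powers (fst φ ψ a b)) e1
    obtain ⟨⟨_, q, rfl⟩, hq⟩ := IsLocalization.exists_of_eq
      (M := Submonoid.powers (snd φ ψ a b)) e2
    refine ⟨⟨_, p + q, rfl⟩, ext ?_ ?_⟩
    · simp only [map_mul, map_pow, pow_add] at hp ⊢
      rw [mul_comm (_ ^ p), mul_assoc, hp, mul_assoc]
    · simp only [map_mul, map_pow, pow_add] at hq ⊢
      rw [mul_assoc, hq, mul_assoc]

end Map

/-- A fibre product of algebras of finite type along surjective maps is of finite type. -/
lemma finiteType {k : Type u} [CommRing k] [IsNoetherianRing k] (κR : k →+* R) (κS : k →+* S)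
    (H : ∀ x, ψ (κS x) = a (φ (κR x))) (hκR : κR.FiniteType) (hκS : κS.FiniteType)
    (hψ : Function.Surjective ψ) (hφ : Function.Surjective (a.comp φ)) :
    (lift κS κR H).FiniteType := by
  letI : Algebra k R := κR.toAlgebra
  letI : Algebra k S := κS.toAlgebra
  letI : Algebra k (FiberProd φ ψ a) := (lift κS κR H).toAlgebra
  haveI : IsScalarTower k (FiberProd φ ψ a) (S × R) := IsScalarTower.of_algebraMap_eq fun _ => rfl
  haveI : Algebra.FiniteType k R := hκR
  haveI : Algebra.FiniteType k S := hκS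
  have h1 : (⊤ : Subalgebra k (S × R)).FG :=
    (inferInstance : Algebra.FiniteType k (S × R)).out
  -- Both projections are onto, so `S × R` is generated as a module by its two idempotents. The
  -- Artin–Tate lemma, `fg_of_fg_of_fg`, then transfers finite type from `S × R` to the fibre
  -- product.
  have h2 : (⊤ : Submodule (FiberProd φ ψ a) (S × R)).FG := by
    refine Submodule.fg_def.mpr ⟨{((1, 0) : S × R), (0, 1)}, Set.toFinite _, ?_⟩
    rw [eq_top_iff]
    rintro ⟨s, r⟩ -
    obtain ⟨x, rfl⟩ := fst_surjective φ ψ a hφ s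
    obtain ⟨y, rfl⟩ := snd_surjective φ ψ a hψ r
    have h3 : (fst φ ψ a x, snd φ ψ a y) = x • ((1, 0) : S × R) + y • ((0, 1) : S × R) := by
      refine Prod.ext ?_ ?_
      · change _ = fst φ ψ a x * 1 + fst φ ψ a y * 0
        simp
      · change _ = snd φ ψ a x * 0 + snd φ ψ a y * 1
        simp
    rw [h3]
    exact add_mem (Submodule.smul_mem _ _ (Submodule.subset_span (by simp)))
      (Submodule.smul_mem _ _ (Submodule.subset_span (by simp)))
  exact ⟨fg_of_fg_of_fg k (FiberProd φ ψ a) (S × R) h1 h2 Subtype.val_injective⟩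

end QSym.FiberProd

end FiberProd

/-! ### Gluing morphisms of schemes -/

section GlueMorphisms

/-- The condition on ranges makes the commutative squares Cartesian, and closed immersions are local
on the target. -/
lemma isClosedImmersion_of_openCover {Z P : Scheme.{u}} (g : Z ⟶ P) (𝒰 : P.OpenCover)
    {W : 𝒰.I₀ → Scheme.{u}} (f : ∀ i, W i ⟶ Z) [∀ i, IsOpenImmersion (f i)]
    (t : ∀ i, W i ⟶ 𝒰.X i) (ht : ∀ i, IsClosedImmersion (t i)) (w : ∀ i, f i ≫ g = t i ≫ 𝒰.f i)
    (hrange : ∀ i, g ⁻¹ᵁ (𝒰.f i).opensRange ≤ (f i).opensRange) : IsClosedImmersion g := by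
  refine (IsZariskiLocalAtTarget.iff_of_openCover (P := @IsClosedImmersion) 𝒰).mpr fun i => ?_
  have h : IsPullback (t i) (f i) (𝒰.f i) g := by
    refine IsOpenImmersion.isPullback _ _ _ _ (w i) (le_antisymm (hrange i) ?_)
    rintro _ ⟨y, rfl⟩
    refine ⟨t i y, ?_⟩
    rw [← Scheme.Hom.comp_apply, ← w i, Scheme.Hom.comp_apply]
  refine (MorphismProperty.cancel_left_of_respectsIso @IsClosedImmersion
    h.flip.isoPullback.hom _).mp ?_
  have h2 : h.flip.isoPullback.hom ≫ Scheme.Cover.pullbackHom 𝒰 g i = _ :=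
      h.flip.isoPullback_hom_snd
  exact h2.symm ▸ ht i

/-- The open cover by the spectra of affine opens. -/
def affineOpensCover {Z : Scheme.{u}} {J : Type u} (U : J → Z.affineOpens)
    (hU : ∀ z : Z, ∃ i, z ∈ (U i).1) : Z.OpenCover where
  I₀ := J
  X i := Spec Γ(Z, (U i).1)
  f i := (U i).2.fromSpec
  mem₀ := by
    rw [presieve₀_mem_precoverage_iff]
    refine ⟨fun z => ?_, fun i => (U i).2.isOpenImmersion_fromSpec⟩
    obtain ⟨i, hi⟩ := hU z
    rw [← SetLike.mem_coe, ← (U i).2.range_fromSpec] at hi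
    exact ⟨i, hi⟩

/-- Morphisms given on the members of a directed family of open immersions glue. -/
lemma exists_glue_of_isOpenImmersion {Z P : Scheme.{u}} {J : Type u} {W : J → Scheme.{u}}
    (f : ∀ i, W i ⟶ Z) [hf : ∀ i, IsOpenImmersion (f i)]
    (hcov : ∀ z : Z, ∃ i, z ∈ Set.range (f i)) (r : J → J → Prop)
    (p : ∀ i j, r i j → (W i ⟶ W j)) (hp : ∀ i j (h : r i j), p i j h ≫ f j = f i)
    (hdir : ∀ i j, ∀ z ∈ Set.range (f i), z ∈ Set.range (f j) →
      ∃ l, r l i ∧ r l j ∧ z ∈ Set.range (f l))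
    (g : ∀ i, W i ⟶ P) (hg : ∀ i j (h : r i j), p i j h ≫ g j = g i) :
    ∃ F : Z ⟶ P, ∀ i, f i ≫ F = g i := by
  let 𝒰 : Z.OpenCover :=
    { I₀ := J
      X := W
      f := f
      mem₀ := by
        rw [presieve₀_mem_precoverage_iff]
        exact ⟨fun z => hcov z, hf⟩ }
  have key : ∀ i j, pullback.fst (f i) (f j) ≫ g i = pullback.snd (f i) (f j) ≫ g j := by
    intro i j
    -- Directedness covers the fibre product of `W i` and `W j` by the members `W l` with `l`
    -- related to both; on each of these the two maps to `P` restrict to `g l`.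
    let S := Σ l : J, PLift (r l i ∧ r l j)
    let e : ∀ s : S, W s.1 ⟶ pullback (f i) (f j) := fun s =>
      pullback.lift (p s.1 i s.2.down.1) (p s.1 j s.2.down.2) (by
        rw [hp _ _ s.2.down.1, hp _ _ s.2.down.2])
    have he : ∀ s, e s ≫ pullback.fst _ _ ≫ f i = f s.1 := fun s => by
      rw [pullback.lift_fst_assoc, hp _ _ s.2.down.1]
    have hopen : ∀ s, IsOpenImmersion (e s) := fun s => by
      have : IsOpenImmersion (e s ≫ pullback.fst _ _ ≫ f i) := by
        rw [he]; infer_instance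
      exact IsOpenImmersion.of_comp (e s) (pullback.fst _ _ ≫ f i)
    let 𝒱 : (pullback (f i) (f j)).OpenCover :=
      { I₀ := S
        X := fun s => W s.1
        f := e
        mem₀ := by
          rw [presieve₀_mem_precoverage_iff]
          refine ⟨fun x => ?_, hopen⟩
          have h1 : (pullback.fst (f i) (f j) ≫ f i) x ∈ Set.range (f i) := by
            rw [Scheme.Hom.comp_apply]
            exact ⟨_, rfl⟩
          have h2 : (pullback.fst (f i) (f j) ≫ f i) x ∈ Set.range (f j) := by
            rw [pullback.condition, Scheme.Hom.comp_apply]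
            exact ⟨_, rfl⟩
          obtain ⟨l, hli, hlj, y, hy⟩ := hdir i j _ h1 h2
          refine ⟨⟨l, ⟨hli, hlj⟩⟩, y, ?_⟩
          refine (pullback.fst (f i) (f j) ≫ f i).isOpenEmbedding.injective ?_
          rw [← hy, ← he ⟨l, ⟨hli, hlj⟩⟩]
          rfl }
    refine 𝒱.hom_ext _ _ fun s => ?_
    change e s ≫ pullback.fst _ _ ≫ g i = e s ≫ pullback.snd _ _ ≫ g j
    rw [pullback.lift_fst_assoc, pullback.lift_snd_assoc, hg _ _ s.2.down.1, hg _ _ s.2.down.2]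
  exact ⟨𝒰.glueMorphisms g key, 𝒰.ι_glueMorphisms g key⟩

lemma exists_glue {Z P : Scheme.{u}} {J : Type u} (U : J → Z.affineOpens)
    (hU : ∀ z : Z, ∃ i, z ∈ (U i).1) (r : J → J → Prop) (hr : ∀ i j, r i j → U i ≤ U j)
    (hdir : ∀ i j, ∀ z ∈ (U i).1, z ∈ (U j).1 → ∃ l, r l i ∧ r l j ∧ z ∈ (U l).1)
    (g : ∀ i, Spec Γ(Z, (U i).1) ⟶ P)
    (hg : ∀ i j (h : r i j), Spec.map (Z.presheaf.map (homOfLE (hr i j h)).op) ≫ g j = g i) :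
    ∃ f : Z ⟶ P, ∀ i, (U i).2.fromSpec ≫ f = g i := by
  have hrange : ∀ i (z : Z), z ∈ Set.range (U i).2.fromSpec ↔ z ∈ (U i).1 := fun i z => by
    rw [(U i).2.range_fromSpec, SetLike.mem_coe]
  refine exists_glue_of_isOpenImmersion (hf := fun i => (U i).2.isOpenImmersion_fromSpec) _
    (fun z => (hU z).imp fun i => (hrange i z).mpr) r
    (fun i j h => Spec.map (Z.presheaf.map (homOfLE (hr i j h)).op))
    (fun i j h => (U j).2.map_fromSpec (U i).2 _) (fun i j z hi hj => ?_) g hg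
  obtain ⟨l, hli, hlj, hl⟩ := hdir i j z ((hrange i z).mp hi) ((hrange j z).mp hj)
  exact ⟨l, hli, hlj, (hrange l z).mpr hl⟩

end GlueMorphisms

end QSymBlowUp

namespace QSymBlowUp

open Scheme Limits QSym

namespace Ambient

variable {k : Type u} [Field k] {X Y : Scheme.{u}} {sX : X ⟶ Spec (.of k)}

/-! ### Pushouts of closed embeddings -/

lemma resHom_map (M : Ambient sX) {V V' : M.scheme.affineOpens} (h : V' ≤ V)
    (e : (M.res V').1 ≤ (M.res V).1) (x : Γ(M.scheme, V.1)) :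
    M.resHom V' ((M.scheme.presheaf.map (homOfLE (show V'.1 ≤ V.1 from h)).op).hom x) =
      (X.presheaf.map (homOfLE e).op).hom (M.resHom V x) :=
  congr($(M.ι.naturality (homOfLE (show V'.1 ≤ V.1 from h)).op) x)

/-- An affine open of `M` and one of `N` with the same trace on `X`. -/
structure Chart (M N : Ambient sX) where
  /-- The open of `M`. -/
  fst : M.scheme.affineOpens
  /-- The open of `N`. -/
  snd : N.scheme.affineOpens
  le : N.res snd ≤ M.res fst
  ge : M.res fst ≤ N.res snd

variable {M N : Ambient sX}

/-- The first open of a chart, as an element of the small affine Zariski site. -/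
def Chart.site (c : Chart M N) : M.scheme.AffineZariskiSite := ⟨c.fst.1, c.fst.2⟩

/-- The first open is required to be a basic open of the larger one, so that restriction becomes a
localization. Inclusion suffices for the second: when `X → N` is onto, opens of `N` are determined
by their traces. -/
instance : Preorder (Chart M N) where
  le c d := c.site ≤ d.site ∧ c.snd ≤ d.snd
  le_refl c := ⟨le_rfl, le_rfl⟩
  le_trans _ _ _ h h' := ⟨h.1.trans h'.1, h.2.trans h'.2⟩

namespace Chart

lemma fst_le {c d : Chart M N} (h : c ≤ d) : c.fst ≤ d.fst :=
  AffineZariskiSite.toOpens_mono h.1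

lemma snd_le {c d : Chart M N} (h : c ≤ d) : c.snd ≤ d.snd := h.2

lemma res_snd_le {c d : Chart M N} (h : c ≤ d) : (N.res c.snd).1 ≤ (N.res d.snd).1 :=
  fun _ hx => h.2 hx

/-- The restriction to the trace on `X`. -/
abbrev trace (c : Chart M N) : Γ(X, (M.res c.fst).1) →+* Γ(X, (N.res c.snd).1) :=
  (X.presheaf.map (homOfLE c.le).op).hom

/-- The ring of functions on the pushout over a chart. -/
abbrev ring (c : Chart M N) : Type u := FiberProd (M.resHom c.fst) (N.resHom c.snd) c.trace

lemma trace_surjective (c : Chart M N) : Function.Surjective c.trace := by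
  intro y
  refine ⟨(X.presheaf.map (homOfLE c.ge).op).hom y, (presheaf_map_map c.ge c.le y).trans ?_⟩
  exact congr($(X.presheaf.map_id _) y)

lemma comp_surjective (c : Chart M N) : Function.Surjective (c.trace.comp (M.resHom c.fst)) :=
  c.trace_surjective.comp (M.resHom_surjective _)

/-- The restriction maps. -/
def map {c d : Chart M N} (h : c ≤ d) : d.ring →+* c.ring :=
  FiberProd.map (M.scheme.presheaf.map (homOfLE (show c.fst.1 ≤ d.fst.1 from fst_le h)).op).hom
    (N.scheme.presheaf.map (homOfLE (show c.snd.1 ≤ d.snd.1 from snd_le h)).op).hom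
    (X.presheaf.map (homOfLE (res_snd_le h)).op).hom
    (fun x => by
      refine (presheaf_map_map _ _ _).trans (Eq.trans ?_ congr(c.trace
        $(M.resHom_map (fst_le h) (fun _ hx => fst_le h hx) x)).symm)
      exact (presheaf_map_map _ _ _).symm)
    (fun x => (N.resHom_map (snd_le h) (res_snd_le h) x).symm)

/-- The spectra of the rings of functions on the charts. -/
def functor (M N : Ambient sX) : Chart M N ⥤ Scheme.{u} where
  obj c := Spec (.of c.ring)
  map h := Spec.map (CommRingCat.ofHom (map h.le))
  map_id c := by
    have h : map (le_refl c) = RingHom.id _ := by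
      refine RingHom.ext fun x => FiberProd.ext ?_ ?_
      · change (N.scheme.presheaf.map (𝟙 _)).hom _ = _
        rw [N.scheme.presheaf.map_id]
        rfl
      · change (M.scheme.presheaf.map (𝟙 _)).hom _ = _
        rw [M.scheme.presheaf.map_id]
        rfl
    change Spec.map (CommRingCat.ofHom (map (le_refl c))) = _
    rw [h]
    exact Spec.map_id _
  map_comp {c d e} h h' := by
    have h1 : map (h.le.trans h'.le) = (map h.le).comp (map h'.le) := by
      refine RingHom.ext fun x => FiberProd.ext ?_ ?_
      · exact (presheaf_map_map _ _ _).symm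
      · exact (presheaf_map_map _ _ _).symm
    change Spec.map (CommRingCat.ofHom (map (h.le.trans h'.le))) = _
    rw [h1, ← Spec.map_comp]
    rfl

lemma snd_le_of_fst_le [Surjective N.ι] {c : Chart M N} {U : M.scheme.affineOpens}
    {T : N.scheme.affineOpens} (h : c.fst ≤ U) (h' : M.res U ≤ N.res T) : c.snd ≤ T := by
  intro y hy
  obtain ⟨x, rfl⟩ := N.ι.surjective y
  exact h' (h (c.le hy))

/-- A function cutting out the smaller open of `M` lifts to `b` in the fibre product. As `X → N` is
onto, equality of traces forces the smaller open of `N` to be the basic open of the other component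
of `b`, and fibre products commute with localization. -/
lemma isLocalization_map [Surjective N.ι] {c d : Chart M N} (h : c ≤ d) :
    ∃ b : d.ring, letI := (map h).toAlgebra; IsLocalization.Away b c.ring := by
  obtain ⟨⟨f, hf : M.scheme.basicOpen f = c.fst.1⟩, -⟩ := id h
  obtain ⟨b, rfl⟩ := FiberProd.snd_surjective (M.resHom d.fst) (N.resHom d.snd) d.trace
    (N.resHom_surjective _) f
  have h0 : M.ι ⁻¹ᵁ c.fst.1 = X.basicOpen (M.resHom d.fst
      (FiberProd.snd (M.resHom d.fst) (N.resHom d.snd) d.trace b)) :=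
    (congr(M.ι ⁻¹ᵁ $hf)).symm.trans (Scheme.preimage_basicOpen M.ι _)
  have h1 : (N.res c.snd).1 =
      X.basicOpen (N.resHom d.snd (FiberProd.fst (M.resHom d.fst) (N.resHom d.snd) d.trace b)) := by
    rw [FiberProd.comm_apply]
    refine le_antisymm (fun x hx => ?_) (fun x hx => ?_)
    · refine (Scheme.basicOpen_res _ _ _).ge ⟨res_snd_le h hx, ?_⟩
      exact h0.le (c.le hx)
    · exact c.ge (h0.ge ((Scheme.basicOpen_res _ _ _).le hx).2)
  have h2 : c.snd.1 = N.scheme.basicOpen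
      (FiberProd.fst (M.resHom d.fst) (N.resHom d.snd) d.trace b) := by
    have h3 : ∀ x, N.ι x ∈ c.snd.1 ↔ N.ι x ∈ N.scheme.basicOpen
        (FiberProd.fst (M.resHom d.fst) (N.resHom d.snd) d.trace b) := by
      intro x
      rw [← Scheme.Hom.mem_preimage, ← Scheme.Hom.mem_preimage, Scheme.preimage_basicOpen]
      exact iff_of_eq congr(x ∈ $h1)
    ext y
    obtain ⟨x, rfl⟩ := N.ι.surjective y
    exact h3 x
  refine ⟨b, FiberProd.isLocalization_map _ _ _ _ _ b ?_ ?_ ?_⟩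
  · exact d.fst.2.isLocalization_of_eq_basicOpen _ _ hf.symm
  · exact d.snd.2.isLocalization_of_eq_basicOpen _ _ h2
  · exact (N.res d.snd).2.isLocalization_of_eq_basicOpen _ _ h1

instance isOpenImmersion_functor_map [Surjective N.ι] {c d : Chart M N} (h : c ⟶ d) :
    IsOpenImmersion ((functor M N).map h) := by
  obtain ⟨b, hb⟩ := isLocalization_map h.le
  letI := (map h.le).toAlgebra
  exact IsOpenImmersion.of_isLocalization (S := c.ring) b

/-- Basic opens of charts are charts. -/
lemma exists_le (c : Chart M N) (f : Γ(M.scheme, c.fst.1)) :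
    ∃ d : Chart M N, d ≤ c ∧ d.fst.1 = M.scheme.basicOpen f := by
  obtain ⟨b, rfl⟩ := FiberProd.snd_surjective (M.resHom c.fst) (N.resHom c.snd) c.trace
    (N.resHom_surjective _) f
  have h1 : N.ι ⁻¹ᵁ N.scheme.basicOpen
      (FiberProd.fst (M.resHom c.fst) (N.resHom c.snd) c.trace b) =
      (N.res c.snd).1 ⊓ M.ι ⁻¹ᵁ M.scheme.basicOpen
        (FiberProd.snd (M.resHom c.fst) (N.resHom c.snd) c.trace b) := by
    rw [Scheme.preimage_basicOpen, Scheme.preimage_basicOpen]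
    refine Eq.trans ?_ (Scheme.basicOpen_res _ _ (homOfLE c.le).op)
    exact congr(X.basicOpen $(FiberProd.comm_apply b))
  refine ⟨⟨M.scheme.affineBasicOpen (FiberProd.snd (M.resHom c.fst) (N.resHom c.snd) c.trace b),
    N.scheme.affineBasicOpen (FiberProd.fst (M.resHom c.fst) (N.resHom c.snd) c.trace b), ?_, ?_⟩,
    ⟨⟨_, rfl⟩, N.scheme.affineBasicOpen_le _⟩, rfl⟩
  · intro x hx
    exact (h1.le hx).2
  · intro x hx
    exact h1.ge ⟨c.ge (M.scheme.affineBasicOpen_le _ hx), hx⟩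

/-- The map from an open of `M` to the corresponding open of the pushout. -/
def fstι (c : Chart M N) : Spec Γ(M.scheme, c.fst.1) ⟶ (functor M N).obj c :=
  Spec.map (CommRingCat.ofHom (FiberProd.snd (M.resHom c.fst) (N.resHom c.snd) c.trace))

/-- The map from an open of `N` to the corresponding open of the pushout. -/
def sndι (c : Chart M N) : Spec Γ(N.scheme, c.snd.1) ⟶ (functor M N).obj c :=
  Spec.map (CommRingCat.ofHom (FiberProd.fst (M.resHom c.fst) (N.resHom c.snd) c.trace))

lemma isClosedImmersion_fstι (c : Chart M N) : IsClosedImmersion (fstι c) :=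
  IsClosedImmersion.spec_of_surjective _ (FiberProd.snd_surjective _ _ _ (N.resHom_surjective _))

lemma isClosedImmersion_sndι (c : Chart M N) : IsClosedImmersion (sndι c) :=
  IsClosedImmersion.spec_of_surjective _ (FiberProd.fst_surjective _ _ _ c.comp_surjective)

lemma fstι_naturality {c d : Chart M N} (h : c ≤ d) :
    Spec.map (M.scheme.presheaf.map (homOfLE (show c.fst.1 ≤ d.fst.1 from fst_le h)).op) ≫ fstι d =
      fstι c ≫ (functor M N).map (homOfLE h) := by
  refine (Spec.map_comp _ _).symm.trans (Eq.trans ?_ (Spec.map_comp _ _))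
  rfl

lemma sndι_naturality {c d : Chart M N} (h : c ≤ d) :
    Spec.map (N.scheme.presheaf.map (homOfLE (show c.snd.1 ≤ d.snd.1 from snd_le h)).op) ≫ sndι d =
      sndι c ≫ (functor M N).map (homOfLE h) := by
  refine (Spec.map_comp _ _).symm.trans (Eq.trans ?_ (Spec.map_comp _ _))
  rfl

lemma appLE_fstι (c : Chart M N) :
    Spec.map (M.ι.appLE c.fst.1 (N.res c.snd).1 c.le) ≫ fstι c =
      Spec.map (N.ι.app c.snd.1) ≫ sndι c := by
  refine (Spec.map_comp _ _).symm.trans (Eq.trans ?_ (Spec.map_comp _ _))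
  refine congr(Spec.map $(?_))
  ext x
  exact (FiberProd.comm_apply x).symm

/-- The kernel of the projection to functions on `M` consists of pairs `(s, 0)` with `s` vanishing
on `X`. Because `X → N` is onto, `s` has empty basic open and is nilpotent, so every prime contains
the kernel. -/
lemma fstι_surjective [Surjective N.ι] (c : Chart M N) : Function.Surjective (fstι c) := by
  have h := range_comap_of_surjective _
    (FiberProd.snd (M.resHom c.fst) (N.resHom c.snd) c.trace)
    (FiberProd.snd_surjective _ _ _ (N.resHom_surjective _))
  refine Set.range_eq_univ.mp (h.trans ?_)
  refine Set.eq_univ_of_forall fun p x hx => ?_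
  obtain ⟨⟨s, r⟩, hsr⟩ := x
  obtain rfl : r = 0 := hx
  have h1 : N.resHom c.snd s = 0 := by
    have : N.resHom c.snd s = c.trace (M.resHom c.fst 0) := hsr
    rw [this, map_zero, map_zero]
  have h2 : N.scheme.basicOpen s = ⊥ := by
    refine eq_bot_iff.mpr fun y hy => ?_
    obtain ⟨q, rfl⟩ := N.ι.surjective y
    have h3 := (Scheme.preimage_basicOpen N.ι s).le hy
    have h4 : X.basicOpen (N.resHom c.snd s) = ⊥ := by
      rw [h1]; exact Scheme.basicOpen_zero _ _
    exact h4.le h3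
  obtain ⟨n, hn⟩ := (isNilpotent_iff_basicOpen_eq_bot_of_isCompact c.snd.2.isCompact s).mpr h2
  refine p.2.mem_of_pow_mem (n + 1) ?_
  convert zero_mem p.asIdeal
  refine FiberProd.ext ?_ ?_
  · rw [map_pow, pow_succ]
    change s ^ n * s = 0
    rw [hn, zero_mul]
  · rw [map_pow]
    exact zero_pow (by omega)

/-- Charts are directed at every point. -/
lemma exists_le_le [Surjective N.ι] (c d : Chart M N) {m : M.scheme} (hc : m ∈ c.fst.1)
    (hd : m ∈ d.fst.1) : ∃ l : Chart M N, l ≤ c ∧ l ≤ d ∧ m ∈ l.fst.1 := by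
  obtain ⟨f, g, hfg, hm⟩ := exists_basicOpen_le_affine_inter c.fst.2 d.fst.2 m ⟨hc, hd⟩
  obtain ⟨l, hl, hlf⟩ := exists_le c f
  have h : l.fst ≤ d.fst := (hlf.trans hfg).le.trans (M.scheme.basicOpen_le g)
  exact ⟨l, hl, ⟨⟨g, (hlf.trans hfg).symm⟩, snd_le_of_fst_le h d.ge⟩, hlf.ge hm⟩

lemma exists_mem_fst (M N : Ambient sX) (m : M.scheme) : ∃ c : Chart M N, m ∈ c.fst.1 := by
  by_cases hm : m ∈ Set.range M.ι
  · obtain ⟨p, rfl⟩ := hm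
    obtain ⟨V, hV, hpV, -⟩ := exists_isAffineOpen_mem_and_subset (x := M.ι p) (U := ⊤) trivial
    obtain ⟨T, hT, hpT, -⟩ := exists_isAffineOpen_mem_and_subset (x := N.ι p) (U := ⊤) trivial
    obtain ⟨f, g, hfg, hp⟩ := exists_basicOpen_le_affine_inter (M.res ⟨V, hV⟩).2 (N.res ⟨T, hT⟩).2
      p ⟨hpV, hpT⟩
    obtain ⟨f, rfl⟩ := M.resHom_surjective ⟨V, hV⟩ f
    obtain ⟨g, rfl⟩ := N.resHom_surjective ⟨T, hT⟩ g
    have hf : M.ι ⁻¹ᵁ M.scheme.basicOpen f = _ := Scheme.preimage_basicOpen M.ι f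
    have hg : N.ι ⁻¹ᵁ N.scheme.basicOpen g = _ := Scheme.preimage_basicOpen N.ι g
    have h := hf.trans (hfg.trans hg.symm)
    exact ⟨⟨⟨_, hV.basicOpen f⟩, ⟨_, hT.basicOpen g⟩, h.ge, h.le⟩, hf.ge hp⟩
  -- Away from `X` an affine open of `M` missing `X` is paired with the empty open of `N`, both
  -- having empty trace.
  · obtain ⟨V, hV, hmV, hle⟩ := exists_isAffineOpen_mem_and_subset (x := m)
      (U := ⟨(Set.range M.ι)ᶜ, M.ι.isClosedEmbedding.isClosed_range.isOpen_compl⟩) hm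
    exact ⟨⟨⟨V, hV⟩, ⟨⊥, isAffineOpen_bot _⟩, fun x hx => hx.elim, fun x hx => hle hx ⟨x, rfl⟩⟩, hmV⟩

lemma mem_snd (c : Chart M N) {p : X} : N.ι p ∈ c.snd.1 ↔ M.ι p ∈ c.fst.1 :=
  ⟨fun h => c.le h, fun h => c.ge h⟩

lemma exists_mem_snd [Surjective N.ι] (n : N.scheme) : ∃ c : Chart M N, n ∈ c.snd.1 := by
  obtain ⟨p, rfl⟩ := N.ι.surjective n
  obtain ⟨c, hc⟩ := exists_mem_fst M N (M.ι p)
  exact ⟨c, c.mem_snd.mpr hc⟩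

lemma exists_fromSpec_eq {Z : Scheme.{u}} (U : Z.affineOpens) {z : Z} (hz : z ∈ U.1) :
    ∃ y, U.2.fromSpec y = z := by
  rwa [← SetLike.mem_coe, ← U.2.range_fromSpec] at hz

/-- Through the bijections `fstι` the points of the charts are points of `M`, so local directedness
reduces to `exists_le_le`. It is what allows the colimit to be formed by gluing. -/
instance [Surjective N.ι] : (functor M N ⋙ Scheme.forget).IsLocallyDirected where
  cond {c d k} fi fj xi xj h := by
    obtain ⟨yi, rfl⟩ := fstι_surjective c xi
    obtain ⟨yj, rfl⟩ := fstι_surjective d xj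
    have h1 : ∀ {c' d' : Chart M N} (f : c' ⟶ d') (y), (functor M N).map f (fstι c' y) =
        fstι d' (Spec.map (M.scheme.presheaf.map
          (homOfLE (show c'.fst.1 ≤ d'.fst.1 from fst_le f.le)).op) y) := fun f y => by
      rw [← Scheme.Hom.comp_apply, ← Scheme.Hom.comp_apply, fstι_naturality f.le]
      rfl
    have h2 : ∀ {c' d' : Chart M N} (f : c' ⟶ d') (y), d'.fst.2.fromSpec
        (Spec.map (M.scheme.presheaf.map
          (homOfLE (show c'.fst.1 ≤ d'.fst.1 from fst_le f.le)).op) y) = c'.fst.2.fromSpec y :=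
      fun {c' d'} f y => by
        rw [← Scheme.Hom.comp_apply, d'.fst.2.map_fromSpec c'.fst.2]
    have h3 := (isClosedImmersion_fstι k).isClosedEmbedding.injective
      ((h1 fi yi).symm.trans (Eq.trans h (h1 fj yj)))
    have h4 : c.fst.2.fromSpec yi = d.fst.2.fromSpec yj :=
      (h2 fi yi).symm.trans (congr(k.fst.2.fromSpec $h3).trans (h2 fj yj))
    have hmem : ∀ (c : Chart M N) y, c.fst.2.fromSpec y ∈ c.fst.1 := fun c y => by
      rw [← SetLike.mem_coe, ← c.fst.2.range_fromSpec]
      exact ⟨y, rfl⟩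
    obtain ⟨l, hlc, hld, hl⟩ := exists_le_le c d (hmem c yi) (h4 ▸ hmem d yj)
    obtain ⟨y, hy⟩ := exists_fromSpec_eq l.fst hl
    have hinj : ∀ c : Chart M N, Function.Injective c.fst.2.fromSpec := fun c =>
      c.fst.2.isOpenImmersion_fromSpec.base_open.injective
    refine ⟨l, homOfLE hlc, homOfLE hld, fstι l y, (h1 (homOfLE hlc) y).trans congr(fstι c $(hinj c ?_)),
      (h1 (homOfLE hld) y).trans congr(fstι d $(hinj d ?_))⟩
    · exact (h2 (homOfLE hlc) y).trans hy
    · exact (h2 (homOfLE hld) y).trans (hy.trans h4)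

end Chart

end Ambient

end QSymBlowUp

/-! ### Gluing the charts to a pushout of finite type over `k`. -/

namespace QSymBlowUp

open Scheme Limits QSym

namespace Ambient

variable {k : Type u} [Field k] {X Y : Scheme.{u}} {sX : X ⟶ Spec (.of k)} {M N : Ambient sX}

namespace Chart

/-- The structure map on an affine open, as a map of rings. -/
def strHom (M : Ambient sX) (V : M.scheme.affineOpens) : CommRingCat.of k ⟶ Γ(M.scheme, V.1) :=
  Spec.preimage (V.2.fromSpec ≫ M.str)

lemma map_strHom (M : Ambient sX) (V : M.scheme.affineOpens) :
    Spec.map (strHom M V) = V.2.fromSpec ≫ M.str := Spec.map_preimage _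

lemma strHom_map {Z : Ambient sX} {U V : Z.scheme.affineOpens} (h : U ≤ V) :
    strHom Z V ≫ Z.scheme.presheaf.map (homOfLE (show U.1 ≤ V.1 from h)).op = strHom Z U := by
  refine Spec.map_injective ?_
  rw [Spec.map_comp, map_strHom, map_strHom, ← Category.assoc, V.2.map_fromSpec U.2]

lemma strHom_comm (c : Chart M N) :
    strHom M c.fst ≫ M.ι.appLE c.fst.1 (N.res c.snd).1 c.le = strHom N c.snd ≫ N.ι.app c.snd.1 := by
  refine Spec.map_injective ?_
  have h1 : Spec.map (M.ι.appLE c.fst.1 (N.res c.snd).1 c.le) ≫ c.fst.2.fromSpec =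
      (N.res c.snd).2.fromSpec ≫ M.ι :=
    IsAffineOpen.SpecMap_appLE_fromSpec M.ι c.fst.2 (N.res c.snd).2 c.le
  have h2 : Spec.map (N.ι.app c.snd.1) ≫ c.snd.2.fromSpec =
      (N.res c.snd).2.fromSpec ≫ N.ι := by
    rw [Scheme.Hom.app_eq_appLE]
    exact IsAffineOpen.SpecMap_appLE_fromSpec N.ι c.snd.2 (N.res c.snd).2 le_rfl
  refine (Spec.map_comp _ _).trans (Eq.trans ?_ (Spec.map_comp _ _).symm)
  refine congr(_ ≫ $(map_strHom M c.fst)).trans (Eq.trans ?_ congr(_ ≫ $(map_strHom N c.snd)).symm)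
  refine congr($h1 ≫ M.str).trans (Eq.trans ?_ congr($h2 ≫ N.str).symm)
  rw [Category.assoc, Category.assoc, M.ι_str, N.ι_str]

/-- The structure map of the ring of functions of a chart. -/
def ringStr (c : Chart M N) : k →+* c.ring :=
  FiberProd.lift (strHom N c.snd).hom (strHom M c.fst).hom fun x => congr($(c.strHom_comm.symm) x)

lemma finiteType_strHom (M : Ambient sX) (V : M.scheme.affineOpens) :
    (strHom M V).hom.FiniteType := by
  have h : LocallyOfFiniteType (Spec.map (strHom M V)) := by
    rw [map_strHom]
    have := V.2.isOpenImmersion_fromSpec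
    infer_instance
  exact (HasRingHomProperty.Spec_iff (P := @LocallyOfFiniteType)).mp h

lemma finiteType_ringStr (c : Chart M N) : c.ringStr.FiniteType :=
  FiberProd.finiteType _ _ _ (finiteType_strHom M _) (finiteType_strHom N _)
    (N.resHom_surjective _) c.comp_surjective

end Chart

open Chart

variable [Surjective N.ι]

variable (M N) in
/-- The pushout of `M` and `N` over `X`, if `X → N` is surjective. -/
def pushout : Scheme.{u} := colimit (functor M N)

variable (M N) in
/-- The cover of the pushout by the charts. -/
def pushoutCover : (pushout M N).OpenCover := IsLocallyDirected.openCover (functor M N)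

variable (M N) in
/-- The structure map of the pushout. -/
def pushoutStr : pushout M N ⟶ Spec (.of k) :=
  colimit.desc (functor M N)
    { pt := Spec (.of k)
      ι := { app := fun c => Spec.map (CommRingCat.ofHom c.ringStr)
             naturality := fun c d h => by
              have h1 : (Chart.map h.le).comp d.ringStr = c.ringStr := by
                refine RingHom.ext fun x => FiberProd.ext ?_ ?_
                · exact congr($(strHom_map (snd_le h.le)) x)
                · exact congr($(strHom_map (fst_le h.le)) x)
              refine (Spec.map_comp _ _).symm.trans (Eq.trans ?_ (Category.comp_id _).symm)
              exact congr(Spec.map (CommRingCat.ofHom $h1)) } }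

lemma ι_pushoutStr (c : Chart M N) :
    colimit.ι (functor M N) c ≫ pushoutStr M N = Spec.map (CommRingCat.ofHom c.ringStr) :=
  colimit.ι_desc _ _

variable (M N) in
lemma exists_inl : ∃ g : M.scheme ⟶ pushout M N, ∀ c : Chart M N,
    c.fst.2.fromSpec ≫ g = fstι c ≫ colimit.ι (functor M N) c := by
  refine exists_glue (fun c : Chart M N => c.fst) (exists_mem_fst M N) (· ≤ ·)
    (fun _ _ => fst_le) (fun c d m => exists_le_le c d)
    (fun c => fstι c ≫ colimit.ι (functor M N) c) fun c d h => ?_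
  refine (Category.assoc _ _ _).symm.trans (congr($(fstι_naturality h) ≫ _).trans ?_)
  refine (Category.assoc _ _ _).trans congr(fstι c ≫ $(colimit.w (functor M N) (homOfLE h)))

variable (M N) in
lemma exists_inr : ∃ g : N.scheme ⟶ pushout M N, ∀ c : Chart M N,
    c.snd.2.fromSpec ≫ g = sndι c ≫ colimit.ι (functor M N) c := by
  refine exists_glue (fun c : Chart M N => c.snd) exists_mem_snd (· ≤ ·)
    (fun _ _ => snd_le) (fun c d n hc hd => ?_)
    (fun c => sndι c ≫ colimit.ι (functor M N) c) fun c d h => ?_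
  · obtain ⟨p, rfl⟩ := N.ι.surjective n
    obtain ⟨l, hlc, hld, hl⟩ := exists_le_le c d (c.mem_snd.mp hc) (d.mem_snd.mp hd)
    exact ⟨l, hlc, hld, l.mem_snd.mpr hl⟩
  · refine (Category.assoc _ _ _).symm.trans (congr($(sndι_naturality h) ≫ _).trans ?_)
    refine (Category.assoc _ _ _).trans congr(sndι c ≫ $(colimit.w (functor M N) (homOfLE h)))

variable (M N) in
/-- The map from the first scheme to the pushout. -/
def pushoutInl : M.scheme ⟶ pushout M N := (exists_inl M N).choose

variable (M N) in
/-- The map from the second scheme to the pushout. -/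
def pushoutInr : N.scheme ⟶ pushout M N := (exists_inr M N).choose

lemma fromSpec_pushoutInl (c : Chart M N) :
    c.fst.2.fromSpec ≫ pushoutInl M N = fstι c ≫ colimit.ι (functor M N) c :=
  (exists_inl M N).choose_spec c

lemma fromSpec_pushoutInr (c : Chart M N) :
    c.snd.2.fromSpec ≫ pushoutInr M N = sndι c ≫ colimit.ι (functor M N) c :=
  (exists_inr M N).choose_spec c

variable (M N) in
lemma ι_pushoutInl : M.ι ≫ pushoutInl M N = N.ι ≫ pushoutInr M N := by
  refine (affineOpensCover (fun c : Chart M N => N.res c.snd) fun p => ?_).hom_ext _ _ fun c => ?_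
  · obtain ⟨c, hc⟩ := exists_mem_fst M N (M.ι p)
    exact ⟨c, c.mem_snd.mpr hc⟩
  · change (N.res c.snd).2.fromSpec ≫ _ = (N.res c.snd).2.fromSpec ≫ _
    have h1 : Spec.map (M.ι.appLE c.fst.1 (N.res c.snd).1 c.le) ≫ c.fst.2.fromSpec =
        (N.res c.snd).2.fromSpec ≫ M.ι :=
      IsAffineOpen.SpecMap_appLE_fromSpec M.ι c.fst.2 (N.res c.snd).2 c.le
    have h2 : Spec.map (N.ι.app c.snd.1) ≫ c.snd.2.fromSpec =
        (N.res c.snd).2.fromSpec ≫ N.ι := by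
      rw [Scheme.Hom.app_eq_appLE]
      exact IsAffineOpen.SpecMap_appLE_fromSpec N.ι c.snd.2 (N.res c.snd).2 le_rfl
    refine (Category.assoc _ _ _).symm.trans (congr($(h1.symm) ≫ _).trans ?_)
    refine Eq.trans ?_ ((Category.assoc _ _ _).symm.trans (congr($(h2.symm) ≫ _))).symm
    refine (Category.assoc _ _ _).trans (congr(_ ≫ $(fromSpec_pushoutInl c)).trans ?_)
    refine Eq.trans ?_ ((Category.assoc _ _ _).trans (congr(_ ≫ $(fromSpec_pushoutInr c)))).symm
    refine (Category.assoc _ _ _).symm.trans (Eq.trans ?_ (Category.assoc _ _ _))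
    exact congr($(appLE_fstι c) ≫ colimit.ι (functor M N) c)

/-- Points of two charts identified in the colimit come from a common smaller chart, hence from one
point of `M`. This is the condition on preimages needed to recognise closed immersions chart by
chart. -/
lemma pushoutInl_mem (c : Chart M N) {m : M.scheme}
    (h : pushoutInl M N m ∈ (colimit.ι (functor M N) c).opensRange) : m ∈ c.fst.1 := by
  obtain ⟨z, hz⟩ := h
  obtain ⟨d, hd⟩ := exists_mem_fst M N m
  obtain ⟨y, rfl⟩ := exists_fromSpec_eq d.fst hd
  obtain ⟨l, fi, fj, w, -, hw⟩ := (IsLocallyDirected.ι_eq_ι_iff (functor M N)).mp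
    (hz.trans (congr($(fromSpec_pushoutInl d) y) : _ = colimit.ι (functor M N) d (fstι d y)))
  obtain ⟨y', rfl⟩ := fstι_surjective l w
  have h1 : fstι d (Spec.map (M.scheme.presheaf.map
      (homOfLE (show l.fst.1 ≤ d.fst.1 from fst_le fj.le)).op) y') = fstι d y :=
    (congr($(fstι_naturality fj.le) y')).trans hw
  have h2 := (isClosedImmersion_fstι d).isClosedEmbedding.injective h1
  rw [← h2, ← Scheme.Hom.comp_apply, d.fst.2.map_fromSpec l.fst.2]
  refine fst_le fi.le ?_
  rw [← SetLike.mem_coe, ← l.fst.2.range_fromSpec]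
  exact ⟨y', rfl⟩

instance : IsClosedImmersion (pushoutInl M N) := by
  have : ∀ c : (pushoutCover M N).I₀, IsOpenImmersion (Chart.fst c).2.fromSpec :=
    fun c => (Chart.fst c).2.isOpenImmersion_fromSpec
  refine isClosedImmersion_of_openCover (pushoutInl M N) (pushoutCover M N)
    (fun c => (Chart.fst c).2.fromSpec) (fun c => fstι c) (fun c => isClosedImmersion_fstι c)
    fromSpec_pushoutInl fun c m hm => ?_
  have h := pushoutInl_mem c hm
  rwa [← SetLike.mem_coe, ← (Chart.fst c).2.range_fromSpec] at h

instance : IsClosedImmersion (pushoutInr M N) := by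
  have : ∀ c : (pushoutCover M N).I₀, IsOpenImmersion (Chart.snd c).2.fromSpec :=
    fun c => (Chart.snd c).2.isOpenImmersion_fromSpec
  refine isClosedImmersion_of_openCover (pushoutInr M N) (pushoutCover M N)
    (fun c => (Chart.snd c).2.fromSpec) (fun c => sndι c) (fun c => isClosedImmersion_sndι c)
    fromSpec_pushoutInr fun c n hn => ?_
  obtain ⟨p, rfl⟩ := N.ι.surjective n
  have h1 : pushoutInl M N (M.ι p) = pushoutInr M N (N.ι p) := congr($(ι_pushoutInl M N) p)
  have h : N.ι p ∈ (Chart.snd c).1 := (Chart.mem_snd c).mpr (pushoutInl_mem c (h1 ▸ hn))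
  rwa [← SetLike.mem_coe, ← (Chart.snd c).2.range_fromSpec] at h

variable (M N) in
lemma pushoutInl_str : pushoutInl M N ≫ pushoutStr M N = M.str := by
  refine (affineOpensCover (fun c : Chart M N => c.fst) (exists_mem_fst M N)).hom_ext _ _ fun c => ?_
  refine (Category.assoc _ _ _).symm.trans (congr($(fromSpec_pushoutInl c) ≫ _).trans ?_)
  refine (Category.assoc _ _ _).trans (congr(_ ≫ $(ι_pushoutStr c)).trans ?_)
  exact (Spec.map_comp _ _).symm.trans (map_strHom _ _)

variable (M N) in
lemma pushoutInr_str : pushoutInr M N ≫ pushoutStr M N = N.str := by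
  refine (affineOpensCover (fun c : Chart M N => c.snd) exists_mem_snd).hom_ext _ _ fun c => ?_
  refine (Category.assoc _ _ _).symm.trans (congr($(fromSpec_pushoutInr c) ≫ _).trans ?_)
  refine (Category.assoc _ _ _).trans (congr(_ ≫ $(ι_pushoutStr c)).trans ?_)
  exact (Spec.map_comp _ _).symm.trans (map_strHom _ _)

instance : LocallyOfFiniteType (pushoutStr M N) := by
  have : IsZariskiLocalAtSource @LocallyOfFiniteType.{u} :=
    HasRingHomProperty.instIsZariskiLocalAtSource (Q := RingHom.FiniteType)
  refine (IsZariskiLocalAtSource.iff_of_openCover (P := @LocallyOfFiniteType)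
    (pushoutCover M N)).mpr fun c => ?_
  have h : (pushoutCover M N).f c ≫ pushoutStr M N = _ := ι_pushoutStr c
  rw [h]
  exact (HasRingHomProperty.Spec_iff (P := @LocallyOfFiniteType)).mpr c.finiteType_ringStr

/-- The points of the pushout are those of `M`; quasi-compactness is inherited from this. -/
lemma pushoutInl_surjective : Function.Surjective (pushoutInl M N) := fun x => by
  obtain ⟨c, z, rfl⟩ := IsLocallyDirected.ι_jointly_surjective (functor M N) x
  obtain ⟨y, rfl⟩ := fstι_surjective c z
  exact ⟨c.fst.2.fromSpec y, congr($(fromSpec_pushoutInl c) y)⟩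

instance : QuasiCompact (pushoutStr M N) := by
  have h1 : CompactSpace M.scheme := (quasiCompact_iff_compactSpace M.str).mp M.quasiCompact
  have h2 : CompactSpace (pushout M N) :=
    (pushoutInl_surjective (M := M) (N := N)).compactSpace (pushoutInl M N).continuous
  exact (quasiCompact_iff_compactSpace _).mpr h2

variable (M N) in
/-- The pushout as a scheme in which `X` is embedded. -/
def pushoutAmbient : Ambient sX where
  scheme := pushout M N
  str := pushoutStr M N
  ι := M.ι ≫ pushoutInl M N
  ι_str := by rw [Category.assoc, pushoutInl_str, M.ι_str]

variable (M N) in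
/-- The embedding of the first scheme in the pushout. -/
def pushoutInlHom : Hom M (pushoutAmbient M N) where
  hom := pushoutInl M N
  isClosedImmersion := inferInstanceAs (IsClosedImmersion (pushoutInl M N))
  ι_hom := rfl
  hom_str := pushoutInl_str M N

variable (M N) in
/-- The embedding of the second scheme in the pushout. -/
def pushoutInrHom : Hom N (pushoutAmbient M N) where
  hom := pushoutInr M N
  isClosedImmersion := inferInstanceAs (IsClosedImmersion (pushoutInr M N))
  ι_hom := (ι_pushoutInl M N).symm
  hom_str := pushoutInr_str M N

end Ambient

end QSymBlowUp

namespace QSymBlowUp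

open Scheme QSym

/-! ### Graded subrings -/

section GradedSubring

variable {B : Type*} [CommRing B] (C : ℕ → AddSubgroup B) [SetLike.GradedMonoid C]

/-- The subring generated by a multiplicative family of subgroups. -/
def gradedSubring : Subring B := (DirectSum.coeRingHom C).range

/-- The homogeneous elements of the subring generated by a multiplicative family of subgroups. -/
def gradedSubringDeg (d : ℕ) : AddSubgroup (gradedSubring C) :=
  (C d).comap (gradedSubring C).subtype.toAddMonoidHom

variable {C}

lemma mem_gradedSubring {d : ℕ} {x : B} (hx : x ∈ C d) : x ∈ gradedSubring C :=
  ⟨DirectSum.of (fun d => C d) d ⟨x, hx⟩, DirectSum.coeRingHom_of C d ⟨x, hx⟩⟩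

lemma gradedSubring_induction {p : B → Prop} (h0 : p 0) (hmem : ∀ d, ∀ x ∈ C d, p x)
    (hadd : ∀ x y, p x → p y → p (x + y)) {x : B} (hx : x ∈ gradedSubring C) : p x := by
  obtain ⟨z, rfl⟩ := hx
  induction z using DirectSum.induction_on with
  | zero => rwa [map_zero]
  | of d y => rw [DirectSum.coeRingHom_of]; exact hmem d _ y.2
  | add y z hy hz => rw [map_add]; exact hadd _ _ hy hz

instance : SetLike.GradedMonoid (gradedSubringDeg C) where
  one_mem := SetLike.GradedOne.one_mem (A := C)
  mul_mem := fun _ _ _ _ hx hy => SetLike.GradedMul.mul_mem (A := C) hx hy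

lemma gradedSubring_isInternal (h : Function.Injective (DirectSum.coeAddMonoidHom C)) :
    DirectSum.IsInternal (gradedSubringDeg C) := by
  let m : (DirectSum ℕ fun d => gradedSubringDeg C d) →+ DirectSum ℕ fun d => C d :=
    DirectSum.map fun d =>
      { toFun := fun x => ⟨x.1.1, x.2⟩
        map_zero' := rfl
        map_add' := fun _ _ => rfl }
  have hm : ∀ x, DirectSum.coeAddMonoidHom C (m x) =
      (DirectSum.coeAddMonoidHom (gradedSubringDeg C) x).1 := by
    intro x
    induction x using DirectSum.induction_on with
    | zero => simp
    | of d y =>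
      simp only [m, DirectSum.map_of, DirectSum.coeAddMonoidHom_of]
      rfl
    | add y z hy hz => rw [map_add, map_add, map_add, hy, hz]; rfl
  constructor
  · intro x y hxy
    have h1 : m x = m y := h ((hm x).trans (congr(($hxy).1).trans (hm y).symm))
    ext d
    exact congr((($h1) d).1)
  · intro x
    suffices H : ∃ y, (DirectSum.coeAddMonoidHom (gradedSubringDeg C) y).1 = x.1 by
      obtain ⟨y, hy⟩ := H
      exact ⟨y, Subtype.ext hy⟩
    refine gradedSubring_induction (p := fun x =>
      ∃ y, (DirectSum.coeAddMonoidHom (gradedSubringDeg C) y).1 = x) ⟨0, rfl⟩ ?_ ?_ x.2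
    · intro d x hx
      exact ⟨DirectSum.of (fun d => gradedSubringDeg C d) d ⟨⟨x, mem_gradedSubring hx⟩, hx⟩, by
        rw [DirectSum.coeAddMonoidHom_of]⟩
    · rintro _ _ ⟨x, rfl⟩ ⟨y, rfl⟩
      exact ⟨x + y, by rw [map_add]; rfl⟩

/-- The grading of the subring generated by an independent multiplicative family of subgroups. -/
@[reducible]
def gradedRingGradedSubring (h : Function.Injective (DirectSum.coeAddMonoidHom C)) :
    GradedRing (gradedSubringDeg C) where
  __ := (gradedSubring_isInternal h).chooseDecomposition

end GradedSubring

/-- The fibre product has the same quotient ring `A`, so the scalar `c` is its own lift there; the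
comparison is therefore linear over functions on `X`. -/
lemma QSym.comparison_inl_algebraMap {R A S A' : Type u} [CommRing R] [CommRing A] [CommRing S]
    [CommRing A'] {φ : R →+* A} {I : Ideal R} {𝔞 : Ideal A} {h : I ≤ 𝔞.comap φ}
    {ψ : S →+* A'} {I' : Ideal S} {𝔞' : Ideal A'} {h' : I' ≤ 𝔞'.comap ψ}
    (hI : I = 𝔞.comap φ) (hI' : I' = 𝔞'.comap ψ) (a : A →+* A')
    (ha : 𝔞 ≤ 𝔞'.comap a) (hb : Function.Bijective (fiberSnd (h := h) hI ψ a)) (c : A) :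
    comparison (h' := h') hI hI' a ha hb (inl φ I 𝔞 h (algebraMap A _ c)) =
      inl ψ I' 𝔞' h' (algebraMap A' _ (a c)) := by
  have h1 : inl φ I 𝔞 h (algebraMap A _ c) =
      fiberSnd hI ψ a (inl _ _ _ _ (algebraMap A _ c)) := by
    exact ((map_inl _ _ _ _ _ _).trans congr(inl φ I 𝔞 h $(symMap_algebraMap (RingHom.id A) 𝔞 𝔞 (fun _ hx => hx) c))).symm
  rw [h1, comparison_fiberSnd]
  refine (map_inl _ _ _ _ _ _).trans ?_
  rw [symMap_algebraMap]

namespace Ambient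

variable {k : Type u} [Field k] {X Y : Scheme.{u}} {sX : X ⟶ Spec (.of k)}
  (j : Y ⟶ X) [IsClosedImmersion j]

lemma qSymStr_mem_deg (N : Ambient sX) (V : N.scheme.affineOpens) (r : Γ(X, (N.res V).1)) :
    N.qSymStr j V r ∈ N.qSymDeg j V 0 := by
  refine ⟨algebraMap _ _ r, ?_, rfl⟩
  change algebraMap _ _ r ∈ Sym.deg _ 0
  rw [Sym.deg, pow_zero]
  exact Submodule.algebraMap_mem r

lemma cmp_qSymStr (M : Ambient sX) [Smooth M.str] {N : Ambient sX} {V : M.scheme.affineOpens}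
    {V' : N.scheme.affineOpens} (e : N.res V' ≤ M.res V) (r : Γ(X, (M.res V).1)) :
    M.cmp j e (M.qSymStr j V r) = N.qSymStr j V' (X.presheaf.map (homOfLE e).op r) :=
  QSym.comparison_inl_algebraMap _ _ _ _ _ r

/-! ### Compatible families -/

section Family

variable (M : Ambient sX)

/-- The affine opens of `M` with trace in `U`. -/
abbrev OpensIn (U : X.affineOpens) : Type u := { V : M.scheme.affineOpens // M.res V ≤ U }

/-- The compatible families of sections of degree `d` over `U`. -/
def familyDeg (U : X.affineOpens) (d : ℕ) : AddSubgroup (∀ V : M.OpensIn U, M.qSym j V.1) where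
  carrier := { s | (∀ V, s V ∈ M.qSymDeg j V.1 d) ∧
    ∀ (V V' : M.OpensIn U) (h : V'.1 ≤ V.1), M.qSymRes j h (s V) = s V' }
  zero_mem' := ⟨fun _ => zero_mem _, fun _ _ _ => map_zero _⟩
  add_mem' := fun hs ht => ⟨fun V => add_mem (hs.1 V) (ht.1 V), fun V V' h =>
    (map_add _ _ _).trans congr($(hs.2 V V' h) + $(ht.2 V V' h))⟩
  neg_mem' := fun hs => ⟨fun V => neg_mem (hs.1 V), fun V V' h =>
    (map_neg _ _).trans congr(-$(hs.2 V V' h))⟩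

instance (U : X.affineOpens) : SetLike.GradedMonoid (M.familyDeg j U) where
  one_mem := ⟨fun V => SetLike.GradedOne.one_mem (A := M.qSymDeg j V.1), fun _ _ _ => map_one _⟩
  mul_mem := fun _ _ _ _ hs ht => ⟨fun V => SetLike.GradedMul.mul_mem (hs.1 V) (ht.1 V),
    fun V V' h => (map_mul _ _ _).trans congr($(hs.2 V V' h) * $(ht.2 V V' h))⟩

/-- The degree `d` component over each `V` recovers the summand of index `d`. Infinite products of
graded rings need not be graded by their homogeneous families, which is why only finite sums of such
families are kept. -/
lemma familyDeg_injective (U : X.affineOpens) :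
    Function.Injective (DirectSum.coeAddMonoidHom (M.familyDeg j U)) := by
  have key : ∀ (x : DirectSum ℕ fun d => M.familyDeg j U d) (d : ℕ) (V : M.OpensIn U),
      (DirectSum.decompose (M.qSymDeg j V.1)
        (DirectSum.coeAddMonoidHom (M.familyDeg j U) x V) d : M.qSym j V.1) = (x d).1 V := by
    intro x d V
    induction x using DirectSum.induction_on with
    | zero => simp
    | of i y =>
      rw [DirectSum.coeAddMonoidHom_of]
      by_cases h : i = d
      · subst h
        rw [DirectSum.of_eq_same, DirectSum.decompose_of_mem_same _ (y.2.1 V)]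
      · rw [DirectSum.of_eq_of_ne _ _ _ (Ne.symm h),
          DirectSum.decompose_of_mem_ne _ (y.2.1 V) h]
        rfl
    | add x y hx hy =>
      rw [map_add, Pi.add_apply, DirectSum.decompose_add, DirectSum.add_apply, DirectSum.add_apply,
        AddMemClass.coe_add, hx, hy]
      rfl
  intro x y hxy
  refine DFinsupp.ext fun d => Subtype.ext (funext fun V => ?_)
  rw [← key, ← key, hxy]

/-- The sums of compatible families of homogeneous sections over `U`. -/
abbrev family (U : X.affineOpens) : Subring (∀ V : M.OpensIn U, M.qSym j V.1) :=
  gradedSubring (M.familyDeg j U)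

variable {M} in
lemma family_compat {U : X.affineOpens} {s : ∀ V : M.OpensIn U, M.qSym j V.1}
    (hs : s ∈ M.family j U) (V V' : M.OpensIn U) (h : V'.1 ≤ V.1) :
    M.qSymRes j h (s V) = s V' :=
  gradedSubring_induction (p := fun s => M.qSymRes j h (s V) = s V') (map_zero _)
    (fun d s (hs : s ∈ M.familyDeg j U d) => hs.2 V V' h) (fun _ _ hs ht => (map_add _ _ _).trans congr($hs + $ht)) hs

/-- The restriction of families. -/
def familyRes {U U' : X.affineOpens} (h : U' ≤ U) :
    (∀ V : M.OpensIn U, M.qSym j V.1) →+* (∀ V : M.OpensIn U', M.qSym j V.1) :=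
  RingHom.pi fun V => Pi.evalRingHom (fun V : M.OpensIn U => M.qSym j V.1) ⟨V.1, V.2.trans h⟩

lemma familyRes_mem_deg {U U' : X.affineOpens} (h : U' ≤ U) {d : ℕ}
    {s : ∀ V : M.OpensIn U, M.qSym j V.1} (hs : s ∈ M.familyDeg j U d) :
    M.familyRes j h s ∈ M.familyDeg j U' d :=
  ⟨fun V => hs.1 ⟨V.1, V.2.trans h⟩, fun V V' h' => hs.2 ⟨V.1, V.2.trans h⟩ ⟨V'.1, V'.2.trans h⟩ h'⟩

lemma familyRes_mem {U U' : X.affineOpens} (h : U' ≤ U)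
    {s : ∀ V : M.OpensIn U, M.qSym j V.1} (hs : s ∈ M.family j U) :
    M.familyRes j h s ∈ M.family j U' :=
  gradedSubring_induction (p := fun s => M.familyRes j h s ∈ M.family j U')
    (by rw [map_zero]; exact zero_mem _)
    (fun _ _ hs => mem_gradedSubring (M.familyRes_mem_deg j h hs))
    (fun _ _ hs ht => by rw [map_add]; exact add_mem hs ht) hs

/-- The structure map to families. -/
def familyStr (U : X.affineOpens) : Γ(X, U.1) →+* ∀ V : M.OpensIn U, M.qSym j V.1 :=
  RingHom.pi fun V => (M.qSymStr j V.1).comp (X.presheaf.map (homOfLE V.2).op).hom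

lemma familyStr_mem_deg (U : X.affineOpens) (r : Γ(X, U.1)) :
    M.familyStr j U r ∈ M.familyDeg j U 0 :=
  ⟨fun V => M.qSymStr_mem_deg j V.1 _, fun _ V' h =>
    (qSymMap_qSymStr j (Hom.id M) h _).trans congr(M.qSymStr j V'.1 $(presheaf_map_map _ _ r))⟩

/-- The graded algebra of sums of compatible families of homogeneous sections. -/
def familyAlg : GradedAlg X where
  obj U := M.family j U
  deg U := gradedSubringDeg (M.familyDeg j U)
  graded U := gradedRingGradedSubring (M.familyDeg_injective j U)
  map h :=
    { __ := ((M.familyRes j h).comp (M.family j _).subtype).codRestrict (M.family j _)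
        fun x => M.familyRes_mem j h x.2
      map_mem := fun hx => M.familyRes_mem_deg j h hx }
  map_id _ _ := rfl
  map_comp _ _ _ := rfl
  str U := (M.familyStr j U).codRestrict (M.family j U)
    fun r => mem_gradedSubring (M.familyStr_mem_deg j U r)
  str_mem U r := M.familyStr_mem_deg j U r
  map_str h r := Subtype.ext (funext fun V =>
    congr(M.qSymStr j V.1 $((presheaf_map_map h V.2 r).symm)))

lemma exists_opensIn (U : X.affineOpens) {p : X} (hp : p ∈ U.1) :
    ∃ V : M.OpensIn U, p ∈ (M.res V.1).1 := by
  obtain ⟨V, hV, hpV, -⟩ := exists_isAffineOpen_mem_and_subset (x := M.ι p) (U := ⊤) trivial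
  obtain ⟨V', -, hpV', hle⟩ := M.exists_affineOpens_res_le (W := ⟨V, hV⟩) U.1 hpV hp
  exact ⟨⟨V', hle⟩, hpV'⟩

variable {M} in
lemma locallyAgree_of_mem_family {U : X.affineOpens} {s : ∀ V : M.OpensIn U, M.qSym j V.1}
    (hs : s ∈ M.family j U) : LocallyAgree j M (V := fun V : M.OpensIn U => V.1) s := by
  intro V V' p hp hp'
  obtain ⟨W, h, h', hW⟩ := exists_affineOpens_le_inf V.1 V'.1 (x := M.ι p) hp hp'
  have hWU : M.res W ≤ U := le_trans (fun _ hx => h hx) V.2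
  exact ⟨W, h, h', hW, (family_compat j hs V ⟨W, hWU⟩ h).trans
    (family_compat j hs V' ⟨W, hWU⟩ h').symm⟩

variable [Smooth M.str]

lemma exists_isGlued_family (N : Ambient sX) (W : N.scheme.affineOpens)
    (s : M.family j (N.res W)) : ∃ t : N.qSym j W,
      IsGlued j M (V := fun V : M.OpensIn (N.res W) => V.1) s.1 t :=
  (locallyAgree_of_mem_family j s.2).exists_isGlued j N W fun _ hp => M.exists_opensIn _ hp

/-- The section glued from a family. -/
def familyGlue (N : Ambient sX) (W : N.scheme.affineOpens) (s : M.family j (N.res W)) :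
    N.qSym j W := (M.exists_isGlued_family j N W s).choose

lemma familyGlue_isGlued (N : Ambient sX) (W : N.scheme.affineOpens)
    (s : M.family j (N.res W)) :
    IsGlued j M (V := fun V : M.OpensIn (N.res W) => V.1) s.1 (M.familyGlue j N W s) :=
  (M.exists_isGlued_family j N W s).choose_spec

variable {M} in
lemma familyGlue_eq {N : Ambient sX} {W : N.scheme.affineOpens} {s : M.family j (N.res W)}
    {t : N.qSym j W} (ht : IsGlued j M (V := fun V : M.OpensIn (N.res W) => V.1) s.1 t) :
    M.familyGlue j N W s = t :=
  (M.familyGlue_isGlued j N W s).ext j ht fun _ hp => M.exists_opensIn _ hp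

/-- The projection from families to sections. -/
def familyProj (N : Ambient sX) (W : N.scheme.affineOpens) :
    M.family j (N.res W) →+* N.qSym j W where
  toFun := M.familyGlue j N W
  -- All the ring identities follow from uniqueness of the glued section, restriction and comparison
  -- being ring maps.
  map_zero' := familyGlue_eq j fun _ _ _ _ => (map_zero _).trans (map_zero _).symm
  map_one' := familyGlue_eq j fun _ _ _ _ => (map_one _).trans (map_one _).symm
  map_add' s t := familyGlue_eq j fun V W' h e => (map_add _ _ _).trans
    ((congr($(M.familyGlue_isGlued j N W s V W' h e) +
      $(M.familyGlue_isGlued j N W t V W' h e))).trans (map_add _ _ _).symm)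
  map_mul' s t := familyGlue_eq j fun V W' h e => (map_mul _ _ _).trans
    ((congr($(M.familyGlue_isGlued j N W s V W' h e) *
      $(M.familyGlue_isGlued j N W t V W' h e))).trans (map_mul _ _ _).symm)

/-- The cone given by families. -/
def familyCone : QSymCone sX j where
  alg := M.familyAlg j
  proj := M.familyProj j
  proj_mem N W d x hx := (M.familyGlue_isGlued j N W x).mem_qSymDeg j
    (fun _ hp => M.exists_opensIn _ hp) hx.1
  proj_str N W r := familyGlue_eq j fun V W' h e => by
    refine (qSymMap_qSymStr j (Hom.id N) h _).trans (Eq.trans ?_ (M.cmp_qSymStr j e _).symm)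
    exact congr(N.qSymStr j W' $((presheaf_map_map _ _ r).symm))
  qSymMap_proj {N N'} g V V' e x := Eq.symm <| familyGlue_eq j fun T W' h e₁ =>
    (M.familyGlue_isGlued j N' V x).qSymMap j g e ⟨T.1, T.2.trans (res_le g e)⟩ W' h e₁

end Family

end Ambient

end QSymBlowUp

namespace QSymBlowUp

open Scheme QSym

lemma exists_preimage_eq_of_isClosedImmersion {Z P : Scheme.{u}} (g : Z ⟶ P) [IsClosedImmersion g]
    (O : Z.Opens) : ∃ O' : P.Opens, g ⁻¹ᵁ O' = O := by
  obtain ⟨O', hO', h⟩ := g.isClosedEmbedding.isInducing.isOpen_iff.mp O.2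
  exact ⟨⟨O', hO'⟩, TopologicalSpace.Opens.ext h⟩

namespace Ambient

variable {k : Type u} [Field k] {X Y : Scheme.{u}} {sX : X ⟶ Spec (.of k)}
  (j : Y ⟶ X) [IsClosedImmersion j] (M : Ambient sX) [Smooth M.str]

instance (N : Ambient sX) (n : ℕ) : Surjective (N.thickening n).ι := ⟨N.thickening_ι_surjective n⟩

/-! ### Compatible families are determined by their values on a smooth ambient scheme -/

/-- The key rigidity statement. Near a point both sides are homogeneous of degree `d`, so they may
be compared on the neighbourhood of order `d` of `X` in `N`. That neighbourhood and `M` both embed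
in their pushout, and the member of the family there links the two sections. -/
lemma family_eq_cmp {U : X.affineOpens} {d : ℕ}
    (s : ∀ (N : Ambient sX) (V : N.scheme.affineOpens), N.res V ≤ U → N.qSym j V)
    (hs : ∀ (N : Ambient sX) (V : N.scheme.affineOpens) (h : N.res V ≤ U),
      s N V h ∈ N.qSymDeg j V d)
    (hc : ∀ (N P : Ambient sX) (g : Ambient.Hom N P) (V : P.scheme.affineOpens)
      (V' : N.scheme.affineOpens) (e : V'.1 ≤ g.hom ⁻¹ᵁ V.1) (h : P.res V ≤ U),
      Ambient.qSymMap j g e (s P V h) = s N V' ((Ambient.res_le g e).trans h))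
    {N : Ambient sX} {W : N.scheme.affineOpens} {V : M.scheme.affineOpens} (hV : M.res V ≤ U)
    (hW : N.res W ≤ U) (e : N.res W ≤ M.res V) : s N W hW = M.cmp j e (s M V hV) := by
  refine N.qSym_ext j fun p hp => ?_
  obtain ⟨P, ⟨g⟩, ⟨g'⟩⟩ : ∃ P : Ambient sX, Nonempty (Hom M P) ∧ Nonempty (Hom (N.thickening d) P) :=
    ⟨_, ⟨pushoutInlHom M (N.thickening d)⟩, ⟨pushoutInrHom M (N.thickening d)⟩⟩
  obtain ⟨O, hO⟩ := exists_preimage_eq_of_isClosedImmersion g.hom V.1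
  have hpO : P.ι p ∈ O := by
    have h1 : M.ι p ∈ g.hom ⁻¹ᵁ O := hO ▸ e hp
    rwa [Scheme.Hom.mem_preimage, ← Scheme.Hom.comp_apply, g.ι_hom] at h1
  -- An affine open of the pushout around `p` whose trace on `M` lies in `V`, so that it can be
  -- compared with `s M V`.
  obtain ⟨W₀, hW₀, hpW₀, hle⟩ := exists_isAffineOpen_mem_and_subset hpO
  let W₁ : P.scheme.affineOpens := ⟨W₀, hW₀⟩
  let V₁ : M.scheme.affineOpens := ⟨g.hom ⁻¹ᵁ W₀, hW₀.preimage _⟩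
  have hV₁ : V₁ ≤ V := fun x hx => hO.le (hle hx)
  have hPU : P.res W₁ ≤ U := fun q hq => by
    have h1 : g.hom (M.ι q) ∈ W₀ := by
      rw [← Scheme.Hom.comp_apply, g.ι_hom]
      exact hq
    exact hV (hV₁ h1)
  -- The pushout receives only the neighbourhood of `X`, not `N`. The preimage of `W₀` is therefore
  -- extended to an open of `N`, inside which `W'` is chosen.
  obtain ⟨O', hO'⟩ := exists_preimage_eq_of_isClosedImmersion (N.thickeningHom d).hom
    (g'.hom ⁻¹ᵁ W₀)
  have hpO' : N.ι p ∈ O' := by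
    have h1 : (N.thickening d).ι p ∈ (N.thickeningHom d).hom ⁻¹ᵁ O' := by
      rw [hO', Scheme.Hom.mem_preimage, ← Scheme.Hom.comp_apply, g'.ι_hom]
      exact hpW₀
    rwa [Scheme.Hom.mem_preimage, ← Scheme.Hom.comp_apply, (N.thickeningHom d).ι_hom] at h1
  obtain ⟨f, hf, hpf⟩ := W.2.exists_basicOpen_le ⟨N.ι p, hpO'⟩ hp
  let W' : N.scheme.affineOpens := N.scheme.affineBasicOpen f
  have hW' : W' ≤ W := N.scheme.affineBasicOpen_le f
  have hres : N.res W' ≤ N.res W := fun _ hx => hW' hx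
  refine ⟨W', hW', hpf, ?_⟩
  let T := N.thickeningRes d W'
  have hT : T.1 ≤ g'.hom ⁻¹ᵁ W₁.1 := fun x hx => hO'.le (hf hx)
  have hTW : (N.thickening d).res T ≤ N.res W' := (N.res_thickeningRes d W').le
  have h1 : N.qSymRes j hW' (s N W hW) = s N W' (hres.trans hW) := hc N N (Hom.id N) W W' hW' hW
  rw [h1, qSymRes_cmp j M e (hres.trans e) le_rfl hW', qSymRes_self, ← sub_eq_zero]
  -- The bound `d ≤ n + 1` holds for the neighbourhood of order `n = d`.
  refine N.eq_zero_of_qSymMap_thickeningHom j (n := d) (d := d) (by omega)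
    (sub_mem (hs _ _ _) (M.cmp_mem_deg j _ (hs _ _ _))) ?_
  have hTV₁ : (N.thickening d).res T ≤ M.res V₁ := fun q hq => by
    have h2 : g'.hom ((N.thickening d).ι q) ∈ W₀ := hT hq
    rw [← Scheme.Hom.comp_apply, g'.ι_hom, ← g.ι_hom, Scheme.Hom.comp_apply] at h2
    exact h2
  have h3 : M.cmp j (hTW.trans (hres.trans e)) (s M V hV) =
      M.cmp j hTV₁ (M.qSymRes j hV₁ (s M V hV)) := by
    rw [← qSymRes_cmp j M (hTW.trans (hres.trans e)) hTV₁ hV₁ le_rfl, qSymRes_self]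
  have h4 : M.qSymRes j hV₁ (s M V hV) = qSymMap j g (le_refl V₁.1) (s P W₁ hPU) :=
    (hc M M (Hom.id M) V V₁ hV₁ hV).trans (hc M P g W₁ V₁ le_rfl hPU).symm
  refine (map_sub _ _ _).trans (sub_eq_zero.mpr ?_)
  refine (hc _ _ (N.thickeningHom d) W' T le_rfl (hres.trans hW)).trans (Eq.trans ?_
    (qSymMap_cmp j M (hres.trans e) (hTW.trans (hres.trans e)) le_rfl (N.thickeningHom d) le_rfl
      _).symm)
  rw [qSymRes_self, h3, h4, M.cmp_qSymMap j hTV₁ g g' _ hT]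
  exact (hc _ P g' W₁ T hT hPU).symm

/-- The graded algebra of compatible families is the inverse limit. -/
lemma familyCone_isLimit : (M.familyCone j).IsLimit := by
  intro U d s hs hc
  have hx : (fun V : M.OpensIn U => s M V.1 V.2) ∈ M.familyDeg j U d :=
    ⟨fun V => hs M V.1 V.2, fun V V' h => hc M M (Hom.id M) V.1 V'.1 h V.2⟩
  refine ⟨⟨_, mem_gradedSubring hx⟩, ⟨hx, fun N W hW => familyGlue_eq j fun V W' h e => ?_⟩,
    fun y hy => Subtype.ext (funext fun V => ?_)⟩
  · have hW' : N.res W' ≤ U := le_trans (fun _ hx => h hx) hW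
    exact (hc N N (Hom.id N) W W' h hW).trans
      (M.family_eq_cmp j s hs hc (V.2.trans hW) hW' e)
  -- Uniqueness: the projection to `M` itself evaluates a family, because comparison within `M` is
  -- restriction.
  · refine Eq.trans (Eq.symm ?_) (hy.2 M V.1 V.2)
    have hV : M.res V.1 ≤ M.res V.1 := le_rfl
    refine familyGlue_eq j fun V' W' h e => ?_
    have h1 := locallyAgree_of_mem_family j y.2
    have hW' : M.res W' ≤ M.res V.1 := fun _ hx => h hx
    exact (M.cmp_eq_qSymRes j h hW' _).symm.trans
      (h1.cmp_eq j (a := V) (b := ⟨V'.1, V'.2.trans V.2⟩) hW' e)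

/-! ### Sections of a limit -/

section Limit

variable {M j} {Q : QSymCone sX j}

variable (M Q) in
/-- The restriction of a section of the limit to an affine open of `M`. -/
def toSec {U : X.affineOpens} (V : M.OpensIn U) : Q.alg.deg U →+*ᵍ M.qSymDeg j V.1 where
  __ := (Q.proj M V.1).comp (Q.alg.map V.2 : Q.alg.obj U →+* Q.alg.obj (M.res V.1))
  map_mem hx := Q.proj_mem M V.1 _ _ ((Q.alg.map V.2).map_mem hx)

lemma qSymRes_toSec {U : X.affineOpens} (V V' : M.OpensIn U) (h : V'.1 ≤ V.1) (x : Q.alg.obj U) :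
    M.qSymRes j h (M.toSec Q V x) = M.toSec Q V' x :=
  (Q.qSymMap_proj (Hom.id M) h _).trans congr(Q.proj M V'.1 $(Q.alg.map_comp _ _ x))

lemma toSec_map {U U' : X.affineOpens} (h : U' ≤ U) (V : M.OpensIn U') (x : Q.alg.obj U) :
    M.toSec Q V (Q.alg.map h x) = M.toSec Q ⟨V.1, V.2.trans h⟩ x :=
  congr(Q.proj M V.1 $(Q.alg.map_comp _ _ x))

lemma toSec_str {U : X.affineOpens} (V : M.OpensIn U) (r : Γ(X, U.1)) :
    M.toSec Q V (Q.alg.str U r) = M.qSymStr j V.1 (X.presheaf.map (homOfLE V.2).op r) :=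
  congr(Q.proj M V.1 $(Q.alg.map_str V.2 r)).trans (Q.proj_str M V.1 _)

lemma toSec_self (V : M.scheme.affineOpens) (x : Q.alg.obj (M.res V)) :
    M.toSec Q ⟨V, le_rfl⟩ x = Q.proj M V x :=
  congr(Q.proj M V $(Q.alg.map_id _ x))

variable (hQ : Q.IsLimit) {U : X.affineOpens} {T : Type u} (V : T → M.OpensIn U)
  (hV : ∀ p ∈ U.1, ∃ t, p ∈ (M.res (V t).1).1)

include hQ hV

/-- By `family_eq_cmp` the sections over a cover by opens of `M` determine, locally, the projections
to every embedding. The uniqueness clause of the limit then applies. -/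
lemma eq_of_toSec_eq_of_mem_deg {d : ℕ} {x y : Q.alg.obj U} (hx : x ∈ Q.alg.deg U d)
    (hy : y ∈ Q.alg.deg U d) (h : ∀ t, M.toSec Q (V t) x = M.toSec Q (V t) y) : x = y := by
  let s : Q.alg.obj U → ∀ (N : Ambient sX) (W : N.scheme.affineOpens), N.res W ≤ U → N.qSym j W :=
    fun x N W h => Q.proj N W (Q.alg.map h x)
  have hs : ∀ x ∈ Q.alg.deg U d, ∀ (N : Ambient sX) (W : N.scheme.affineOpens) (h : N.res W ≤ U),
      s x N W h ∈ N.qSymDeg j W d :=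
    fun x hx N W h => Q.proj_mem N W _ _ ((Q.alg.map h).map_mem hx)
  have hc : ∀ (x) (N P : Ambient sX) (g : Ambient.Hom N P) (V : P.scheme.affineOpens)
      (V' : N.scheme.affineOpens) (e : V'.1 ≤ g.hom ⁻¹ᵁ V.1) (h : P.res V ≤ U),
      Ambient.qSymMap j g e (s x P V h) = s x N V' ((Ambient.res_le g e).trans h) :=
    fun x N P g V V' e h => (Q.qSymMap_proj g e _).trans
      congr(Q.proj N V' $(Q.alg.map_comp _ _ x))
  refine (hQ U d (s x) (hs x hx) (hc x)).unique ⟨hx, fun N W h => rfl⟩ ⟨hy, fun N W hW => ?_⟩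
  refine N.qSym_ext j fun p hp => ?_
  obtain ⟨t, ht⟩ := hV p (hW hp)
  obtain ⟨W', hW', hpW', hle⟩ := N.exists_affineOpens_res_le (M.res (V t).1).1 hp ht
  have hWU : N.res W' ≤ U := le_trans (fun _ hx => hW' hx) hW
  refine ⟨W', hW', hpW', (hc y N N (Hom.id N) W W' hW' hW).trans (Eq.trans ?_
    (hc x N N (Hom.id N) W W' hW' hW).symm)⟩
  have h1 : s y N W' hWU = s x N W' hWU := by
    rw [M.family_eq_cmp j (s x) (hs x hx) (hc x) (V t).2 hWU hle,
      M.family_eq_cmp j (s y) (hs y hy) (hc y) (V t).2 hWU hle]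
    exact congr(M.cmp j hle $(h t)).symm
  exact h1

lemma eq_of_toSec_eq {x y : Q.alg.obj U} (h : ∀ t, M.toSec Q (V t) x = M.toSec Q (V t) y) :
    x = y := by
  classical
  refine (DirectSum.decompose (Q.alg.deg U)).injective (DFinsupp.ext fun d => Subtype.ext ?_)
  refine eq_of_toSec_eq_of_mem_deg hQ V hV (SetLike.coe_mem _) (SetLike.coe_mem _) fun t => ?_
  exact (map_decompose _ _ _).trans (congr((DirectSum.decompose _ $(h t) d).1).trans
    (map_decompose _ _ _).symm)

/-- Comparison glues the given sections to sections over every embedding, and these form a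
compatible family by uniqueness of gluing; the existence clause of the limit supplies `x`. -/
lemma exists_toSec_eq_of_mem_deg {d : ℕ} {z : ∀ t, M.qSym j (V t).1}
    (hz : LocallyAgree j M (V := fun t => (V t).1) z) (hd : ∀ t, z t ∈ M.qSymDeg j (V t).1 d) :
    ∃ x : Q.alg.obj U, ∀ t, M.toSec Q (V t) x = z t := by
  choose s hs using fun (N : Ambient sX) (W : N.scheme.affineOpens) (hW : N.res W ≤ U) =>
    hz.exists_isGlued j N W fun p hp => hV p (hW hp)
  obtain ⟨x, ⟨-, hx⟩, -⟩ := hQ U d s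
    (fun N W hW => (hs N W hW).mem_qSymDeg j (fun p hp => hV p (hW hp)) hd)
    (fun N P g W W' e h => ((hs P W h).qSymMap j g e).ext j (hs N W' _)
      fun p hp => hV p (((res_le g e).trans h) hp))
  refine ⟨x, fun t => (hx M (V t).1 (V t).2).trans ?_⟩
  have h1 := hs M (V t).1 (V t).2 t (V t).1 le_rfl le_rfl
  rwa [qSymRes_self, cmp_eq_qSymRes j M le_rfl, qSymRes_self] at h1

/-- The limit property concerns one degree at a time. For a finite cover only finitely many degrees
occur, so the homogeneous solutions can be summed. -/
lemma exists_toSec_eq [Finite T] {z : ∀ t, M.qSym j (V t).1}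
    (hz : LocallyAgree j M (V := fun t => (V t).1) z) :
    ∃ x : Q.alg.obj U, ∀ t, M.toSec Q (V t) x = z t := by
  classical
  have := Fintype.ofFinite T
  have h1 : ∀ d : ℕ, ∃ x : Q.alg.obj U, ∀ t, M.toSec Q (V t) x =
      DirectSum.decompose (M.qSymDeg j (V t).1) (z t) d := by
    refine fun d => exists_toSec_eq_of_mem_deg hQ V hV (d := d) (fun a b p hp hp' => ?_)
      (fun t => SetLike.coe_mem _)
    obtain ⟨W, h, h', hpW, heq⟩ := hz a b p hp hp'
    refine ⟨W, h, h', hpW, ?_⟩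
    exact (map_decompose (qSymGradedMap j (Hom.id M) (V' := W) h) _ _).trans
      (congr((DirectSum.decompose (M.qSymDeg j W) $heq d).1).trans
      (map_decompose (qSymGradedMap j (Hom.id M) (V' := W) h') _ _).symm)
  choose x hx using h1
  let F : Finset ℕ := Finset.univ.biUnion fun t =>
    DFinsupp.support (DirectSum.decompose (M.qSymDeg j (V t).1) (z t))
  refine ⟨∑ d ∈ F, x d, fun t => ?_⟩
  rw [map_sum, Finset.sum_congr rfl fun d _ => hx d t]
  refine Eq.trans ?_ (DirectSum.sum_support_decompose (M.qSymDeg j (V t).1) (z t))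
  refine (Finset.sum_subset (Finset.subset_biUnion_of_mem (fun t =>
    DFinsupp.support (DirectSum.decompose (M.qSymDeg j (V t).1) (z t))) (Finset.mem_univ t))
    fun d _ hd => ?_).symm
  rw [DFinsupp.notMem_support_iff.mp hd]
  rfl

omit hV in
/-- The projection of the limit to a smooth ambient scheme is an isomorphism. -/
lemma proj_bijective (V : M.scheme.affineOpens) : Function.Bijective (Q.proj M V) := by
  -- Over a trace the single open `V` already is a cover.
  have hcov : ∀ p ∈ (M.res V).1, ∃ _ : PUnit.{u + 1}, p ∈ (M.res V).1 := fun p hp => ⟨⟨⟩, hp⟩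
  constructor
  · intro x y hxy
    refine eq_of_toSec_eq hQ (fun _ : PUnit.{u + 1} => (⟨V, le_rfl⟩ : M.OpensIn (M.res V))) hcov
      fun _ => ?_
    rw [toSec_self, toSec_self, hxy]
  · intro z
    obtain ⟨x, hx⟩ := exists_toSec_eq hQ
      (fun _ : PUnit.{u + 1} => (⟨V, le_rfl⟩ : M.OpensIn (M.res V))) hcov (z := fun _ => z)
      fun _ _ p hp _ => ⟨V, le_rfl, le_rfl, hp, rfl⟩
    exact ⟨x, (toSec_self V x).symm.trans (hx ⟨⟩)⟩

end Limit

end Ambient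

end QSymBlowUp

namespace QSymBlowUp

open Scheme QSym

namespace Ambient

variable {k : Type u} [Field k] {X Y : Scheme.{u}} {sX : X ⟶ Spec (.of k)}
  {j : Y ⟶ X} [IsClosedImmersion j] {M : Ambient sX}

/-! ### Quasi-coherence of the limit -/

/-- An affine open of `X` need not be a trace; it is covered by opens that are at once basic in it
and traces from `M`. -/
lemma exists_basicOpen_mem (M : Ambient sX) (U : X.affineOpens) {p : X} (hp : p ∈ U.1) :
    ∃ (g : Γ(X, U.1)) (V : M.OpensIn U), (M.res V.1).1 = X.basicOpen g ∧ p ∈ X.basicOpen g := by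
  obtain ⟨V, hV⟩ := M.exists_opensIn U hp
  obtain ⟨g, g', hg, hpg⟩ := exists_basicOpen_le_affine_inter U.2 (M.res V.1).2 p ⟨hp, hV⟩
  obtain ⟨g', rfl⟩ := M.resHom_surjective V.1 g'
  have h1 := (M.res_affineBasicOpen V.1 g').trans hg.symm
  exact ⟨g, ⟨M.scheme.affineBasicOpen g', h1.le.trans (X.basicOpen_le g)⟩, h1, hpg⟩

lemma exists_finite_cover (M : Ambient sX) (U : X.affineOpens) :
    ∃ (T : Type u) (_ : Finite T) (V : T → M.OpensIn U) (g : T → Γ(X, U.1)),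
      (∀ t, (M.res (V t).1).1 = X.basicOpen (g t)) ∧ ∀ p ∈ U.1, ∃ t, p ∈ (M.res (V t).1).1 := by
  choose g V hV hg using fun p : U.1 => M.exists_basicOpen_mem U p.2
  obtain ⟨s, hs⟩ := U.2.isCompact.elim_finite_subcover
    (fun p : U.1 => ((X.basicOpen (g p) : X.Opens) : Set X))
    (fun p => (X.basicOpen (g p)).2)
    (fun p hp => Set.mem_iUnion.mpr ⟨⟨p, hp⟩, hg _⟩)
  refine ⟨s, inferInstance, fun t => V t, fun t => g t, fun t => hV t, fun p hp => ?_⟩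
  obtain ⟨t, ht⟩ := Set.mem_iUnion.mp (hs hp)
  obtain ⟨hts, hpt⟩ := Set.mem_iUnion.mp ht
  exact ⟨⟨t, hts⟩, (hV t).ge hpt⟩

/-- The structure map to the sections over an affine open of `M`. -/
def secStr (j : Y ⟶ X) [IsClosedImmersion j] {U : X.affineOpens} (V : M.OpensIn U) :
    Γ(X, U.1) →+* M.qSym j V.1 :=
  (M.qSymStr j V.1).comp (X.presheaf.map (homOfLE V.2).op).hom

lemma qSymRes_secStr {U U' : X.affineOpens} (V : M.OpensIn U) (V' : M.OpensIn U')
    (hU : U' ≤ U) (h : V'.1 ≤ V.1) (r : Γ(X, U.1)) :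
    M.qSymRes j h (secStr j V r) = secStr j V' (X.presheaf.map (homOfLE hU).op r) :=
  (qSymMap_qSymStr j (Hom.id M) h _).trans congr(M.qSymStr j V'.1
    $((presheaf_map_map _ _ r).trans (presheaf_map_map hU V'.2 r).symm))

/-- The restriction of `f` lifts to a function on `V`, whose basic open has trace `V ∩ X ∩ D(f)`.
The last two clauses express that restriction to it inverts `f`. -/
lemma exists_opensIn_basicOpen (j : Y ⟶ X) [IsClosedImmersion j] {U : X.affineOpens}
    (V : M.OpensIn U) (f : Γ(X, U.1)) :
    ∃ (V' : M.OpensIn (X.affineBasicOpen f)) (h : V'.1 ≤ V.1),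
      (∀ p ∈ (M.res V.1).1, p ∈ X.basicOpen f → p ∈ (M.res V'.1).1) ∧
      (∀ c, ∃ (n : ℕ) (x : M.qSym j V.1),
        M.qSymRes j h (secStr j V f) ^ n * c = M.qSymRes j h x) ∧
      ∀ x y : M.qSym j V.1, M.qSymRes j h x = M.qSymRes j h y →
        ∃ n : ℕ, secStr j V f ^ n * x = secStr j V f ^ n * y := by
  obtain ⟨f', hf'⟩ := M.resHom_surjective V.1 ((X.presheaf.map (homOfLE V.2).op).hom f)
  have h1 : (M.res (M.scheme.affineBasicOpen f')).1 = (M.res V.1).1 ⊓ X.basicOpen f := by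
    refine (M.res_affineBasicOpen V.1 f').trans ?_
    rw [hf']
    exact Scheme.basicOpen_res _ _ _
  have h2 : secStr j V f = M.qSymStr j V.1 (M.resHom V.1 f') := congr(M.qSymStr j V.1 $hf'.symm)
  refine ⟨⟨M.scheme.affineBasicOpen f', h1.le.trans inf_le_right⟩, M.scheme.affineBasicOpen_le f',
    fun p hp hp' => h1.ge ⟨hp, hp'⟩, ?_, ?_⟩
  · rw [h2]
    exact M.exists_pow_mul_qSymRes_eq j V.1 f'
  · rw [h2]
    exact M.exists_pow_mul_eq_of_qSymRes_eq j V.1 f'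

variable {Q : QSymCone sX j} [Smooth M.str]

lemma cmp_qSymRes {N : Ambient sX} {V V₁ : M.scheme.affineOpens} {W : N.scheme.affineOpens}
    (e : N.res W ≤ M.res V) (e₁ : N.res W ≤ M.res V₁) (h : V₁ ≤ V) (x : M.qSym j V) :
    M.cmp j e₁ (M.qSymRes j h x) = M.cmp j e x :=
  (qSymRes_cmp j M e e₁ h le_rfl x).symm.trans (N.qSymRes_self j le_rfl _)

/-- The opens are related only through their traces, so the equality is checked on affine opens of
`M` contained in both. -/
lemma cmp_toSec {U : X.affineOpens} (V V' : M.OpensIn U) (e : M.res V'.1 ≤ M.res V.1)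
    (x : Q.alg.obj U) : M.cmp j e (M.toSec Q V x) = M.toSec Q V' x := by
  refine M.qSym_ext j fun p hp => ?_
  obtain ⟨W, h, h', hpW⟩ := exists_affineOpens_le_inf V.1 V'.1 (x := M.ι p) (e hp) hp
  have hWU : M.res W ≤ U := le_trans (fun _ hx => h hx) V.2
  refine ⟨W, h', hpW, ?_⟩
  rw [qSymRes_cmp j M e le_rfl h h', qSymRes_toSec V ⟨W, hWU⟩ h, qSymRes_toSec V' ⟨W, hWU⟩ h',
    cmp_eq_qSymRes j M le_rfl, qSymRes_self]

variable (hQ : Q.IsLimit)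

include M hQ

/-- Over each member of a finite cover some power of `f` kills the difference; the sum of the
exponents serves for all. -/
lemma exists_pow_mul_eq_of_map_eq {U : X.affineOpens} (f : Γ(X, U.1)) {x y : Q.alg.obj U}
    (h : Q.alg.map (X.affineBasicOpen_le f) x = Q.alg.map (X.affineBasicOpen_le f) y) :
    ∃ n : ℕ, Q.alg.str U f ^ n * x = Q.alg.str U f ^ n * y := by
  obtain ⟨T, _, V, g, -, hcov⟩ := M.exists_finite_cover U
  have := Fintype.ofFinite T
  have h1 : ∀ t, ∃ n : ℕ, secStr j (V t) f ^ n * M.toSec Q (V t) x =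
      secStr j (V t) f ^ n * M.toSec Q (V t) y := fun t => by
    obtain ⟨V', hV', -, -, H⟩ := exists_opensIn_basicOpen j (V t) f
    refine H _ _ ?_
    rw [qSymRes_toSec (V t) ⟨V'.1, V'.2.trans (X.affineBasicOpen_le f)⟩ hV',
      qSymRes_toSec (V t) ⟨V'.1, V'.2.trans (X.affineBasicOpen_le f)⟩ hV',
      ← toSec_map (X.affineBasicOpen_le f) V', h, toSec_map]
  choose n hn using h1
  refine ⟨∑ t, n t, eq_of_toSec_eq hQ V hcov fun t => ?_⟩
  obtain ⟨a, ha⟩ := Nat.exists_eq_add_of_le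
    (Finset.single_le_sum (f := n) (fun _ _ => Nat.zero_le _) (Finset.mem_univ t))
  have h2 : M.toSec Q (V t) (Q.alg.str U f) = secStr j (V t) f := toSec_str (V t) f
  rw [map_mul, map_mul, map_pow, h2, ha, add_comm, pow_add, mul_assoc, mul_assoc, hn]

/-- The standard extension argument: after multiplication by a power of `f`, the section extends
over every member of a finite cover. The extensions agree on overlaps up to a further power of `f`,
and then they glue. -/
lemma exists_pow_mul_eq_map {U : X.affineOpens} (f : Γ(X, U.1))
    (c : Q.alg.obj (X.affineBasicOpen f)) : ∃ (n : ℕ) (x : Q.alg.obj U),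
      Q.alg.map (X.affineBasicOpen_le f) (Q.alg.str U f) ^ n * c =
        Q.alg.map (X.affineBasicOpen_le f) x := by
  obtain ⟨T, _, V, g, hg, hcov⟩ := M.exists_finite_cover U
  have := Fintype.ofFinite T
  have hle := X.affineBasicOpen_le f
  let σ : Q.alg.obj (X.affineBasicOpen f) := Q.alg.map hle (Q.alg.str U f)
  choose V' hV' hp' hsurj hinj using fun t => exists_opensIn_basicOpen j (V t) f
  have hσ : ∀ t, M.toSec Q (V' t) σ = M.qSymRes j (hV' t) (secStr j (V t) f) := fun t => by
    rw [qSymRes_secStr (V t) (V' t) hle (hV' t)]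
    exact congr(M.toSec Q (V' t) $(Q.alg.map_str hle f)).trans (toSec_str (V' t) _)
  choose n₀ x₀ hx₀ using fun t => hsurj t (M.toSec Q (V' t) c)
  let n : ℕ := ∑ t, n₀ t
  have hx : ∀ t, ∃ x : M.qSym j (V t).1,
      M.toSec Q (V' t) (σ ^ n * c) = M.qSymRes j (hV' t) x := fun t => by
    obtain ⟨a, ha⟩ := Nat.exists_eq_add_of_le
      (Finset.single_le_sum (f := n₀) (fun _ _ => Nat.zero_le _) (Finset.mem_univ t))
    refine ⟨secStr j (V t) f ^ a * x₀ t, ?_⟩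
    rw [map_mul, map_mul, ← hx₀, map_pow, map_pow, hσ, ← mul_assoc, ← pow_add, add_comm a, ← ha]
  choose x hx using hx
  -- The intersection of `V t` and `V s` need not be affine. In its place stands a basic open of `V
  -- t` with trace in that of `V s`; it need not lie in `V s`, so `x s` is brought there by the
  -- comparison map.
  choose W hW hpW _ _ using fun t s => exists_opensIn_basicOpen j (V t) (g s)
  have e : ∀ t s, M.res (W t s).1 ≤ M.res (V s).1 := fun t s => (W t s).2.trans (hg s).ge
  let W₁ : T → T → M.OpensIn U := fun t s => ⟨(W t s).1, (e t s).trans (V s).2⟩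
  have hm : ∀ t s, ∃ m : ℕ, secStr j (W₁ t s) f ^ m * M.qSymRes j (hW t s) (x t) =
      secStr j (W₁ t s) f ^ m * M.cmp j (e t s) (x s) := fun t s => by
    obtain ⟨W', hW', -, -, H⟩ := exists_opensIn_basicOpen j (W₁ t s) f
    -- Where `f` is inverted, every extension `x r` becomes the section of `σ ^ n * c`; so any two
    -- agree up to a power of `f`.
    have key : ∀ r (hr : M.res W'.1 ≤ M.res (V r).1), M.cmp j hr (x r) =
        M.toSec Q W' (σ ^ n * c) := fun r hr => by
      have hr' : M.res W'.1 ≤ M.res (V' r).1 := fun p hp => hp' r p (hr hp) (W'.2 hp)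
      rw [← cmp_qSymRes hr hr' (hV' r), ← hx, cmp_toSec]
    have hs : M.res W'.1 ≤ M.res (V s).1 := le_trans (fun _ hx => hW' hx) (e t s)
    have ht : M.res W'.1 ≤ M.res (V t).1 := fun _ hx => hW t s (hW' hx)
    refine H _ _ (Eq.trans ?_ (((key t ht).trans (key s hs).symm).trans ?_))
    · exact (M.qSymRes_qSymRes j _ _ _).trans (cmp_eq_qSymRes j M _ ht _).symm
    · exact ((qSymRes_cmp j M (e t s) hs le_rfl hW' (x s)).trans
        congr(M.cmp j hs $(M.qSymRes_self j le_rfl (x s)))).symm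
  choose m₀ hm₀ using hm
  let m : ℕ := ∑ t, ∑ s, m₀ t s
  have hm : ∀ t s, secStr j (W₁ t s) f ^ m * M.qSymRes j (hW t s) (x t) =
      secStr j (W₁ t s) f ^ m * M.cmp j (e t s) (x s) := fun t s => by
    obtain ⟨a, ha⟩ := Nat.exists_eq_add_of_le ((Finset.single_le_sum (f := fun s => m₀ t s)
      (fun _ _ => Nat.zero_le _) (Finset.mem_univ s)).trans
      (Finset.single_le_sum (f := fun t => ∑ s, m₀ t s) (fun _ _ => Nat.zero_le _)
      (Finset.mem_univ t)))
    have ha' : m = a + m₀ t s := ha.trans (add_comm _ _)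
    rw [ha', pow_add, mul_assoc, mul_assoc, hm₀]
  have hz : LocallyAgree j M (V := fun t => (V t).1) fun t => secStr j (V t) f ^ m * x t := by
    intro t s p hp hp₁
    obtain ⟨W', h, h', hpW'⟩ := exists_affineOpens_le_inf (W t s).1 (V s).1 (x := M.ι p)
      (hpW t s p hp ((hg s).le hp₁)) hp₁
    have hts : W' ≤ (V t).1 := h.trans (hW t s)
    have hWs : M.res W' ≤ M.res (V s).1 := fun _ hx => h' hx
    have hWU : M.res W' ≤ U := hWs.trans (V s).2
    have hrs : ∀ (V₁ : M.OpensIn U) (h : W' ≤ V₁.1),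
        M.qSymRes j h (secStr j V₁ f) = secStr j (⟨W', hWU⟩ : M.OpensIn U)
          (X.presheaf.map (homOfLE (le_refl U.1)).op f) := fun V₁ h =>
      qSymRes_secStr V₁ ⟨W', hWU⟩ le_rfl h f
    refine ⟨W', hts, h', hpW', ?_⟩
    have h1 := congr(M.qSymRes j h $(hm t s))
    rw [map_mul, map_mul, map_pow, hrs (W₁ t s) h, qSymRes_qSymRes,
      qSymRes_cmp j M (e t s) hWs le_rfl h, qSymRes_self, cmp_eq_qSymRes j M h'] at h1
    rw [map_mul, map_mul, map_pow, map_pow, hrs (V t) hts, hrs (V s) h']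
    exact h1
  obtain ⟨y, hy⟩ := exists_toSec_eq hQ V hcov hz
  refine ⟨m + n, y, eq_of_toSec_eq hQ V' (fun p hp => ?_) fun t => ?_⟩
  · obtain ⟨t, ht⟩ := hcov p (hle hp)
    exact ⟨t, hp' t p ht hp⟩
  · rw [toSec_map hle, ← qSymRes_toSec (V t) ⟨(V' t).1, (V' t).2.trans hle⟩ (hV' t), hy]
    refine Eq.trans ?_ (map_mul (M.qSymRes j (hV' t)) _ _).symm
    rw [← hx, map_pow (M.qSymRes j (hV' t)), ← hσ, ← map_pow (M.toSec Q (V' t)),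
      ← map_mul (M.toSec Q (V' t)), ← mul_assoc, ← pow_add]

/-- The limit is quasi-coherent. -/
lemma isQuasiCoherent_of_isLimit : Q.alg.IsQuasiCoherent := by
  intro U f
  letI := (Q.alg.map (X.affineBasicOpen_le f) :
    Q.alg.obj U →+* Q.alg.obj (X.affineBasicOpen f)).toAlgebra
  have hunit : IsUnit (Q.alg.map (X.affineBasicOpen_le f) (Q.alg.str U f)) := by
    rw [Q.alg.map_str]
    exact (RingedSpace.isUnit_res_basicOpen _ f).map (Q.alg.str (X.affineBasicOpen f))
  refine ⟨?_, fun c => ?_, fun {x y} hxy => ?_⟩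
  · rintro ⟨_, n, rfl⟩
    rw [map_pow]
    exact hunit.pow n
  · obtain ⟨n, x, hx⟩ := exists_pow_mul_eq_map (M := M) hQ f c
    refine ⟨⟨x, ⟨_, n, rfl⟩⟩, (mul_comm _ _).trans (Eq.trans ?_ hx)⟩
    exact congr($(map_pow (Q.alg.map (X.affineBasicOpen_le f)) (Q.alg.str U f) n) * c)
  · obtain ⟨n, hn⟩ := exists_pow_mul_eq_of_map_eq (M := M) hQ f hxy
    exact ⟨⟨_, n, rfl⟩, hn⟩

/-! ### The map from the Rees algebra to the limit -/

omit hQ [Smooth M.str] in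
lemma reesToQSym_mem_deg (V : M.scheme.affineOpens) {d : ℕ}
    {x : reesAlgebra ((j ≫ M.ι).ker.ideal V)} (hx : x ∈ reesDeg _ d) :
    M.reesToQSym j V x ∈ M.qSymDeg j V d := by
  have h := QSym.deg_eq_map (h := (M.ideal_eq_comap j V).le) (M.resHom_surjective V)
    (M.ideal_eq_comap j V) d
  exact h.ge ⟨x, hx, rfl⟩

omit hQ [Smooth M.str] in
lemma reesToQSym_surjective (V : M.scheme.affineOpens) :
    Function.Surjective (M.reesToQSym j V) :=
  QSym.inr_surjective (M.resHom_surjective V) (M.ideal_eq_comap j V)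

omit hQ [Smooth M.str] in
lemma qSymRes_reesToQSym {V V' : M.scheme.affineOpens} (h : V' ≤ V)
    (x : reesAlgebra ((j ≫ M.ι).ker.ideal V)) :
    M.qSymRes j h (M.reesToQSym j V x) =
      M.reesToQSym j V' ((reesAlg (j ≫ M.ι).ker).map (U := V) (V := V') h x) := by
  refine (QSym.map_inr _ _ (resHom_comp (Hom.id M) h) _ _ x).trans congr(M.reesToQSym j V' $(Subtype.ext ?_))
  refine congr(Polynomial.map (CommRingCat.Hom.hom $(?_)) x.1)
  exact id_appLE _

/-- The map from the Rees algebra to the limit. -/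
def reesToLimit (V : M.scheme.affineOpens) :
    reesDeg ((j ≫ M.ι).ker.ideal V) →+*ᵍ Q.alg.deg (M.res V) where
  __ := (RingEquiv.ofBijective _ (proj_bijective hQ V)).symm.toRingHom.comp (M.reesToQSym j V)
  map_mem {d x} hx := by
    let e := RingEquiv.ofBijective (Q.proj M V) (proj_bijective hQ V)
    change e.symm (M.reesToQSym j V x) ∈ _
    -- The inverse of a bijective graded map is graded: the image is compared with its own degree
    -- `d` component after projecting.
    have h1 : e.symm (M.reesToQSym j V x) =
        DirectSum.decompose (Q.alg.deg (M.res V)) (e.symm (M.reesToQSym j V x)) d := by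
      refine (proj_bijective hQ V).1 ?_
      let π : Q.alg.deg (M.res V) →+*ᵍ M.qSymDeg j V :=
        { __ := Q.proj M V, map_mem := fun hx => Q.proj_mem M V _ _ hx }
      refine Eq.trans ?_ (map_decompose π _ _).symm
      have h2 : π (e.symm (M.reesToQSym j V x)) = M.reesToQSym j V x := e.apply_symm_apply _
      rw [h2, DirectSum.decompose_of_mem_same _ (reesToQSym_mem_deg V hx)]
      exact h2
    rw [h1]
    exact SetLike.coe_mem _

lemma proj_reesToLimit (V : M.scheme.affineOpens) (x : reesAlgebra ((j ≫ M.ι).ker.ideal V)) :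
    Q.proj M V (reesToLimit hQ V x) = M.reesToQSym j V x :=
  (RingEquiv.ofBijective _ (proj_bijective hQ V)).apply_symm_apply _

lemma reesToLimit_surjective (V : M.scheme.affineOpens) :
    Function.Surjective (reesToLimit (M := M) hQ V) := fun y => by
  obtain ⟨x, hx⟩ := reesToQSym_surjective V (Q.proj M V y)
  exact ⟨x, (proj_bijective hQ V).1 ((proj_reesToLimit hQ V x).trans hx)⟩

lemma reesToLimit_reesMonomial_eq_zero_iff (V : M.scheme.affineOpens) {d : ℕ}
    {x : Γ(M.scheme, V.1)} (hx : x ∈ (j ≫ M.ι).ker.ideal V ^ d) :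
    reesToLimit hQ V (reesMonomial ((j ≫ M.ι).ker.ideal V) d x hx) = 0 ↔
      x ∈ M.ι.ker.ideal V * (j ≫ M.ι).ker.ideal V ^ (d - 1) := by
  have h1 : M.ι.ker.ideal V = RingHom.ker (M.resHom V) := Scheme.Hom.ker_apply M.ι V
  rw [h1, ← QSym.inr_reesMonomial_eq_zero_iff (h := (M.ideal_eq_comap j V).le)
    (M.resHom_surjective V) (M.ideal_eq_comap j V) (hx := hx),
    ← (proj_bijective hQ V).1.eq_iff, map_zero, proj_reesToLimit]
  rfl

/-- Degree zero compatibility, needed for the induced morphism to lie over `X → M`. -/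
lemma reesToLimit_algebraMap (V : M.scheme.affineOpens) (r : Γ(M.scheme, V.1)) :
    reesToLimit (M := M) hQ V (algebraMap _ _ r) = Q.alg.str (M.res V) (M.resHom V r) :=
  (proj_bijective hQ V).1 ((proj_reesToLimit hQ V _).trans
    ((QSym.inr_algebraMap r).trans (Q.proj_str M V _).symm))

lemma map_reesToLimit {V V' : M.scheme.affineOpens} (h : V' ≤ V) (e : M.res V' ≤ M.res V)
    (x : reesAlgebra ((j ≫ M.ι).ker.ideal V)) :
    Q.alg.map e (reesToLimit hQ V x) =
      reesToLimit hQ V' ((reesAlg (j ≫ M.ι).ker).map (U := V) (V := V') h x) := by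
  refine (proj_bijective hQ V').1 ?_
  refine (Q.qSymMap_proj (Hom.id M) h _).symm.trans (Eq.trans ?_ (proj_reesToLimit hQ V' _).symm)
  exact congr(M.qSymRes j h $(proj_reesToLimit hQ V x)).trans (qSymRes_reesToQSym h x)

end Ambient

end QSymBlowUp

namespace QSymBlowUp

open Limits HomogeneousLocalization HomogeneousIdeal Scheme

/-! ### Morphisms between relative `Proj`s -/

section ProjMap

variable {A B : Type u} [CommRing A] [CommRing B] {𝒜 : ℕ → AddSubgroup A} {ℬ : ℕ → AddSubgroup B}
  [GradedRing 𝒜] [GradedRing ℬ]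

lemma exists_mem_deg_of_surjective (ψ : 𝒜 →+*ᵍ ℬ) (hs : Function.Surjective ψ) {d : ℕ} {b : B}
    (hb : b ∈ ℬ d) : ∃ a ∈ 𝒜 d, ψ a = b := by
  obtain ⟨a, rfl⟩ := hs b
  refine ⟨DirectSum.decompose 𝒜 a d, SetLike.coe_mem _, ?_⟩
  rw [map_decompose ψ, DirectSum.decompose_of_mem_same _ hb]

lemma awayMap_surjective (ψ : 𝒜 →+*ᵍ ℬ) (hψ : Function.Surjective ψ) {d : ℕ} {s : A}
    (hs : s ∈ 𝒜 d) : Function.Surjective (Away.map ψ s) := fun z => by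
  obtain ⟨n, b, hb, rfl⟩ := Away.mk_surjective ℬ (ψ.2 hs) z
  obtain ⟨a, ha, rfl⟩ := exists_mem_deg_of_surjective ψ hψ hb
  exact ⟨Away.mk 𝒜 hs n a ha, Away.map_mk ψ s hs n a ha⟩

lemma isClosedImmersion_projMap (ψ : 𝒜 →+*ᵍ ℬ) (hψ : irrelevant ℬ ≤ (irrelevant 𝒜).map ψ)
    (hs : Function.Surjective ψ) : IsClosedImmersion (Proj.map ψ hψ) := by
  refine (IsZariskiLocalAtTarget.iff_of_openCover (P := @IsClosedImmersion)
    (Proj.affineOpenCover 𝒜).openCover).mpr fun s => ?_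
  have h := isPullback_awayι ψ hψ s.1.2 s.2.2
  refine (MorphismProperty.cancel_left_of_respectsIso @IsClosedImmersion
    h.flip.isoPullback.hom _).mp ?_
  have h2 : h.flip.isoPullback.hom ≫
    Scheme.Cover.pullbackHom (Proj.affineOpenCover 𝒜).openCover (Proj.map ψ hψ) s = _ :=
      h.flip.isoPullback_hom_snd
  exact h2.symm ▸ IsClosedImmersion.spec_of_surjective
    (CommRingCat.ofHom (Away.map ψ (s.2 : A))) (awayMap_surjective ψ hs s.2.2)

end ProjMap

/-! ### Closed immersions of relative `Proj`s over a closed embedding. -/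

namespace GradedAlg

variable {X : Scheme.{u}} {𝒜 : GradedAlg X} (hQ : 𝒜.IsQuasiCoherent)

lemma relProj.range_ι (U : X.affineOpens) :
    relProj.toBase hQ ⁻¹ᵁ U.1 = (relProj.ι hQ U).opensRange :=
  congr(relProj.toBase hQ ⁻¹ᵁ $((Scheme.Opens.opensRange_ι U.1).symm)).trans
    ((projGluingData hQ).toBase_preimage_eq_opensRange_ι (⟨U.1, U.2⟩ : AffineZariskiSite X))

lemma relProj.mem_range_ι {U : X.affineOpens} {z : relProj hQ} :
    z ∈ Set.range (relProj.ι hQ U) ↔ relProj.toBase hQ z ∈ U.1 :=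
  (SetLike.ext_iff.mp (relProj.range_ι hQ U) z).symm

lemma relProj.exists_mem_range_ι (z : relProj hQ) :
    ∃ U : X.affineOpens, z ∈ Set.range (relProj.ι hQ U) := by
  obtain ⟨U, hU⟩ := TopologicalSpace.Opens.mem_iSup.mp
    ((iSup_affineOpens_eq_top X).ge (Set.mem_univ (relProj.toBase hQ z)))
  exact ⟨U, (relProj.mem_range_ι hQ).mpr hU⟩

/-- The gluing datum is indexed by the small affine Zariski site, whose order relation is that of
basic opens; transition maps are therefore taken only along these. -/
lemma relProj.map_ι {U V : X.affineOpens} (f : Γ(X, V.1)) (h : U ≤ V) (hU : U.1 = X.basicOpen f) :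
    ∃ h' : irrelevant (𝒜.deg U) ≤ (irrelevant (𝒜.deg V)).map (𝒜.map h),
      Proj.map (𝒜.map h) h' ≫ relProj.ι hQ V = relProj.ι hQ U := by
  let U' : AffineZariskiSite X := ⟨U.1, U.2⟩
  let V' : AffineZariskiSite X := ⟨V.1, V.2⟩
  have hle : U' ≤ V' := ⟨f, hU.symm⟩
  have hom : U' ⟶ V' := homOfLE hle
  exact ⟨irrelevant_le hQ hle, (projGluingData hQ).cover.trans_map (i := U') (j := V') hom⟩

variable {k : Type u} [Field k] {sX : X ⟶ Spec (.of k)} {M : Ambient sX} {ℬ : GradedAlg M.scheme}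
  (hℬ : ℬ.IsQuasiCoherent)

lemma relProj.preimage_range_le {e : relProj hQ ⟶ relProj hℬ}
    (he : e ≫ relProj.toBase hℬ = relProj.toBase hQ ≫ M.ι) (V : M.scheme.affineOpens) :
    e ⁻¹ᵁ (relProj.ι hℬ V).opensRange ≤ (relProj.ι hQ (M.res V)).opensRange := by
  intro z hz
  have h1 : e z ∈ Set.range (relProj.ι hℬ V) := hz
  have h2 : (e ≫ relProj.toBase hℬ) z ∈ V.1 := (relProj.mem_range_ι hℬ).mp h1
  rw [he] at h2
  exact (relProj.mem_range_ι (U := M.res V) hQ).mpr h2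

/-- Compatible surjections of graded algebras induce a closed immersion of relative `Proj`s. -/
lemma relProj.exists_closedImmersion (φ : ∀ V : M.scheme.affineOpens, ℬ.deg V →+*ᵍ 𝒜.deg (M.res V))
    (hφ : ∀ V, Function.Surjective (φ V))
    (hmap : ∀ {V V' : M.scheme.affineOpens} (h : V' ≤ V) (e : M.res V' ≤ M.res V) (x : ℬ.obj V),
      𝒜.map e (φ V x) = φ V' (ℬ.map h x))
    (hstr : ∀ (V : M.scheme.affineOpens) (r : Γ(M.scheme, V.1)),
      φ V (ℬ.str V r) = 𝒜.str (M.res V) (M.resHom V r)) :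
    ∃ e : relProj hQ ⟶ relProj hℬ, IsClosedImmersion e ∧
      e ≫ relProj.toBase hℬ = relProj.toBase hQ ≫ M.ι ∧
      ∀ V : M.scheme.affineOpens,
        Proj.map (φ V) (irrelevant_le_of_surjective (φ V) (hφ V)) ≫ relProj.ι hℬ V =
          relProj.ι hQ (M.res V) ≫ e := by
  have hmem : ∀ (V : M.scheme.affineOpens) (z : relProj hQ),
      z ∈ Set.range (relProj.ι hQ (M.res V)) ↔ M.ι (relProj.toBase hQ z) ∈ V.1 :=
    fun V z => relProj.mem_range_ι hQ
  have hres : ∀ (V : M.scheme.affineOpens) (f : Γ(M.scheme, V.1)) (V' : M.scheme.affineOpens),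
      V'.1 = M.scheme.basicOpen f → (M.res V').1 = X.basicOpen (M.resHom V f) := by
    intro V f V' h
    exact congr(M.ι ⁻¹ᵁ $h).trans (Scheme.preimage_basicOpen M.ι f)
  have hle : ∀ (V' V : M.scheme.affineOpens) (f : Γ(M.scheme, V.1)),
      V'.1 = M.scheme.basicOpen f → V' ≤ V := fun V' V f h => h.le.trans (M.scheme.basicOpen_le f)
  have hle' : ∀ {V' V : M.scheme.affineOpens}, V' ≤ V → M.res V' ≤ M.res V := fun h _ hx => h hx
  -- Gluing proceeds along basic opens only: their traces on `X` are again basic opens, so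
  -- `relProj.map_ι` is available on both sides.
  let r : M.scheme.affineOpens → M.scheme.affineOpens → Prop := fun V' V =>
    ∃ f : Γ(M.scheme, V.1), V'.1 = M.scheme.basicOpen f
  have hr : ∀ V' V, r V' V → V' ≤ V := fun V' V h => hle V' V h.choose h.choose_spec
  have key : ∀ V' V (h : r V' V), ∃ p : Proj (𝒜.deg (M.res V')) ⟶ Proj (𝒜.deg (M.res V)),
      p ≫ relProj.ι hQ (M.res V) = relProj.ι hQ (M.res V') ∧
      p ≫ Proj.map (φ V) (irrelevant_le_of_surjective (φ V) (hφ V)) ≫ relProj.ι hℬ V =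
        Proj.map (φ V') (irrelevant_le_of_surjective (φ V') (hφ V')) ≫ relProj.ι hℬ V' := by
    intro V' V h
    obtain ⟨f, hf⟩ := id h
    obtain ⟨h1, h2⟩ := relProj.map_ι hQ (M.resHom V f) (hle' (hr V' V h)) (hres V f V' hf)
    obtain ⟨h3, h4⟩ := relProj.map_ι hℬ f (hr V' V h) hf
    refine ⟨_, h2, ?_⟩
    rw [← h4, ← Category.assoc, ← Category.assoc]
    congr 1
    have h5 : irrelevant (𝒜.deg (M.res V')) ≤
        (irrelevant (ℬ.deg V)).map ((𝒜.map (hle' (hr V' V h))).comp (φ V)) := by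
      rw [← HomogeneousIdeal.map_map]
      exact h1.trans (HomogeneousIdeal.map_mono _ (irrelevant_le_of_surjective (φ V) (hφ V)))
    exact (projMap_eq_comp _ _ _ _ ((𝒜.map (hle' (hr V' V h))).comp (φ V)) h5
      fun x => rfl).symm.trans (projMap_eq_comp _ _ _ _ _ h5 fun x => hmap _ _ x)
  choose p hp hpφ using key
  obtain ⟨e, he⟩ := exists_glue_of_isOpenImmersion (fun V => relProj.ι hQ (M.res V))
    (fun z => by
      obtain ⟨V, hV⟩ := TopologicalSpace.Opens.mem_iSup.mp
        ((iSup_affineOpens_eq_top M.scheme).ge (Set.mem_univ (M.ι (relProj.toBase hQ z))))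
      exact ⟨V, (hmem V z).mpr hV⟩) r p hp
    (fun V V' z hz hz' => by
      obtain ⟨f, g, hfg, hzf⟩ := exists_basicOpen_le_affine_inter V.2 V'.2 _
        ⟨(hmem V z).mp hz, (hmem V' z).mp hz'⟩
      exact ⟨M.scheme.affineBasicOpen f, ⟨f, rfl⟩, ⟨g, hfg⟩, (hmem _ z).mpr hzf⟩)
    (fun V => Proj.map (φ V) (irrelevant_le_of_surjective (φ V) (hφ V)) ≫ relProj.ι hℬ V) hpφ
  have hbase : e ≫ relProj.toBase hℬ = relProj.toBase hQ ≫ M.ι := by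
    let 𝒰 : (relProj hQ).OpenCover :=
      { I₀ := M.scheme.affineOpens
        X := fun V => Proj (𝒜.deg (M.res V))
        f := fun V => relProj.ι hQ (M.res V)
        mem₀ := by
          rw [presieve₀_mem_precoverage_iff]
          refine ⟨fun z => ?_, fun V => inferInstance⟩
          obtain ⟨V, hV⟩ := TopologicalSpace.Opens.mem_iSup.mp
            ((iSup_affineOpens_eq_top M.scheme).ge (Set.mem_univ (M.ι (relProj.toBase hQ z))))
          exact ⟨V, (hmem V z).mpr hV⟩ }
    refine 𝒰.hom_ext _ _ fun V => ?_
    change relProj.ι hQ (M.res V) ≫ e ≫ _ = relProj.ι hQ (M.res V) ≫ _ ≫ _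
    rw [← Category.assoc, he, Category.assoc, relProj.ι_toBase, ← Category.assoc,
      map_projToSpec (φ V) (irrelevant_le_of_surjective (φ V) (hφ V)) (ℬ.str V) (ℬ.str_mem V)
        (𝒜.str (M.res V)) (𝒜.str_mem _) (M.resHom V) (hstr V), Category.assoc,
      ← Category.assoc (relProj.ι hQ (M.res V)), relProj.ι_toBase, Category.assoc]
    congr 1
    have h := V.2.SpecMap_appLE_fromSpec M.ι (M.res V).2 le_rfl
    refine Eq.trans ?_ h
    exact congr(Spec.map $(M.ι.app_eq_appLE) ≫ IsAffineOpen.fromSpec _)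
  refine ⟨e, ?_, hbase, fun V => (he V).symm⟩
  let 𝒰 : (relProj hℬ).OpenCover :=
    { I₀ := M.scheme.affineOpens
      X := fun V => Proj (ℬ.deg V)
      f := fun V => relProj.ι hℬ V
      mem₀ := by
        rw [presieve₀_mem_precoverage_iff]
        exact ⟨fun z => relProj.exists_mem_range_ι hℬ z, fun V => inferInstance⟩ }
  exact isClosedImmersion_of_openCover e 𝒰 (fun V => relProj.ι hQ (M.res V))
    (fun V => Proj.map (φ V) (irrelevant_le_of_surjective (φ V) (hφ V)))
    (fun V => isClosedImmersion_projMap _ _ (hφ V)) he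
    fun V => relProj.preimage_range_le hQ hℬ hbase V

end GradedAlg

end QSymBlowUp

namespace QSymBlowUp

open Limits Scheme

/-! ### Ideal sheaves on affine charts -/

section ChartIdeal

/-- The ideal sheaf on `Spec B` given by an ideal of `B`. -/
def specIdeal {B : Type u} [CommRing B] (𝔟 : Ideal B) : (Spec (.of B)).IdealSheafData :=
  IdealSheafData.ofIdealTop (𝔟.comap (Scheme.ΓSpecIso (.of B)).hom.hom)

lemma ker_specMap {B C : Type u} [CommRing B] [CommRing C] (σ : B →+* C) :
    (Spec.map (CommRingCat.ofHom σ)).ker = specIdeal (RingHom.ker σ) := by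
  refine (ker_of_isAffine _).trans congr(IdealSheafData.ofIdealTop $(?_))
  ext x
  have h := congr(($(Scheme.ΓSpecIso_naturality (CommRingCat.ofHom σ))).hom x)
  change (Spec.map (CommRingCat.ofHom σ)).appTop.hom x = 0 ↔
    σ ((Scheme.ΓSpecIso (.of B)).hom.hom x) = 0
  have h' : (Scheme.ΓSpecIso (.of C)).hom.hom ((Spec.map (CommRingCat.ofHom σ)).appTop.hom x) =
    σ ((Scheme.ΓSpecIso (.of B)).hom.hom x) := h
  rw [← h']
  exact ((map_eq_zero_iff _ (ConcreteCategory.bijective_of_isIso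
    (Scheme.ΓSpecIso (.of C)).hom).1)).symm

lemma ker_specMap_quotient {B : Type u} [CommRing B] (𝔟 : Ideal B) :
    (Spec.map (CommRingCat.ofHom (Ideal.Quotient.mk 𝔟))).ker = specIdeal 𝔟 := by
  rw [ker_specMap, Ideal.mk_ker]

lemma comap_eq_ker_of_isPullback {Z P Z' P' : Scheme.{u}} {t : Z' ⟶ P'} {f : Z' ⟶ Z}
    {g : P' ⟶ P} {e : Z ⟶ P} [IsClosedImmersion e] (h : IsPullback t f g e) :
    e.ker.comap g = t.ker := by
  rw [← IdealSheafData.ker_fst_of_isClosedImmersion, ← h.isoPullback_hom_fst,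
    Hom.ker_comp_of_isIso]

lemma isPushout_quotient {B C : Type u} [CommRing B] [CommRing C] (ρ : B →+* C) (𝔟 : Ideal B) :
    IsPushout (CommRingCat.ofHom ρ) (CommRingCat.ofHom (Ideal.Quotient.mk 𝔟))
      (CommRingCat.ofHom (Ideal.Quotient.mk (𝔟.map ρ)))
      (CommRingCat.ofHom (Ideal.quotientMap (𝔟.map ρ) ρ Ideal.le_comap_map)) := by
  refine ⟨⟨by ext; rfl⟩, ⟨PushoutCocone.IsColimit.mk _ (fun s => CommRingCat.ofHom
    (Ideal.Quotient.lift (𝔟.map ρ) s.inl.hom fun a ha => ?_)) (fun s => ?_) (fun s => ?_)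
    fun s m h _ => ?_⟩⟩
  · have : 𝔟.map ρ ≤ RingHom.ker s.inl.hom := by
      rw [Ideal.map_le_iff_le_comap]
      intro b hb
      have h := congr(($(s.condition)).hom b)
      refine h.trans ?_
      change s.inr.hom (Ideal.Quotient.mk 𝔟 b) = 0
      rw [Ideal.Quotient.eq_zero_iff_mem.mpr hb, map_zero]
    exact this ha
  · ext; rfl
  · ext b
    exact congr(($(s.condition)).hom b)
  · ext c
    exact congr(($h).hom c)

/-- Both ideal sheaves are kernels of closed immersions, and the spectrum of `C` modulo the
extension of `𝔟` is the base change of that of `B ⧸ 𝔟`. -/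
lemma comap_specIdeal {B C : Type u} [CommRing B] [CommRing C] (ρ : B →+* C) (𝔟 : Ideal B) :
    (specIdeal 𝔟).comap (Spec.map (CommRingCat.ofHom ρ)) = specIdeal (𝔟.map ρ) := by
  have : IsClosedImmersion (Spec.map (CommRingCat.ofHom (Ideal.Quotient.mk 𝔟))) :=
    IsClosedImmersion.spec_of_surjective _ Ideal.Quotient.mk_surjective
  rw [← ker_specMap_quotient, ← ker_specMap_quotient]
  exact comap_eq_ker_of_isPullback (isPullback_SpecMap_of_isPushout _ _ _ _ (isPushout_quotient ρ 𝔟))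

lemma ideal_comap_eq_map {P Z : Scheme.{u}} (I : P.IdealSheafData) (f : Z ⟶ P) [IsOpenImmersion f]
    (V : P.affineOpens) (U : Z.affineOpens) (e : U.1 ≤ f ⁻¹ᵁ V.1) :
    (I.comap f).ideal U = (I.ideal V).map (f.appLE V.1 U.1 e).hom := by
  have h : f ''ᵁ U.1 ≤ V.1 := by
    rintro _ ⟨x, hx, rfl⟩
    exact e hx
  have h1 : f.appLE V.1 U.1 e = P.presheaf.map (homOfLE h).op ≫ (f.appIso U.1).hom := by
    rw [Scheme.Hom.appIso_hom', Scheme.Hom.map_appLE]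
  have h2 := I.map_ideal (U := ⟨f ''ᵁ U.1, U.2.image_of_isOpenImmersion f⟩) (V := V) h
  refine (IdealSheafData.ideal_comap_of_isOpenImmersion I f U).trans ?_
  rw [h1, CommRingCat.hom_comp, ← Ideal.map_map]
  refine Eq.trans ?_ congr(Ideal.map (f.appIso U.1).hom.hom $h2.symm)
  exact Ideal.comap_symm (f.appIso U.1).commRingCatIsoToRingEquiv

lemma specIdeal_ideal_top {B : Type u} [CommRing B] (𝔟 : Ideal B) :
    (specIdeal 𝔟).ideal ⟨⊤, isAffineOpen_top _⟩ =
      𝔟.comap (Scheme.ΓSpecIso (.of B)).hom.hom :=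
  IdealSheafData.equivOfIsAffine.apply_symm_apply _

lemma comap_fromSpec {P : Scheme.{u}} (I : P.IdealSheafData) (V : P.affineOpens) :
    I.comap V.2.fromSpec = specIdeal (I.ideal V) := by
  have := V.2.isOpenImmersion_fromSpec
  refine IdealSheafData.ext_of_isAffine ?_
  have e : (⊤ : (Spec Γ(P, V.1)).Opens) ≤ V.2.fromSpec ⁻¹ᵁ V.1 := V.2.fromSpec_preimage_self.ge
  refine (ideal_comap_eq_map I V.2.fromSpec V ⟨⊤, isAffineOpen_top _⟩ e).trans ?_
  have h1 : V.2.fromSpec.appLE V.1 ⊤ e = (Scheme.ΓSpecIso Γ(P, V.1)).inv := by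
    rw [Scheme.Hom.appLE, V.2.fromSpec_app_self, Category.assoc, ← Functor.map_comp]
    exact (congr(_ ≫ $((Spec Γ(P, V.1)).presheaf.map_id _))).trans (Category.comp_id _)
  rw [h1]
  refine Eq.trans ?_ (specIdeal_ideal_top _).symm
  exact Ideal.map_symm (Scheme.ΓSpecIso Γ(P, V.1)).commRingCatIsoToRingEquiv

/-- The affine open given by an affine chart. -/
def chartOpen {P : Scheme.{u}} {B : Type u} [CommRing B] (g : Spec (.of B) ⟶ P)
    [IsOpenImmersion g] : P.affineOpens :=
  ⟨g ''ᵁ ⊤, (isAffineOpen_top _).image_of_isOpenImmersion g⟩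

/-- The functions on an affine chart. -/
def chartRingEquiv {P : Scheme.{u}} {B : Type u} [CommRing B] (g : Spec (.of B) ⟶ P)
    [IsOpenImmersion g] : Γ(P, (chartOpen g).1) ≃+* B :=
  (g.appIso ⊤ ≪≫ Scheme.ΓSpecIso (.of B)).commRingCatIsoToRingEquiv

lemma ideal_chartOpen {P : Scheme.{u}} {B : Type u} [CommRing B] (g : Spec (.of B) ⟶ P)
    [IsOpenImmersion g] {I : P.IdealSheafData} {𝔟 : Ideal B} (h : I.comap g = specIdeal 𝔟) :
    I.ideal (chartOpen g) = 𝔟.map (chartRingEquiv g).symm.toRingHom := by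
  have h1 := (I.ideal_comap_of_isOpenImmersion g ⟨⊤, isAffineOpen_top _⟩).symm.trans
    (congr(IdealSheafData.ideal $h ⟨⊤, isAffineOpen_top _⟩).trans (specIdeal_ideal_top 𝔟))
  have h2 : Ideal.comap (chartRingEquiv g).symm.toRingHom (I.ideal (chartOpen g)) = 𝔟 := by
    refine (congr(Ideal.comap (Scheme.ΓSpecIso (.of B)).inv.hom $h1) :).trans ?_
    ext x
    have h3 := congr(($((Scheme.ΓSpecIso (.of B)).inv_hom_id)).hom x)
    change (Scheme.ΓSpecIso (.of B)).hom.hom ((Scheme.ΓSpecIso (.of B)).inv.hom x) ∈ 𝔟 ↔ x ∈ 𝔟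
    exact congr($h3 ∈ 𝔟).to_iff
  rw [← h2]
  exact (Ideal.map_comap_of_surjective (chartRingEquiv g).symm.toRingHom
    (chartRingEquiv g).symm.surjective _).symm

/-- Residual subschemes can be computed on affine charts. -/
lemma isResidual_of_charts {P : Scheme.{u}} {J : Type*} {B : J → Type u} [∀ c, CommRing (B c)]
    (g : ∀ c, Spec (.of (B c)) ⟶ P) [∀ c, IsOpenImmersion (g c)]
    (hg : ∀ z : P, ∃ c, z ∈ Set.range (g c)) {D W R : P.IdealSheafData} (hWD : W ≤ D)
    (t : ∀ c, B c) (ht : ∀ c, t c ∈ nonZeroDivisors (B c)) (𝔴 𝔯 : ∀ c, Ideal (B c))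
    (hD : ∀ c, D.comap (g c) = specIdeal (Ideal.span {t c}))
    (hW : ∀ c, W.comap (g c) = specIdeal (𝔴 c)) (hR : ∀ c, R.comap (g c) = specIdeal (𝔯 c))
    (h : ∀ c, 𝔴 c = Ideal.span {t c} * 𝔯 c) : IsResidual D W R := by
  have hcov : ∀ z : P, ∃ c, z ∈ (chartOpen (g c)).1 := fun z => by
    obtain ⟨c, y, rfl⟩ := hg z
    exact ⟨c, y, trivial, rfl⟩
  refine ⟨fun z => ?_, hWD, ?_⟩
  · obtain ⟨c, hc⟩ := hcov z
    refine ⟨chartOpen (g c), hc, (chartRingEquiv (g c)).symm (t c), ?_, ?_⟩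
    · exact (MulEquivClass.map_nonZeroDivisors (chartRingEquiv (g c)).symm).le ⟨_, ht c, rfl⟩
    · rw [ideal_chartOpen (g c) (hD c), Ideal.map_span, Set.image_singleton]
      rfl
  · refine IdealSheafData.ext_of_iSup_eq_top (fun c => chartOpen (g c))
      (eq_top_iff.mpr fun z _ => TopologicalSpace.Opens.mem_iSup.mpr (hcov z)) fun c => ?_
    rw [IdealSheafData.ideal_mul, Pi.mul_apply, ideal_chartOpen (g c) (hD c),
      ideal_chartOpen (g c) (hW c), ideal_chartOpen (g c) (hR c), ← Ideal.map_mul, ← h]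

end ChartIdeal

end QSymBlowUp

namespace QSymBlowUp

open Limits HomogeneousLocalization HomogeneousIdeal Scheme

/-! ### The charts of a blow-up -/

section ReesAway

variable {R : Type u} [CommRing R] {I : Ideal R}

lemma reesDeg_eq_reesMonomial {d : ℕ} {p : reesAlgebra I} (hp : p ∈ reesDeg I d) :
    ∃ (y : R) (hy : y ∈ I ^ d), p = reesMonomial I d y hy := by
  refine ⟨_, p.2 d, ?_⟩
  ext1
  ext i
  rw [reesMonomial, Polynomial.coeff_monomial]
  split_ifs with h
  · rw [h]
  · exact hp i (Ne.symm h)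

/-- The irrelevant ideal of the Rees algebra is generated in degree one. -/
lemma irrelevant_reesDeg_le : (irrelevant (reesDeg I)).toIdeal ≤
    Ideal.span (Set.range fun x : I => reesMonomial I 1 (x : R) (by simp)) := by
  rw [toIdeal_irrelevant_le]
  intro n hn p hp
  obtain ⟨y, hy, rfl⟩ := reesDeg_eq_reesMonomial hp
  obtain ⟨n, rfl⟩ := Nat.exists_eq_succ_of_ne_zero hn.ne'
  have key : ∀ y (hy : y ∈ I ^ (n + 1)), reesMonomial I (n + 1) y hy ∈
      Ideal.span (Set.range fun x : I => reesMonomial I 1 (x : R) (by simp)) := by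
    intro y hy
    have hy' := hy
    rw [pow_succ'] at hy'
    induction hy' using Submodule.mul_induction_on' with
    | mem_mul_mem a ha b hb =>
      have h1 : reesMonomial I (n + 1) (a * b) hy =
          reesMonomial I n b hb * reesMonomial I 1 a (by simpa using ha) :=
        (Subtype.ext ((Polynomial.monomial_mul_monomial _ _ _ _).trans
          congr(Polynomial.monomial (n + 1) $(mul_comm b a)))).symm
      exact h1 ▸ Ideal.mul_mem_left _ _ (Ideal.subset_span ⟨⟨a, ha⟩, rfl⟩)
    | add a ha b hb iha ihb =>
      rw [← pow_succ'] at ha hb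
      have h1 : reesMonomial I (n + 1) (a + b) hy =
          reesMonomial I (n + 1) a ha + reesMonomial I (n + 1) b hb :=
        Subtype.ext (map_add (Polynomial.monomial (n + 1)) a b)
      exact h1 ▸ Ideal.add_mem _ (iha ha) (ihb hb)
  exact key y hy

variable {x : R} (hx : x ∈ I)

/-- The generator `x t` of the Rees algebra, for `x ∈ I`. -/
def reesGen : reesAlgebra I := reesMonomial I 1 x (by simpa using hx)

lemma reesGen_mem : reesGen hx ∈ reesDeg I 1 := reesMonomial_mem _ _ _ _

/-- The element `y t^n / (x t)^n`. -/
def reesFrac (n : ℕ) (y : R) (hy : y ∈ I ^ n) : Away (reesDeg I) (reesGen hx) :=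
  Away.mk _ (reesGen_mem hx) n (reesMonomial I n y hy) (by
    simpa using reesMonomial_mem I n y hy)

lemma reesFrac_surjective (z : Away (reesDeg I) (reesGen hx)) :
    ∃ n y hy, z = reesFrac hx n y hy := by
  obtain ⟨n, p, hp, rfl⟩ := Away.mk_surjective _ (reesGen_mem hx) z
  obtain ⟨y, hy, rfl⟩ := reesDeg_eq_reesMonomial (I := I) (d := n) (by simpa using hp)
  exact ⟨n, y, hy, rfl⟩

lemma reesGen_pow_mul {m : ℕ} {y : R} (hy : y ∈ I ^ m) (p n : ℕ) :
    ((reesGen hx ^ p * (reesGen hx ^ n * reesMonomial I m y hy) : reesAlgebra I) :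
      Polynomial R) = Polynomial.monomial (p + (n + m)) (x ^ (p + n) * y) := by
  have h : ∀ n, ((reesGen hx ^ n : reesAlgebra I) : Polynomial R) =
      Polynomial.monomial n (x ^ n) := fun n =>
    (SubmonoidClass.coe_pow _ _).trans ((Polynomial.monomial_pow _ _ _).trans (by rw [one_mul]))
  rw [MulMemClass.coe_mul, MulMemClass.coe_mul, h, h, reesMonomial,
    Polynomial.monomial_mul_monomial, Polynomial.monomial_mul_monomial, ← mul_assoc, ← pow_add]

/-- All the elements involved are monomials, so equality of fractions is an identity between
coefficients in `R`. -/
lemma reesFrac_eq_iff {m n : ℕ} {y z : R} {hy : y ∈ I ^ m} {hz : z ∈ I ^ n} :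
    reesFrac hx m y hy = reesFrac hx n z hz ↔ ∃ p : ℕ, x ^ (p + n) * y = x ^ (p + m) * z := by
  rw [← (HomogeneousLocalization.val_injective _).eq_iff, reesFrac, reesFrac, Away.val_mk,
    Away.val_mk, Localization.mk_eq_mk_iff, Localization.r_iff_exists]
  have key : ∀ p : ℕ, reesGen hx ^ p * (reesGen hx ^ n * reesMonomial I m y hy) =
      reesGen hx ^ p * (reesGen hx ^ m * reesMonomial I n z hz) ↔
        x ^ (p + n) * y = x ^ (p + m) * z := fun p => by
    rw [← Subtype.coe_injective.eq_iff, reesGen_pow_mul, reesGen_pow_mul, add_comm n m,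
      (Polynomial.monomial_injective _).eq_iff]
  constructor
  · rintro ⟨⟨_, p, rfl⟩, hp⟩
    exact ⟨p, (key p).mp hp⟩
  · rintro ⟨p, hp⟩
    exact ⟨⟨_, p, rfl⟩, (key p).mpr hp⟩

lemma reesFrac_mul {m n : ℕ} {y z : R} (hy : y ∈ I ^ m) (hz : z ∈ I ^ n)
    (hyz : y * z ∈ I ^ (m + n)) :
    reesFrac hx m y hy * reesFrac hx n z hz = reesFrac hx (m + n) (y * z) hyz := by
  apply HomogeneousLocalization.val_injective
  rw [HomogeneousLocalization.val_mul, reesFrac, reesFrac, reesFrac, Away.val_mk, Away.val_mk,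
    Away.val_mk, Localization.mk_mul]
  congr 1
  · exact Subtype.ext (Polynomial.monomial_mul_monomial _ _ _ _)
  · exact Subtype.ext (pow_add _ _ _).symm

lemma reesFrac_add {n : ℕ} {y z : R} (hy : y ∈ I ^ n) (hz : z ∈ I ^ n) (hyz : y + z ∈ I ^ n) :
    reesFrac hx n (y + z) hyz = reesFrac hx n y hy + reesFrac hx n z hz := by
  apply HomogeneousLocalization.val_injective
  rw [HomogeneousLocalization.val_add, reesFrac, reesFrac, reesFrac, Away.val_mk, Away.val_mk,
    Away.val_mk, Localization.add_mk_self]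
  congr 1
  exact Subtype.ext (map_add (Polynomial.monomial n) y z)

lemma reesFrac_congr {n : ℕ} {y z : R} (h : y = z) {hy : y ∈ I ^ n} {hz : z ∈ I ^ n} :
    reesFrac hx n y hy = reesFrac hx n z hz := by
  subst h
  rfl

/-- The structure map to the degree zero part of the localized Rees algebra. -/
def reesAwayStr : R →+* Away (reesDeg I) (reesGen hx) :=
  (fromZeroRingHom (reesDeg I) _).comp (toDegZero (algebraMap R (reesAlgebra I)) fun r i hi => by
    change (Polynomial.C r).coeff i = 0
    rw [Polynomial.coeff_C, if_neg hi])

lemma reesAwayStr_apply (r : R) : reesAwayStr hx r = reesFrac hx 0 r (by simp) :=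
  fromZeroRingHom_eq_mk (reesGen_mem hx) _

lemma reesAwayStr_mul {r : R} {n : ℕ} {y : R} (hy : y ∈ I ^ n) :
    reesAwayStr hx r * reesFrac hx n y hy = reesFrac hx n (r * y) (Ideal.mul_mem_left _ _ hy) := by
  rw [reesAwayStr_apply, reesFrac_mul hx (by simp) hy
    (by rw [zero_add]; exact Ideal.mul_mem_left _ _ hy), reesFrac_eq_iff]
  exact ⟨0, by simp⟩

/-- Since `y = x · (y t / x t)`, the ideal `I` becomes principal on this chart. -/
lemma reesAwayStr_eq_mul {y : R} (hy : y ∈ I) : reesAwayStr hx y =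
    reesAwayStr hx x * reesFrac hx 1 y (by simpa using hy) := by
  rw [reesAwayStr_mul, reesAwayStr_apply, reesFrac_eq_iff]
  exact ⟨0, by ring⟩

lemma map_reesAwayStr : I.map (reesAwayStr hx) = Ideal.span {reesAwayStr hx x} := by
  refine le_antisymm ?_ ?_
  · rw [Ideal.map_le_iff_le_comap]
    intro y hy
    exact Ideal.mem_span_singleton.mpr ⟨_, reesAwayStr_eq_mul hx hy⟩
  · rw [Ideal.span_singleton_le_iff_mem]
    exact Ideal.mem_map_of_mem _ hx

/-- If `x` kills a fraction with numerator `y`, some power of `x` kills `y`; the fraction is then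
already zero because `x t` is inverted. -/
lemma reesAwayStr_mem_nonZeroDivisors :
    reesAwayStr hx x ∈ nonZeroDivisors (Away (reesDeg I) (reesGen hx)) := by
  rw [mem_nonZeroDivisors_iff_right]
  intro z hz
  obtain ⟨n, y, hy, rfl⟩ := reesFrac_surjective hx z
  have h0 : (0 : Away (reesDeg I) (reesGen hx)) = reesFrac hx 0 0 (by simp) := by
    rw [← reesAwayStr_apply, map_zero]
  rw [mul_comm, reesAwayStr_mul, h0, reesFrac_eq_iff] at hz
  obtain ⟨p, hp⟩ := hz
  rw [h0, reesFrac_eq_iff]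
  exact ⟨p + 1, by rw [mul_zero] at hp ⊢; rw [← hp]; ring⟩

/-- For `w = a b` with `a ∈ K` and `b ∈ I ^ d`, the factor `x` raises `b` into `I ^ (d + 1)`, so `a`
can be split off as a scalar. -/
lemma reesFrac_mul_mem_map {K : Ideal R} {d : ℕ} {w : R} (hwK : w ∈ K * I ^ d)
    (hw : x * w ∈ I ^ (d + 1)) :
    reesFrac hx (d + 1) (x * w) hw ∈ K.map (reesAwayStr hx) := by
  have hI : ∀ c ∈ I ^ d, x * c ∈ I ^ (d + 1) := fun c hc => by
    rw [pow_succ']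
    exact Ideal.mul_mem_mul hx hc
  have hle : K * I ^ d ≤ I ^ d := Ideal.mul_le_right
  induction hwK using Submodule.mul_induction_on' with
  | mem_mul_mem a ha b hb =>
    have h1 : reesFrac hx (d + 1) (x * (a * b)) hw =
        reesAwayStr hx a * reesFrac hx (d + 1) (x * b) (hI b hb) :=
      (reesFrac_congr hx (mul_left_comm x a b)).trans (reesAwayStr_mul hx (hI b hb)).symm
    have h2 : reesAwayStr hx a ∈ K.map (reesAwayStr hx) := Ideal.mem_map_of_mem _ ha
    exact h1 ▸ Ideal.mul_mem_right _ _ h2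
  | add a ha b hb iha ihb =>
    have ha' := hI a (hle ha)
    have hb' := hI b (hle hb)
    have h1 : reesFrac hx (d + 1) (x * (a + b)) hw =
        reesFrac hx (d + 1) (x * a) ha' + reesFrac hx (d + 1) (x * b) hb' :=
      (reesFrac_congr hx (mul_add x a b)).trans
        (reesFrac_add hx ha' hb' (Ideal.add_mem _ ha' hb'))
    exact h1 ▸ Ideal.add_mem _ (iha ha') (ihb hb')

variable {B : Type u} [CommRing B] {ℬ : ℕ → AddSubgroup B} [GradedRing ℬ]

/-- The ideal of a closed subscheme of a chart of the blow-up of `I`, for the graded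
quotient of the Rees algebra by `⨁ K I ^ (d - 1)`. -/
lemma map_reesAwayStr_eq_mul_ker {K : Ideal R} (hK : K ≤ I) (φ : reesDeg I →+*ᵍ ℬ)
    (hφ : ∀ (d : ℕ) (y : R) (hy : y ∈ I ^ d),
      φ (reesMonomial I d y hy) = 0 ↔ y ∈ K * I ^ (d - 1)) :
    K.map (reesAwayStr hx) =
      Ideal.span {reesAwayStr hx x} * RingHom.ker (Away.map φ (reesGen hx)) := by
  refine le_antisymm ?_ ?_
  · rw [Ideal.map_le_iff_le_comap]
    intro y hy
    -- The cofactor `y t / x t` lies in the kernel by the case `d = 1` of `hφ`.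
    rw [Ideal.mem_comap, reesAwayStr_eq_mul hx (hK hy)]
    refine Ideal.mul_mem_mul (Ideal.mem_span_singleton_self _) ?_
    rw [RingHom.mem_ker, reesFrac, Away.map_mk]
    apply HomogeneousLocalization.val_injective
    rw [Away.val_mk, HomogeneousLocalization.val_zero,
      (hφ 1 y (by simpa using hK hy)).mpr (by simpa using hy), Localization.mk_zero]
  · rw [Ideal.span_singleton_mul_le_iff]
    intro z hz
    obtain ⟨n, y, hy, rfl⟩ := reesFrac_surjective hx z
    rw [RingHom.mem_ker, reesFrac, Away.map_mk] at hz
    have h1 := congr(HomogeneousLocalization.val $hz)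
    rw [Away.val_mk, HomogeneousLocalization.val_zero, Localization.mk_eq_mk',
      IsLocalization.mk'_eq_zero_iff] at h1
    obtain ⟨⟨_, p, rfl⟩, hp⟩ := h1
    -- One factor more than the `p` that annihilate the numerator: the degree is then positive, so
    -- that `d - 1` in `hφ` is a true predecessor, and `x` times the fraction has the form required
    -- by `reesFrac_mul_mem_map`.
    have hpy : x ^ (p + 1) * y ∈ I ^ (p + (1 + n)) := by
      rw [← add_assoc, pow_add]
      exact Ideal.mul_mem_mul (Ideal.pow_mem_pow hx _) hy
    have h2 : reesMonomial I _ _ hpy =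
        reesGen hx ^ p * (reesGen hx ^ 1 * reesMonomial I n y hy) :=
      Subtype.ext (reesGen_pow_mul hx hy p 1).symm
    have h3 : φ (reesMonomial I _ _ hpy) = 0 := by
      have h4 : φ (reesGen hx) ^ p * φ (reesMonomial I n y hy) = 0 := hp
      rw [h2, map_mul, map_mul, map_pow, map_pow, mul_left_comm, h4, mul_zero]
    have h5 := (hφ _ _ hpy).mp h3
    have h8 : p + (1 + n) - 1 = p + n := by omega
    rw [h8] at h5
    have h9 : x * (x ^ (p + 1) * y) ∈ I ^ (p + n + 1) := by
      have : p + n + 1 = p + (1 + n) := by omega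
      rw [this]
      exact Ideal.mul_mem_left _ _ hpy
    have h10 : reesAwayStr hx x * reesFrac hx n y hy = reesFrac hx (p + n + 1) _ h9 := by
      rw [reesAwayStr_mul, reesFrac_eq_iff]
      exact ⟨0, by ring⟩
    exact h10 ▸ reesFrac_mul_mem_map hx h5 h9

end ReesAway

end QSymBlowUp

namespace QSymBlowUp

open Limits HomogeneousLocalization HomogeneousIdeal Scheme

/-! ### The principal transform -/

namespace Ambient

variable {k : Type u} [Field k] {X Y : Scheme.{u}} {sX : X ⟶ Spec (.of k)}
  {j : Y ⟶ X} [IsClosedImmersion j] {M : Ambient sX}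

/-- The affine chart of the blow-up of `J` over the affine open `V` given by `x ∈ J(V)`. -/
def blowUpChart {P : Scheme.{u}} (J : P.IdealSheafData) (V : P.affineOpens) {x : Γ(P, V.1)}
    (hx : x ∈ J.ideal V) :
    Spec (.of (Away (reesDeg (J.ideal V)) (reesGen hx))) ⟶ blowUp J :=
  Proj.awayι _ (reesGen hx) (reesGen_mem hx) one_pos ≫ blowUp.ι J V

instance {P : Scheme.{u}} (J : P.IdealSheafData) (V : P.affineOpens) :
    IsOpenImmersion (blowUp.ι J V) :=
  inferInstanceAs (IsOpenImmersion (GradedAlg.relProj.ι _ _))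

instance {P : Scheme.{u}} (J : P.IdealSheafData) (V : P.affineOpens) {x : Γ(P, V.1)}
    (hx : x ∈ J.ideal V) : IsOpenImmersion (blowUpChart J V hx) :=
  inferInstanceAs (IsOpenImmersion (Proj.awayι _ _ _ _ ≫ blowUp.ι J V))

lemma exists_mem_range_blowUpChart {P : Scheme.{u}} (J : P.IdealSheafData) (z : blowUp J) :
    ∃ (V : P.affineOpens) (x : J.ideal V), z ∈ Set.range (blowUpChart J V x.2) := by
  obtain ⟨V, y, rfl⟩ := GradedAlg.relProj.exists_mem_range_ι (reesAlg_isQuasiCoherent J) z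
  -- The irrelevant ideal being generated in degree one, the charts attached to elements of `J`
  -- cover the blow-up.
  obtain ⟨x, w, hw⟩ := (Proj.affineOpenCoverOfIrrelevantLESpan (reesDeg (J.ideal V))
    (fun x : J.ideal V => reesGen x.2) (fun x => reesGen_mem x.2) (fun _ => one_pos)
    irrelevant_reesDeg_le).openCover.exists_eq y
  refine ⟨V, x, w, ?_⟩
  exact congr(blowUp.ι J V $hw)

lemma blowUpChart_toBase {P : Scheme.{u}} (J : P.IdealSheafData) (V : P.affineOpens)
    {x : Γ(P, V.1)} (hx : x ∈ J.ideal V) :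
    blowUpChart J V hx ≫ blowUp.toBase J =
      Spec.map (CommRingCat.ofHom (reesAwayStr hx)) ≫ V.2.fromSpec := by
  have h1 : blowUp.ι J V ≫ blowUp.toBase J = projToSpec (reesDeg (J.ideal V)) _
      ((reesAlg J).str_mem V) ≫ V.2.fromSpec :=
    GradedAlg.relProj.ι_toBase (reesAlg_isQuasiCoherent J) V
  refine (Category.assoc _ _ _).trans (congr(_ ≫ $h1).trans ?_)
  refine (Category.assoc _ _ _).symm.trans congr($(?_) ≫ V.2.fromSpec)
  exact awayι_projToSpec _ ((reesAlg J).str_mem V) (reesGen hx) (reesGen_mem hx) one_pos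

lemma comap_blowUpChart {P : Scheme.{u}} (J I : P.IdealSheafData) (V : P.affineOpens)
    {x : Γ(P, V.1)} (hx : x ∈ J.ideal V) :
    (I.comap (blowUp.toBase J)).comap (blowUpChart J V hx) =
      specIdeal ((I.ideal V).map (reesAwayStr hx)) := by
  rw [← IdealSheafData.comap_comp, blowUpChart_toBase, IdealSheafData.comap_comp, comap_fromSpec]
  exact comap_specIdeal _ _

variable {𝒜 : GradedAlg X} (hQ : 𝒜.IsQuasiCoherent)
  (φ : ∀ V : M.scheme.affineOpens, reesDeg ((j ≫ M.ι).ker.ideal V) →+*ᵍ 𝒜.deg (M.res V))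
  (hφ : ∀ V, Function.Surjective (φ V))
  (e : GradedAlg.relProj hQ ⟶ blowUp (j ≫ M.ι).ker)
  (he : e ≫ blowUp.toBase (j ≫ M.ι).ker = GradedAlg.relProj.toBase hQ ≫ M.ι)
  (heφ : ∀ V : M.scheme.affineOpens,
    Proj.map (φ V) (irrelevant_le_of_surjective (φ V) (hφ V)) ≫ blowUp.ι (j ≫ M.ι).ker V =
      GradedAlg.relProj.ι hQ (M.res V) ≫ e)

include he heφ in
-- Two Cartesian squares are pasted, one for `Proj` over an affine chart and one for the open `Proj`
-- inside the relative one. The kernel of `e` on a chart can thus be read off from a ring map.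
lemma isPullback_blowUpChart (V : M.scheme.affineOpens) {x : Γ(M.scheme, V.1)}
    (hx : x ∈ (j ≫ M.ι).ker.ideal V) :
    IsPullback (Spec.map (CommRingCat.ofHom (Away.map (φ V) (reesGen hx))))
      (Proj.awayι _ (φ V (reesGen hx)) ((φ V).2 (reesGen_mem hx)) one_pos ≫
        GradedAlg.relProj.ι hQ (M.res V))
      (blowUpChart (j ≫ M.ι).ker V hx) e := by
  refine (isPullback_awayι (φ V) (irrelevant_le_of_surjective (φ V) (hφ V)) one_pos
    (reesGen_mem hx)).paste_vert ?_
  refine IsOpenImmersion.isPullback _ _ _ _ (heφ V).symm (le_antisymm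
    (GradedAlg.relProj.preimage_range_le hQ (reesAlg_isQuasiCoherent _) he V) ?_)
  rintro _ ⟨y, rfl⟩
  exact ⟨_, congr($(heφ V) y)⟩

set_option maxHeartbeats 1000000 in
/-- A closed subscheme `Proj 𝒜` of the blow-up of `J_{Y,M}` with ideal `⨁ J_{X,M} J_{Y,M}^(d-1)`
is the principal transform of `X`. -/
lemma isPrincipalTransform_of_ker [IsClosedImmersion e]
    (hker : ∀ (V : M.scheme.affineOpens) (d : ℕ) (x : Γ(M.scheme, V.1))
      (hx : x ∈ (j ≫ M.ι).ker.ideal V ^ d),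
      φ V (reesMonomial ((j ≫ M.ι).ker.ideal V) d x hx) = 0 ↔
        x ∈ M.ι.ker.ideal V * (j ≫ M.ι).ker.ideal V ^ (d - 1))
    (he : e ≫ blowUp.toBase (j ≫ M.ι).ker = GradedAlg.relProj.toBase hQ ≫ M.ι)
    (heφ : ∀ V : M.scheme.affineOpens,
      Proj.map (φ V) (irrelevant_le_of_surjective (φ V) (hφ V)) ≫ blowUp.ι (j ≫ M.ι).ker V =
        GradedAlg.relProj.ι hQ (M.res V) ≫ e) :
    IsPrincipalTransform M.ι j e.ker := by
  have hle : M.ι.ker ≤ (j ≫ M.ι).ker := Hom.le_ker_comp j M.ι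
  refine isResidual_of_charts (J := Σ V : M.scheme.affineOpens, (j ≫ M.ι).ker.ideal V)
    (B := fun c => Away (reesDeg ((j ≫ M.ι).ker.ideal c.1)) (reesGen c.2.2))
    (fun c => blowUpChart (j ≫ M.ι).ker c.1 c.2.2)
    (fun z => ?_) (IdealSheafData.comap_mono _ hle) (fun c => reesAwayStr c.2.2 c.2)
    (fun c => reesAwayStr_mem_nonZeroDivisors c.2.2)
    (fun c => (M.ι.ker.ideal c.1).map (reesAwayStr c.2.2))
    (fun c => RingHom.ker (Away.map (φ c.1) (reesGen c.2.2)))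
    (fun c => ?_) (fun c => ?_) (fun c => ?_) (fun c => ?_)
  · obtain ⟨V, x, hx⟩ := exists_mem_range_blowUpChart _ z
    exact ⟨⟨V, x⟩, hx⟩
  · exact (comap_blowUpChart (j ≫ M.ι).ker (j ≫ M.ι).ker c.1 c.2.2).trans
      congr(specIdeal $(map_reesAwayStr c.2.2))
  · exact comap_blowUpChart (j ≫ M.ι).ker M.ι.ker c.1 c.2.2
  · exact (comap_eq_ker_of_isPullback (isPullback_blowUpChart hQ φ hφ e he heφ c.1 c.2.2)).trans
      (ker_specMap _)
  · exact map_reesAwayStr_eq_mul_ker c.2.2 (hle c.1) (φ c.1) (hker c.1)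

end Ambient

end QSymBlowUp

end

/-! ### Assembly of the limit, the closed embedding and the principal transform. -/

theorem mainTheorem5 {k : Type u} [Field k] {Y X M : Scheme.{u}}
    (sM : M ⟶ Spec (.of k)) [Smooth sM] [QuasiCompact sM]
    (i : X ⟶ M) [IsClosedImmersion i] (j : Y ⟶ X) [IsClosedImmersion j] :
    (∃ Q : QSymCone (i ≫ sM) j, Q.IsLimit) ∧
    ∀ Q : QSymCone (i ≫ sM) j, Q.IsLimit →
      ∃ (hQ : Q.alg.IsQuasiCoherent)
        (φ : ∀ V : M.affineOpens,
          reesDeg ((j ≫ i).ker.ideal V) →+*ᵍ Q.alg.deg ((Ambient.of sM i).res V))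
        (hφ : ∀ V : M.affineOpens, Function.Surjective (φ V)),
        (∀ V : M.affineOpens, Function.Bijective (Q.proj (Ambient.of sM i) V)) ∧
        (∀ (V : M.affineOpens) (x : reesAlgebra ((j ≫ i).ker.ideal V)),
          Q.proj (Ambient.of sM i) V (φ V x) = (Ambient.of sM i).reesToQSym j V x) ∧
        (∀ (V : M.affineOpens) (d : ℕ) (x : Γ(M, V)) (hx : x ∈ (j ≫ i).ker.ideal V ^ d),
          φ V (reesMonomial ((j ≫ i).ker.ideal V) d x hx) = 0 ↔
            x ∈ i.ker.ideal V * (j ≫ i).ker.ideal V ^ (d - 1)) ∧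
        ∃ e : GradedAlg.relProj hQ ⟶ blowUp (j ≫ i).ker,
          IsClosedImmersion e ∧
          e ≫ blowUp.toBase (j ≫ i).ker = GradedAlg.relProj.toBase hQ ≫ i ∧
          (∀ V : M.affineOpens,
            Proj.map (φ V) (irrelevant_le_of_surjective (φ V) (hφ V)) ≫
                blowUp.ι (j ≫ i).ker V =
              GradedAlg.relProj.ι hQ ((Ambient.of sM i).res V) ≫ e) ∧
          IsPrincipalTransform i j e.ker := by
  let 𝓜 := Ambient.of sM i
  haveI : Smooth 𝓜.str := inferInstanceAs (Smooth sM)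
  refine ⟨⟨_, 𝓜.familyCone_isLimit j⟩, fun Q hQ => ?_⟩
  have hqc := Ambient.isQuasiCoherent_of_isLimit (M := 𝓜) hQ
  have hsurj := Ambient.reesToLimit_surjective (M := 𝓜) hQ
  obtain ⟨e, he, hbase, hι⟩ := GradedAlg.relProj.exists_closedImmersion (M := 𝓜) hqc
    (reesAlg_isQuasiCoherent (j ≫ i).ker) (Ambient.reesToLimit (M := 𝓜) hQ) hsurj
    (Ambient.map_reesToLimit hQ) (Ambient.reesToLimit_algebraMap hQ)
  haveI : IsClosedImmersion (Y := blowUp (j ≫ 𝓜.ι).ker) e := he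
  have hker := fun V d x hx => Ambient.reesToLimit_reesMonomial_eq_zero_iff (M := 𝓜) hQ V
    (d := d) (x := x) hx
  exact ⟨hqc, Ambient.reesToLimit (M := 𝓜) hQ, hsurj, Ambient.proj_bijective (M := 𝓜) hQ,
    Ambient.proj_reesToLimit (M := 𝓜) hQ, hker, e, he, hbase, hι,
    Ambient.isPrincipalTransform_of_ker (M := 𝓜) hqc _ hsurj e hker hbase hι⟩
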